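/- Let $J:\mathbb{R}\to[0,\infty)$ be of class $C^2$ with $J(0)=0$, $J>0$ on $(0,\infty)$, $J'>0$ on $(0,1]$, and $J''>0$ on $(0,\rho_0)$ for some $\rho_0>0$. For $R>1$ set $$I(R)=\sup\Big\{\int_1^R\frac{1-f^2}{r}\,dr\ :\ \int_1^R J(1-f^2)\,r\,dr\le 1\Big\},$$ the supremum being over measurable $f:[1,R]\to\mathbb{R}$ for which both integrals are finite. Let $p_0>0$, $a>0$, $K\in\mathbb{R}$ and integers $m,d\ge 0$ be given. Then there is a constant $C$, depending only on $J$, $p_0$, $a$, $d$, $m$ and $K$, with the following property. Let $R_0>0$ and $R$ satisfy $R_0\le R/4$, let $a_1,\dots,a_m\in\mathbb{C}$ satisfy $|a_i|\le R/2$ for all $i$ and $|a_i-a_j|\ge 4R_0$ for all $i\ne j$, and put $\Omega=B_R(0)\setminus\bigcup_{j=1}^m \overline{B_{R_0}(a_j)}$. Let $p:\Omega\to\mathbb{R}$ be continuous with $p\ge p_0$ on $\Omega$. Let $u:\overline\Omega\to\mathbb{C}$ be continuous, of class $C^1$ in $\Omega$, with $a\le|u|\le 1$ in $\Omega$, $\deg(u,\partial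 B_{R_0}(a_j))=d_j$ for $j=1,\dots,m$, where $\sum_{j=1}^m|d_j|=d$, and $$\frac1{R_0^2}\int_\Omega J(1-|u|^2)\le K.$$ Then (the left-hand side being possibly $+\infty$; the sums over $i\neq j$ are over ordered pairs) $$\int_\Omega p|\nabla u|^2\ \ge\ 2\pi p_0\Big(\sum_{i=1}^m d_i^2\Big)\Big(\log\frac{R}{R_0}-I\Big(\frac{R}{R_0}\Big)\Big)+2\pi p_0\sum_{i\ne j}\big(d_id_j-(1-a^2)|d_i||d_j|\big)\log\frac{R}{|a_i-a_j|}-C.$$ In particular, if moreover $d_i\ge 0$ for all $i$, then, with the same $C$, $$\int_\Omega p|\nabla u|^2\ \ge\ 2\pi p_0\Big(\sum_{i=1}^m d_i^2\Big)\Big(\log\frac{R}{R_0}-I\Big(\frac{R}{R_0}\Big)\Big)+2\pi p_0a^2\sum_{i\ne j}d_id_j\log\frac{R}{|a_i-a_j|}-C.$$ -/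

import Mathlib

open MeasureTheory Set

noncomputable section

namespace WeightedGL

/-- The class of potentials: `J : ℝ → [0,∞)` of class `C²` with (H1) `J 0 = 0` and `J > 0` on
`(0,∞)`; (H2) `J' > 0` on `(0,1]`; (H3) `J'' > 0` on `(0,ρ₀)` for some `ρ₀ > 0`. -/
structure IsPotential (J : ℝ → ℝ) : Prop where
  contDiff : ContDiff ℝ 2 J
  nonneg : ∀ t, 0 ≤ J t
  zero : J 0 = 0
  pos : ∀ t, 0 < t → 0 < J t
  deriv_pos : ∀ t ∈ Ioc (0 : ℝ) 1, 0 < deriv J t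
  deriv_two_pos : ∃ ρ₀ : ℝ, 0 < ρ₀ ∧ ∀ t ∈ Ioo (0 : ℝ) ρ₀, 0 < iteratedDeriv 2 J t

/-- Admissible profiles for the one-dimensional problem on `[1,R]` with budget `c`: measurable
`f : ℝ → ℝ` for which both integrals exist and `∫₁ᴿ J(1 - f²) r dr ≤ c`. -/
def Admissible (J : ℝ → ℝ) (R c : ℝ) (f : ℝ → ℝ) : Prop :=
  Measurable f ∧
  IntervalIntegrable (fun r => (1 - f r ^ 2) / r) volume 1 R ∧
  IntervalIntegrable (fun r => J (1 - f r ^ 2) * r) volume 1 R ∧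
  ∫ r in (1 : ℝ)..R, J (1 - f r ^ 2) * r ≤ c

/-- `I(R,c) = sup { ∫₁ᴿ (1 - f²)/r dr : ∫₁ᴿ J(1 - f²) r dr ≤ c }`, for `R > 1`, `c > 0`. -/
def profileSup (J : ℝ → ℝ) (R c : ℝ) : ℝ :=
  sSup {y : ℝ | ∃ f : ℝ → ℝ, Admissible J R c f ∧ y = ∫ r in (1 : ℝ)..R, (1 - f r ^ 2) / r}

/-- `I(R) = I(R,1)`. -/
def profileI (J : ℝ → ℝ) (R : ℝ) : ℝ := profileSup J R 1

/-- For `R > 1` the supremum defining `I(R,c)` is over a nonempty set bounded above, so it is a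
genuine real supremum. -/
theorem profileSup_isLUB {J : ℝ → ℝ} (hJ : IsPotential J) {R c : ℝ} (hR : 1 < R) (hc : 0 ≤ c) :
    IsLUB {y : ℝ | ∃ f : ℝ → ℝ, Admissible J R c f ∧ y = ∫ r in (1 : ℝ)..R, (1 - f r ^ 2) / r}
      (profileSup J R c) := by
  apply isLUB_csSup
  · refine ⟨_, fun _ => 1, ⟨measurable_const, ?_, ?_, ?_⟩, rfl⟩ <;> simp [hJ.zero, hc]
  · refine ⟨∫ r in (1 : ℝ)..R, 1 / r, ?_⟩
    rintro y ⟨f, ⟨-, hf, -, -⟩, rfl⟩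
    apply intervalIntegral.integral_mono_on hR.le hf
    · apply intervalIntegral.intervalIntegrable_one_div
      · intro x hx
        rw [uIcc_of_le hR.le] at hx
        have := hx.1
        positivity
      · exact continuousOn_id
    · intro x hx
      have h1 : (0 : ℝ) < x := lt_of_lt_of_le one_pos hx.1
      apply div_le_div_of_nonneg_right _ h1.le
      nlinarith [sq_nonneg (f x)]

/-- The perforated disc `Ω = B_R(0) \ ⋃ⱼ B_{R₀}(aⱼ)` (open disc, closed holes, so `Ω` is open). -/
def perforatedDisc {m : ℕ} (R R₀ : ℝ) (pts : Fin m → ℂ) : Set ℂ :=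
  Metric.ball 0 R \ ⋃ j, Metric.closedBall (pts j) R₀

/-- `|∇u|² = |∂ₓu|² + |∂ᵧu|²` for `u : ℝ² → ℂ`, the plane being identified with `ℂ`. -/
def gradSq (u : ℂ → ℂ) (z : ℂ) : ℝ :=
  ‖fderiv ℝ u z 1‖ ^ 2 + ‖fderiv ℝ u z Complex.I‖ ^ 2

/-- `deg(u, ∂B_r(c)) = n`: `u` does not vanish on the circle, and along the positively oriented
circle `t ↦ c + r e^{it}`, `0 ≤ t ≤ 2π`, some continuous determination `θ` of the argument of `u`
increases by `2πn`. -/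
def HasDegreeOnCircle (u : ℂ → ℂ) (c : ℂ) (r : ℝ) (n : ℤ) : Prop :=
  (∀ z ∈ Metric.sphere c r, u z ≠ 0) ∧
  ∃ θ : ℝ → ℝ, ContinuousOn θ (Icc 0 (2 * Real.pi)) ∧
    (∀ t ∈ Icc (0 : ℝ) (2 * Real.pi),
      u (circleMap c r t) = (‖u (circleMap c r t)‖ : ℂ) * Complex.exp (θ t * Complex.I)) ∧
    θ (2 * Real.pi) - θ 0 = 2 * Real.pi * n

/-- The configurations: points `aⱼ ∈ B_R(0)` with `|aᵢ - aⱼ| ≥ 4R₀` for `i ≠ j`, `|aᵢ| ≤ R/2`,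
`0 < R₀ ≤ R/4`, and a map `u`, of class `C¹` in `Ω` and continuous up to `∂Ω`, with
`a ≤ |u| ≤ 1` in `Ω`, `deg(u, ∂B_{R₀}(aⱼ)) = dⱼ` and `R₀⁻² ∫_Ω J(1 - |u|²) ≤ K`. -/
structure IsConfiguration (J : ℝ → ℝ) (a K : ℝ) {m : ℕ} (R R₀ : ℝ) (pts : Fin m → ℂ)
    (deg : Fin m → ℤ) (u : ℂ → ℂ) : Prop where
  radius_pos : 0 < R₀
  radius_le : R₀ ≤ R / 4
  separated : ∀ i j, i ≠ j → 4 * R₀ ≤ ‖pts i - pts j‖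
  norm_le : ∀ i, ‖pts i‖ ≤ R / 2
  contDiffOn : ContDiffOn ℝ 1 u (perforatedDisc R R₀ pts)
  continuousOn : ContinuousOn u (closure (perforatedDisc R R₀ pts))
  bounds : ∀ z ∈ perforatedDisc R R₀ pts, a ≤ ‖u z‖ ∧ ‖u z‖ ≤ 1
  degree : ∀ j, HasDegreeOnCircle u (pts j) R₀ (deg j)
  potential_le : 1 / R₀ ^ 2 * ∫ z in perforatedDisc R R₀ pts, J (1 - ‖u z‖ ^ 2) ≤ K

/-- The weighted Dirichlet energy `∫_Ω p |∇u|²` with values in `[0,∞]` (for `p ≥ 0` on `Ω`). -/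
def weightedEnergy (p : ℂ → ℝ) (u : ℂ → ℂ) (Ω : Set ℂ) : ENNReal :=
  ∫⁻ z in Ω, ENNReal.ofReal (p z * gradSq u z)

end WeightedGL

end

/-! The proof tests `|∇u|²` against one explicit vector field. For any vector `X`, Young's
inequality gives `|∇u|² ≥ 2 Im(∂_X u / u) - |X|²/|u|²` (`two_mul_im_sub_le`). Take `X = Σ dⱼ βⱼ(|z -
aⱼ|) ∇θⱼ`, where `θⱼ` is the angle around `aⱼ`. The coefficient `βⱼ(r)` vanishes unless the circle
of radius `r` about `aⱼ` stays away from the other holes and inside the disc; on such good radii it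
is the inverse of the mean of `W = 1/|u|²` on that circle.

The linear term is controlled by topology alone. After division by `∏ (z - aᵢ)^{dᵢ}`, `u` has a
continuous logarithm on a slightly smaller disc minus the holes (`exists_continuousOn_log`). Hence
on each good circle the current of `u` has the same circulation as `Σ dᵢ ∇θᵢ`, and the difference
integrates to zero against the radial `βⱼ` (`integral_defect`). What remains is a sum over pairs of
`dᵢ dⱼ ∫ (2βⱼ - βᵢβⱼW) ∇θᵢ·∇θⱼ`.

For `i = j` the choice of `βⱼ` is optimal and the integral equals `2π ∫ (1 - h)/r` over good radii,
with `h = 1 - 1/W̄`. The good radii carry all of `log (R/R₀)` up to a constant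
(`le_integral_goodRadii`). The loss `∫ h/r` is a competitor for the profile problem: a Jensen
inequality with multiplicative constant (`potential_circleAverage_le`, based on
`exists_support_line`) gives `h` a budget of order `R₀²`, and since `dr/r` is scale invariant,
normalizing that budget to `1` costs a constant (`integral_div_le_profileI`).

For `i ≠ j` the circle averages of `∇θᵢ·∇θⱼ` are winding numbers, so its integral is `2π log (R/|aᵢ
- aⱼ|)` up to a constant (`integral_angleKernel_goodSet`). The factor `2βⱼ - βᵢβⱼW` differs from `1`
by at most `(1 - a²)/2` plus a multiple of potential terms (`exists_weight_error`). Against the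
majorant `1/(|z - aᵢ||z - aⱼ|)`, whose integral is at most `4π log (R/|aᵢ - aⱼ|)` plus a constant,
the first error produces the `(1 - a²)|dᵢ||dⱼ|` loss; the second is bounded because the kernel is at
most `1/(4R₀²)` on the good set. -/

noncomputable section

namespace WeightedGL

/-! ### Continuous logarithms and degrees -/

/-- A continuous function on the circle, given by a periodic parametrisation, extends to the
plane. -/
theorem exists_continuous_extend_circleMap {ℓ : ℝ → ℂ} (c : ℂ) {r : ℝ} (hr : 0 < r)
    (hℓ : ContinuousOn ℓ (Icc 0 (2 * Real.pi))) (hper : ℓ 0 = ℓ (2 * Real.pi)) :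
    ∃ L : ℂ → ℂ, Continuous L ∧ ∀ t ∈ Icc (0 : ℝ) (2 * Real.pi), L (circleMap c r t) = ℓ t := by
  have : Fact (0 < 2 * Real.pi) := ⟨Real.two_pi_pos⟩
  let g : C(AddCircle (2 * Real.pi), ℂ) :=
    ⟨AddCircle.liftIco (2 * Real.pi) 0 ℓ, AddCircle.liftIco_zero_continuous hper hℓ⟩
  let e : AddCircle (2 * Real.pi) → ℂ := fun x => c + r * (AddCircle.toCircle x : ℂ)
  have hec : Continuous e := by
    refine continuous_const.add (continuous_const.mul ?_)
    exact continuous_subtype_val.comp AddCircle.continuous_toCircle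
  have hei : Function.Injective e := by
    intro x y hxy
    have h1 : (r : ℂ) * (AddCircle.toCircle x : ℂ) = r * (AddCircle.toCircle y : ℂ) :=
      add_left_cancel hxy
    have h2 := mul_left_cancel₀ (by exact_mod_cast hr.ne') h1
    exact AddCircle.injective_toCircle Real.two_pi_pos.ne' (Subtype.ext h2)
  -- Tietze extension: `e` embeds the abstract circle as a closed subset of the plane.
  obtain ⟨G, hG⟩ := ContinuousMap.exists_extension' (hec.isClosedEmbedding hei) g
  have he : ∀ t : ℝ, e (t : AddCircle (2 * Real.pi)) = circleMap c r t := by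
    intro t
    simp [e, circleMap, AddCircle.toCircle_apply_mk, Circle.coe_exp]
  have hmain : ∀ t ∈ Ico (0 : ℝ) (2 * Real.pi), G (circleMap c r t) = ℓ t := by
    intro t ht
    have h1 := congrFun hG (t : AddCircle (2 * Real.pi))
    simp only [Function.comp_apply, he] at h1
    rw [h1]
    exact AddCircle.liftIco_zero_coe_apply ht
  refine ⟨G, G.continuous, fun t ht => ?_⟩
  rcases eq_or_lt_of_le ht.2 with h | h
  · have h0 : circleMap c r (2 * Real.pi) = circleMap c r 0 := by
      simpa using periodic_circleMap c r 0
    rw [h, h0, ← hper]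
    exact hmain 0 ⟨le_rfl, Real.two_pi_pos⟩
  · exact hmain t ⟨ht.1, h⟩

/-- On the boundary of a hole of degree `n`, `u (z - c)⁻ⁿ` has a logarithm that extends
continuously to the plane. -/
theorem HasDegreeOnCircle.exists_log {u : ℂ → ℂ} {c : ℂ} {r : ℝ} {n : ℤ} (hr : 0 < r)
    (hu : ContinuousOn u (Metric.sphere c r)) (h : HasDegreeOnCircle u c r n) :
    ∃ L : ℂ → ℂ, Continuous L ∧
      ∀ z ∈ Metric.sphere c r, Complex.exp (L z) = u z * (z - c) ^ (-n) := by
  obtain ⟨hne, θ, hθ, hrep, hdeg⟩ := h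
  have hmem : ∀ t, circleMap c r t ∈ Metric.sphere c r := fun t =>
    circleMap_mem_sphere c hr.le t
  -- A logarithm of `u (z - c)⁻ⁿ` along the circle; it closes up because the gain `2πn` of `θ` is
  -- cancelled by that of `n t`.
  let ℓ : ℝ → ℂ := fun t => (Real.log ‖u (circleMap c r t)‖ : ℂ) + θ t * Complex.I
    - n * ((Real.log r : ℂ) + t * Complex.I)
  have hℓ : ContinuousOn ℓ (Icc 0 (2 * Real.pi)) := by
    have h1 : ContinuousOn (fun t => u (circleMap c r t)) (Icc 0 (2 * Real.pi)) :=
      hu.comp (continuous_circleMap c r).continuousOn fun t _ => hmem t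
    have h2 : ContinuousOn (fun t => Real.log ‖u (circleMap c r t)‖) (Icc 0 (2 * Real.pi)) :=
      h1.norm.log fun t _ => norm_ne_zero_iff.2 (hne _ (hmem t))
    have h3 := Complex.continuous_ofReal.comp_continuousOn h2
    have h4 := Complex.continuous_ofReal.comp_continuousOn hθ
    exact (h3.add (h4.mul continuousOn_const)).sub (by fun_prop)
  have h0 : circleMap c r (2 * Real.pi) = circleMap c r 0 := by
    simpa using periodic_circleMap c r 0
  have hper : ℓ 0 = ℓ (2 * Real.pi) := by
    have h1 : (θ (2 * Real.pi) : ℂ) = θ 0 + 2 * Real.pi * n := by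
      rw [← sub_eq_iff_eq_add']
      exact_mod_cast hdeg
    simp only [ℓ, h0, h1]
    push_cast
    ring
  obtain ⟨L, hL, hLe⟩ := exists_continuous_extend_circleMap c hr hℓ hper
  refine ⟨L, hL, fun z hz => ?_⟩
  obtain ⟨t₀, rfl⟩ : z ∈ range (circleMap c r) := by rwa [range_circleMap, abs_of_pos hr]
  obtain ⟨t, ht, htt⟩ := (periodic_circleMap c r).exists_mem_Ico₀ Real.two_pi_pos t₀
  rw [htt]
  have ht' : t ∈ Icc (0 : ℝ) (2 * Real.pi) := ⟨ht.1, ht.2.le⟩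
  rw [hLe t ht']
  have hpos : 0 < ‖u (circleMap c r t)‖ := norm_pos_iff.2 (hne _ (hmem t))
  have h1 : Complex.exp (Real.log r + t * Complex.I) = circleMap c r t - c := by
    rw [Complex.exp_add, ← Complex.ofReal_exp, Real.exp_log hr]
    simp [circleMap]
  rw [← h1, ← Complex.exp_int_mul]
  simp only [ℓ]
  rw [sub_eq_add_neg, Complex.exp_add, Complex.exp_add, ← Complex.ofReal_exp, Real.exp_log hpos,
    ← hrep t ht']
  push_cast
  ring_nf

/-- A continuous nonvanishing map on a disc with holes, of degree `dᵢ` around the `i`-th hole: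
after division by `∏ (z - aᵢ)^{dᵢ}` it has a continuous logarithm. -/
theorem exists_continuousOn_log {m : ℕ} {ρ R₀ : ℝ} {pts : Fin m → ℂ} {deg : Fin m → ℤ}
    {u : ℂ → ℂ} (hρ : 0 < ρ) (hR₀ : 0 < R₀)
    (hsep : ∀ i j, i ≠ j → 2 * R₀ < ‖pts i - pts j‖)
    (hin : ∀ i, ‖pts i‖ + R₀ ≤ ρ)
    (hu : ContinuousOn u (Metric.closedBall 0 ρ \ ⋃ j, Metric.ball (pts j) R₀))
    (hne : ∀ z ∈ Metric.closedBall 0 ρ \ ⋃ j, Metric.ball (pts j) R₀, u z ≠ 0)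
    (hdeg : ∀ j, HasDegreeOnCircle u (pts j) R₀ (deg j)) :
    ∃ Ψ : ℂ → ℂ, ContinuousOn Ψ (Metric.ball 0 ρ) ∧
      ∀ z ∈ Metric.ball 0 ρ \ ⋃ j, Metric.ball (pts j) R₀,
        Complex.exp (Ψ z) = u z * ∏ i, (z - pts i) ^ (-deg i) := by
  classical
  set A : Set ℂ := Metric.closedBall 0 ρ \ ⋃ j, Metric.ball (pts j) R₀ with hA
  have hdisj : ∀ i j z, i ≠ j → ‖z - pts i‖ ≤ R₀ → R₀ < ‖z - pts j‖ := by
    intro i j z hij hz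
    have h1 := hsep i j hij
    have h2 : ‖pts i - pts j‖ ≤ ‖z - pts i‖ + ‖z - pts j‖ := by
      rw [norm_sub_rev z (pts i)]
      simpa using norm_add_le (pts i - z) (z - pts j)
    linarith
  have hsph : ∀ i, Metric.sphere (pts i) R₀ ⊆ A := by
    intro i z hz
    have hz' : ‖z - pts i‖ = R₀ := by simpa [dist_eq_norm] using hz
    refine ⟨?_, ?_⟩
    · rw [mem_closedBall_zero_iff]
      have : ‖z‖ ≤ ‖z - pts i‖ + ‖pts i‖ := by simpa using norm_add_le (z - pts i) (pts i)
      linarith [hin i]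
    · simp only [mem_iUnion, Metric.mem_ball, dist_eq_norm, not_exists, not_lt]
      intro j
      by_cases hij : i = j
      · subst hij; exact hz'.ge
      · exact (hdisj i j z hij hz'.le).le
  choose L hL hLe using fun i => (hdeg i).exists_log hR₀ (hu.mono (hsph i))
  -- The singular factor of the `i`-th hole, together with `u`, is replaced inside that hole by `exp
  -- (L i)`. The glued function `V` is continuous and zero-free on the whole disc, which is simply
  -- connected, so it has a logarithm.
  let E : Fin m → ℂ → ℂ := fun i z =>
    Complex.exp (L i z) * ∏ k ∈ Finset.univ.erase i, (z - pts k) ^ (-deg k)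
  let F : ℂ → ℂ := fun z => u z * ∏ i, (z - pts i) ^ (-deg i)
  let V : ℂ → ℂ := fun z => if h : ∃ i, ‖z - pts i‖ ≤ R₀ then E h.choose z else F z
  have hVE : ∀ i z, ‖z - pts i‖ ≤ R₀ → V z = E i z := by
    intro i z hz
    have h : ∃ i, ‖z - pts i‖ ≤ R₀ := ⟨i, hz⟩
    have hi : h.choose = i := by
      by_contra hne'
      exact absurd h.choose_spec (not_le.2 (hdisj i _ z (Ne.symm hne') hz))
    simp only [V, dif_pos h, hi]
  have hVF : ∀ z ∈ A, V z = F z := by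
    intro z hz
    by_cases h : ∃ i, ‖z - pts i‖ ≤ R₀
    · obtain ⟨i, hi⟩ := h
      have hz2 : R₀ ≤ ‖z - pts i‖ := by
        have := hz.2
        simp only [mem_iUnion, Metric.mem_ball, dist_eq_norm, not_exists, not_lt] at this
        exact this i
      have hs : z ∈ Metric.sphere (pts i) R₀ := by
        simpa [dist_eq_norm] using le_antisymm hi hz2
      rw [hVE i z hi]
      simp only [E, F]
      rw [hLe i z hs, mul_assoc, Finset.mul_prod_erase Finset.univ
        (fun k => (z - pts k) ^ (-deg k)) (Finset.mem_univ i)]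
    · simp only [V, dif_neg h]
  have hAge : ∀ z ∈ A, ∀ i, z - pts i ≠ 0 := by
    intro z hz i h0
    have := hz.2
    simp only [mem_iUnion, Metric.mem_ball, dist_eq_norm, not_exists, not_lt] at this
    have := this i
    rw [h0, norm_zero] at this
    linarith
  have hAcl : IsClosed A :=
    Metric.isClosed_closedBall.sdiff (isOpen_iUnion fun _ => Metric.isOpen_ball)
  have hVA : ContinuousOn V A := by
    refine ContinuousOn.congr ?_ hVF
    refine hu.mul (continuousOn_finsetProd _ fun i _ => ?_)
    exact ContinuousOn.zpow₀ (by fun_prop) _ fun z hz => Or.inl (hAge z hz i)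
  have hVB : ∀ i, ContinuousOn V (Metric.closedBall (pts i) R₀) := by
    intro i
    refine ContinuousOn.congr (f := E i) ?_ fun z hz => hVE i z (by simpa [dist_eq_norm] using hz)
    refine ((hL i).cexp.continuousOn).mul (continuousOn_finsetProd _ fun k hk => ?_)
    refine ContinuousOn.zpow₀ (by fun_prop) _ fun z hz => Or.inl fun h0 => ?_
    have := hdisj i k z (Finset.ne_of_mem_erase hk).symm (by simpa [dist_eq_norm] using hz)
    rw [h0, norm_zero] at this
    linarith
  let P : Option (Fin m) → Set ℂ := fun o => o.elim A fun i => Metric.closedBall (pts i) R₀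
  have hcont : ContinuousOn V (⋃ o, P o) := by
    refine (locallyFinite_of_finite P).continuousOn_iUnion ?_ ?_
    · rintro (_ | i)
      · exact hAcl
      · exact Metric.isClosed_closedBall
    · rintro (_ | i)
      · exact hVA
      · exact hVB i
  have hsub : Metric.ball (0 : ℂ) ρ ⊆ ⋃ o, P o := by
    intro z hz
    by_cases h : ∃ i, ‖z - pts i‖ ≤ R₀
    · obtain ⟨i, hi⟩ := h
      exact mem_iUnion.2 ⟨some i, by simpa [P, dist_eq_norm] using hi⟩
    · push Not at h
      refine mem_iUnion.2 ⟨none, Metric.ball_subset_closedBall hz, ?_⟩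
      simp only [mem_iUnion, Metric.mem_ball, dist_eq_norm, not_exists, not_lt]
      exact fun i => (h i).le
  have hV0 : (0 : ℂ) ∉ V '' Metric.ball 0 ρ := by
    rintro ⟨z, hz, hz0⟩
    obtain ⟨o, ho⟩ := mem_iUnion.1 (hsub hz)
    rcases o with _ | i
    · have hzA : z ∈ A := ho
      rw [hVF z hzA] at hz0
      refine mul_ne_zero (hne z hzA) (Finset.prod_ne_zero_iff.2 fun i _ => ?_) hz0
      exact zpow_ne_zero _ (hAge z hzA i)
    · have hzi : ‖z - pts i‖ ≤ R₀ := by simpa [P, dist_eq_norm] using ho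
      rw [hVE i z hzi] at hz0
      refine mul_ne_zero (Complex.exp_ne_zero _) (Finset.prod_ne_zero_iff.2 fun k hk => ?_) hz0
      refine zpow_ne_zero _ fun h0 => ?_
      have := hdisj i k z (Finset.ne_of_mem_erase hk).symm hzi
      rw [h0, norm_zero] at this
      linarith
  have hsc : IsSimplyConnected (Metric.ball (0 : ℂ) ρ) :=
    have := (convex_ball (0 : ℂ) ρ).contractibleSpace ⟨0, Metric.mem_ball_self hρ⟩
    SimplyConnectedSpace.ofContractible _
  obtain ⟨Ψ, hΨ, hΨe⟩ := Complex.exists_continuousOn_eqOn_exp_comp hsc Metric.isOpen_ball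
    (hcont.mono hsub) hV0
  refine ⟨Ψ, hΨ, fun z hz => ?_⟩
  have hzA : z ∈ A := ⟨Metric.ball_subset_closedBall hz.1, hz.2⟩
  have := hΨe hz.1
  rw [Function.comp_apply, hVF z hzA] at this
  exact this

/-- If `v = exp ψ` with `ψ` continuous and `v` differentiable, then `ψ' = v'/v`. -/
theorem hasDerivAt_of_exp_eq {v ψ : ℝ → ℂ} {v' : ℂ} {t : ℝ} (hψ : Continuous ψ)
    (hv : HasDerivAt v v' t) (h : ∀ s, Complex.exp (ψ s) = v s) :
    HasDerivAt ψ (v' / v t) t := by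
  have hvt : v t ≠ 0 := by rw [← h]; exact Complex.exp_ne_zero _
  -- The principal branch recentred at `t` coincides with `ψ` as long as `ψ` has moved by less than
  -- `π`.
  have h1 : HasDerivAt (fun s => Complex.log (v s / v t) + ψ t) (v' / v t) t := by
    have := (hv.div_const (v t)).clog_real (by rw [div_self hvt]; exact Complex.one_mem_slitPlane)
    rw [div_self hvt, div_one] at this
    exact this.add_const _
  refine h1.congr_of_eventuallyEq ?_
  have h2 : ∀ᶠ s in nhds t, ‖ψ s - ψ t‖ < Real.pi := by
    have : Filter.Tendsto (fun s => ‖ψ s - ψ t‖) (nhds t) (nhds ‖ψ t - ψ t‖) :=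
      ((hψ.sub continuous_const).norm).tendsto t
    rw [sub_self, norm_zero] at this
    exact this.eventually_lt_const Real.pi_pos
  filter_upwards [h2] with s hs
  have him : |(ψ s - ψ t).im| < Real.pi := (Complex.abs_im_le_norm _).trans_lt hs
  rw [← h s, ← h t, ← Complex.exp_sub, Complex.log_exp (abs_lt.1 him).1 (abs_lt.1 him).2.le]
  ring

/-- The logarithmic derivative of a closed curve with a continuous logarithm has integral zero. -/
theorem integral_logDeriv_eq_zero {v v' ψ : ℝ → ℂ} {T : ℝ} (hψ : Continuous ψ)
    (hv : ∀ t, HasDerivAt v (v' t) t) (hv' : Continuous v') (h : ∀ s, Complex.exp (ψ s) = v s)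
    (hper : ψ T = ψ 0) : ∫ t in (0 : ℝ)..T, v' t / v t = 0 := by
  have hvc : Continuous v := continuous_iff_continuousAt.2 fun t => (hv t).continuousAt
  have hne : ∀ t, v t ≠ 0 := fun t => by rw [← h]; exact Complex.exp_ne_zero _
  rw [intervalIntegral.integral_eq_sub_of_hasDerivAt
    (fun t _ => hasDerivAt_of_exp_eq hψ (hv t) h)
    ((hv'.div hvc hne).intervalIntegrable _ _), hper, sub_self]

/-- The logarithmic derivative of `u ∏ (z - aᵢ)^{-dᵢ}` along a circle has integral zero. -/
theorem integral_logDeriv_circleMap {m : ℕ} {ρ R₀ : ℝ} {pts : Fin m → ℂ} {deg : Fin m → ℤ}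
    {u Ψ : ℂ → ℂ} (hΨ : ContinuousOn Ψ (Metric.ball 0 ρ))
    (hΨe : ∀ z ∈ Metric.ball 0 ρ \ ⋃ j, Metric.ball (pts j) R₀,
        Complex.exp (Ψ z) = u z * ∏ i, (z - pts i) ^ (-deg i))
    {Ω : Set ℂ} (hΩ : IsOpen Ω) (hu : ContDiffOn ℝ 1 u Ω) (hu0 : ∀ z ∈ Ω, u z ≠ 0)
    (hΩp : ∀ z ∈ Ω, ∀ i, z ≠ pts i) {c : ℂ} {r : ℝ}
    (hcΩ : ∀ t, circleMap c r t ∈ Ω)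
    (hcb : ∀ t, circleMap c r t ∈ Metric.ball 0 ρ \ ⋃ j, Metric.ball (pts j) R₀) :
    ∫ t in (0 : ℝ)..2 * Real.pi,
      (fderiv ℝ u (circleMap c r t) (deriv (circleMap c r) t) / u (circleMap c r t)
        - ∑ i, (deg i : ℂ) * (deriv (circleMap c r) t / (circleMap c r t - pts i))) = 0 := by
  set γ := circleMap c r with hγ
  have hγd : ∀ t, HasDerivAt γ (deriv γ t) t := fun t =>
    (differentiable_circleMap c r t).hasDerivAt
  have hγc : Continuous γ := continuous_circleMap c r
  have hγ'c : Continuous (deriv γ) := by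
    have : deriv γ = fun t => circleMap 0 r t * Complex.I := by
      ext t; exact deriv_circleMap c r t
    rw [this]
    fun_prop
  let v : ℝ → ℂ := fun t => u (γ t) * ∏ i, (γ t - pts i) ^ (-deg i)
  let q : ℝ → ℂ := fun t => fderiv ℝ u (γ t) (deriv γ t) / u (γ t)
        - ∑ i, (deg i : ℂ) * (deriv γ t / (γ t - pts i))
  have hud : ∀ t, HasDerivAt (fun t => u (γ t)) (fderiv ℝ u (γ t) (deriv γ t)) t := by
    intro t
    have h1 : DifferentiableAt ℝ u (γ t) :=
      (hu.differentiableOn one_ne_zero).differentiableAt (hΩ.mem_nhds (hcΩ t))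
    exact h1.hasFDerivAt.comp_hasDerivAt t (hγd t)
  have hne : ∀ t i, γ t - pts i ≠ 0 := fun t i => sub_ne_zero.2 (hΩp _ (hcΩ t) i)
  have hzd : ∀ t i, HasDerivAt (fun t => (γ t - pts i) ^ (-deg i))
      (((-deg i : ℤ) : ℂ) * (γ t - pts i) ^ (-deg i - 1) * deriv γ t) t := by
    intro t i
    exact (hasDerivAt_zpow (-deg i) (γ t - pts i) (Or.inl (hne t i))).comp_of_eq t
      ((hγd t).sub_const _) rfl
  have hvd : ∀ t, HasDerivAt v (v t * q t) t := by
    intro t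
    have hd : DifferentiableAt ℝ v t := by
      refine (hud t).differentiableAt.mul ?_
      exact DifferentiableAt.fun_finsetProd fun i _ => (hzd t i).differentiableAt
    have hl : logDeriv v t = q t := by
      have h1 : logDeriv v t = logDeriv (fun t => u (γ t)) t
          + logDeriv (fun t => ∏ i, (γ t - pts i) ^ (-deg i)) t := by
        refine logDeriv_mul t (hu0 _ (hcΩ t)) ?_ (hud t).differentiableAt ?_
        · exact Finset.prod_ne_zero_iff.2 fun i _ => zpow_ne_zero _ (hne t i)
        · exact DifferentiableAt.fun_finsetProd fun i _ => (hzd t i).differentiableAt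
      rw [h1, logDeriv_prod (f := fun i t => (γ t - pts i) ^ (-deg i))
        (fun i _ => zpow_ne_zero _ (hne t i))
        (fun i _ => (hzd t i).differentiableAt), logDeriv_apply, (hud t).deriv]
      simp only [q]
      rw [sub_eq_add_neg, ← Finset.sum_neg_distrib]
      congr 1
      refine Finset.sum_congr rfl fun i _ => ?_
      rw [logDeriv_apply, (hzd t i).deriv, zpow_sub_one₀ (hne t i)]
      have := hne t i
      have := zpow_ne_zero (-deg i) (hne t i)
      push_cast
      field_simp
    have hv0 : v t ≠ 0 :=
      mul_ne_zero (hu0 _ (hcΩ t)) (Finset.prod_ne_zero_iff.2 fun i _ => zpow_ne_zero _ (hne t i))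
    have : deriv v t = v t * q t := by
      rw [← hl, logDeriv_apply]
      field_simp
    rw [← this]
    exact hd.hasDerivAt
  have huc : Continuous fun t => u (γ t) :=
    continuous_iff_continuousAt.2 fun t => (hud t).continuousAt
  have hfc : Continuous fun t => fderiv ℝ u (γ t) (deriv γ t) := by
    have h1 : ContinuousOn (fderiv ℝ u) Ω := hu.continuousOn_fderiv_of_isOpen hΩ le_rfl
    exact (h1.comp_continuous hγc hcΩ).clm_apply hγ'c
  have hqc : Continuous q := by
    refine (hfc.div huc fun t => hu0 _ (hcΩ t)).sub (continuous_finsetSum _ fun i _ => ?_)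
    exact continuous_const.mul (hγ'c.div (by fun_prop) fun t => hne t i)
  have hvc : Continuous v := continuous_iff_continuousAt.2 fun t => (hvd t).continuousAt
  have hψ : Continuous fun t => Ψ (γ t) := hΨ.comp_continuous hγc fun t => (hcb t).1
  have hper : Ψ (γ (2 * Real.pi)) = Ψ (γ 0) := by
    have := periodic_circleMap c r 0
    rw [zero_add] at this
    rw [hγ, this]
  have := integral_logDeriv_eq_zero hψ hvd (hvc.mul hqc) (fun s => hΨe _ (hcb s)) hper
  rw [← this]
  refine intervalIntegral.integral_congr fun t _ => ?_
  have hv0 : v t ≠ 0 :=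
    mul_ne_zero (hu0 _ (hcΩ t)) (Finset.prod_ne_zero_iff.2 fun i _ => zpow_ne_zero _ (hne t i))
  exact (mul_div_cancel_left₀ (q t) hv0).symm

/-! ### Polar coordinates around a point -/

theorem polarCoord_symm_eq_circleMap (p : ℝ × ℝ) :
    Complex.polarCoord.symm p = circleMap 0 p.1 p.2 := by
  rw [Complex.polarCoord_symm_apply, circleMap, zero_add, Complex.exp_mul_I]
  push_cast
  rfl

theorem integrableOn_polar {F : ℂ → ℝ} (hF : Integrable F) (hFm : Measurable F) (c : ℂ) :
    IntegrableOn (fun p : ℝ × ℝ => p.1 * F (circleMap c p.1 p.2))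
      (Ioi 0 ×ˢ Ioo (-Real.pi) Real.pi) := by
  have hcm : Continuous fun p : ℝ × ℝ => circleMap c p.1 p.2 := by
    unfold circleMap; fun_prop
  refine ⟨(measurable_fst.mul (hFm.comp hcm.measurable)).aestronglyMeasurable, ?_⟩
  -- Nonnegative integrals pass to polar coordinates unconditionally, so finiteness transfers from
  -- `F`.
  have h1 : ∫⁻ p in Ioi (0 : ℝ) ×ˢ Ioo (-Real.pi) Real.pi,
      ‖p.1 * F (circleMap c p.1 p.2)‖ₑ = ∫⁻ z, ‖F z‖ₑ := by
    rw [← lintegral_add_left_eq_self (fun z => ‖F z‖ₑ) c,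
      ← Complex.lintegral_comp_polarCoord_symm, polarCoord_target]
    refine setLIntegral_congr_fun (measurableSet_Ioi.prod measurableSet_Ioo) fun p hp => ?_
    have h2 : c + Complex.polarCoord.symm p = circleMap c p.1 p.2 := by
      rw [polarCoord_symm_eq_circleMap]; simp [circleMap]
    simp only [h2]
    rw [enorm_mul, Real.enorm_eq_ofReal (le_of_lt hp.1), smul_eq_mul]
  rw [HasFiniteIntegral, h1]
  exact hF.2

theorem setIntegral_Ioo_circleMap (F : ℂ → ℝ) (c : ℂ) (r : ℝ) :
    ∫ t in Ioo (-Real.pi) Real.pi, F (circleMap c r t)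
      = 2 * Real.pi * Real.circleAverage F c r := by
  have hper : Function.Periodic (fun t => F (circleMap c r t)) (2 * Real.pi) := fun t => by
    simp only [periodic_circleMap c r t]
  have h := hper.intervalIntegral_add_eq (-Real.pi) 0
  rw [Real.circleAverage_def, smul_eq_mul, ← mul_assoc,
    mul_inv_cancel₀ Real.two_pi_pos.ne', one_mul, ← integral_Ioc_eq_integral_Ioo,
    ← intervalIntegral.integral_of_le (by linarith [Real.pi_pos])]
  convert h using 2 <;> ring

theorem integrableOn_circleAverage {F : ℂ → ℝ} (hF : Integrable F) (hFm : Measurable F) (c : ℂ) :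
    IntegrableOn (fun r => 2 * Real.pi * r * Real.circleAverage F c r) (Ioi 0) := by
  have h := integrableOn_polar hF hFm c
  rw [IntegrableOn, Measure.volume_eq_prod, ← Measure.prod_restrict] at h
  refine h.integral_prod_left.congr (Filter.Eventually.of_forall fun r => ?_)
  simp only
  rw [integral_const_mul, setIntegral_Ioo_circleMap]
  ring

theorem integral_eq_integral_circleAverage {F : ℂ → ℝ} (hF : Integrable F) (hFm : Measurable F)
    (c : ℂ) : ∫ z, F z = ∫ r in Ioi 0, 2 * Real.pi * r * Real.circleAverage F c r := by
  have h := integrableOn_polar hF hFm c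
  rw [← integral_add_left_eq_self F c, ← Complex.integral_comp_polarCoord_symm,
    polarCoord_target]
  have h2 : ∀ p : ℝ × ℝ, c + Complex.polarCoord.symm p = circleMap c p.1 p.2 := fun p => by
    rw [polarCoord_symm_eq_circleMap]; simp [circleMap]
  simp only [h2, smul_eq_mul]
  rw [Measure.volume_eq_prod, setIntegral_prod _ h]
  refine integral_congr_ae (Filter.Eventually.of_forall fun r => ?_)
  simp only
  rw [integral_const_mul, setIntegral_Ioo_circleMap]
  ring

theorem measurable_circleAverage {F : ℂ → ℝ} (hF : Measurable F) (c : ℂ) :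
    Measurable fun r => Real.circleAverage F c r := by
  have hcm : Continuous fun p : ℝ × ℝ => circleMap c p.1 p.2 := by
    unfold circleMap; fun_prop
  have h : StronglyMeasurable fun r : ℝ =>
      ∫ t in Ioc 0 (2 * Real.pi), F (circleMap c r t) :=
    (hF.comp hcm.measurable).stronglyMeasurable.integral_prod_right'
  have h2 : (fun r => Real.circleAverage F c r)
      = fun r => (2 * Real.pi)⁻¹ * ∫ t in Ioc 0 (2 * Real.pi), F (circleMap c r t) := by
    ext r
    rw [Real.circleAverage_def, smul_eq_mul, intervalIntegral.integral_of_le Real.two_pi_pos.le]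
  rw [h2]
  exact h.measurable.const_mul _

theorem circleIntegrable_of_bounded {F : ℂ → ℝ} (hF : Measurable F) {M : ℝ}
    (hM : ∀ z, |F z| ≤ M) (c : ℂ) (r : ℝ) : CircleIntegrable F c r := by
  unfold CircleIntegrable
  rw [intervalIntegrable_iff]
  refine Measure.integrableOn_of_bounded (M := M) ?_ ?_ ?_
  · rw [uIoc_of_le Real.two_pi_pos.le]; exact measure_Ioc_lt_top.ne
  · exact (hF.comp (continuous_circleMap c r).measurable).aestronglyMeasurable
  · exact Filter.Eventually.of_forall fun t => by simpa using hM _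

theorem circleAverage_const_mul (k : ℝ) (F : ℂ → ℝ) (c : ℂ) (r : ℝ) :
    Real.circleAverage (fun z => k * F z) c r = k * Real.circleAverage F c r := by
  simp only [Real.circleAverage_def, intervalIntegral.integral_const_mul, smul_eq_mul]
  ring

/-- A radial factor comes out of the circle average. -/
theorem circleAverage_radial_mul (g : ℝ → ℝ) (F : ℂ → ℝ) (c : ℂ) {r : ℝ} (hr : 0 ≤ r) :
    Real.circleAverage (fun z => g ‖z - c‖ * F z) c r = g r * Real.circleAverage F c r := by
  have : ∀ t, ‖circleMap c r t - c‖ = r := fun t => by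
    simp [circleMap, abs_of_nonneg hr]
  simp only [Real.circleAverage_def, this, intervalIntegral.integral_const_mul, smul_eq_mul]
  ring

/-- With `g` supported on good radii, the averages of `F` need to be known on good circles only. -/
theorem integral_radial_mul {g : ℝ → ℝ} {F : ℂ → ℝ} {c : ℂ}
    (hF : Integrable fun z => g ‖z - c‖ * F z) (hFm : Measurable fun z => g ‖z - c‖ * F z) :
    ∫ z, g ‖z - c‖ * F z
      = ∫ r in Ioi 0, 2 * Real.pi * r * (g r * Real.circleAverage F c r) := by
  rw [integral_eq_integral_circleAverage hF hFm c]
  refine setIntegral_congr_fun measurableSet_Ioi fun r hr => ?_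
  rw [circleAverage_radial_mul g F c (le_of_lt hr)]

/-! ### The potential -/

theorem IsPotential.strictMonoOn {J : ℝ → ℝ} (hJ : IsPotential J) : StrictMonoOn J (Icc 0 1) := by
  refine strictMonoOn_of_deriv_pos (convex_Icc 0 1) hJ.contDiff.continuous.continuousOn ?_
  intro x hx
  rw [interior_Icc] at hx
  exact hJ.deriv_pos x ⟨hx.1, hx.2.le⟩

theorem IsPotential.mono {J : ℝ → ℝ} (hJ : IsPotential J) {s t : ℝ} (hs : 0 ≤ s) (hst : s ≤ t)
    (ht : t ≤ 1) : J s ≤ J t :=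
  hJ.strictMonoOn.monotoneOn ⟨hs, hst.trans ht⟩ ⟨hs.trans hst, ht⟩ hst

/-- At `t = 0` the derivative vanishes, since `0` is a global minimum of `J`. -/
theorem IsPotential.deriv_nonneg {J : ℝ → ℝ} (hJ : IsPotential J) {t : ℝ} (ht : 0 ≤ t)
    (ht1 : t ≤ 1) : 0 ≤ deriv J t := by
  rcases eq_or_lt_of_le ht with h | h
  · rw [← h]
    refine le_of_eq (IsLocalMin.deriv_eq_zero ?_).symm
    exact Filter.Eventually.of_forall fun x => by rw [hJ.zero]; exact hJ.nonneg x
  · exact (hJ.deriv_pos t ⟨h, ht1⟩).le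

/-- Near `0` the graph of `J` lies above its tangents. -/
theorem IsPotential.exists_tangent_le {J : ℝ → ℝ} (hJ : IsPotential J) :
    ∃ η : ℝ, 0 < η ∧ η ≤ 1 ∧ MonotoneOn (deriv J) (Icc 0 η) ∧
      ∀ h ∈ Icc 0 η, ∀ t ∈ Icc 0 η, J h + deriv J h * (t - h) ≤ J t := by
  obtain ⟨ρ, hρ, hρJ⟩ := hJ.deriv_two_pos
  have hd : Differentiable ℝ J := hJ.contDiff.differentiable two_ne_zero
  have hd1 : ContDiff ℝ 1 (deriv J) := by
    have : ContDiff ℝ (1 + 1) J := by convert hJ.contDiff using 1; norm_num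
    exact (contDiff_succ_iff_deriv.1 this).2.2
  have hmono : MonotoneOn (deriv J) (Icc 0 (min (ρ / 2) 1)) := by
    refine monotoneOn_of_deriv_nonneg (convex_Icc _ _) hd1.continuous.continuousOn
      (hd1.differentiable one_ne_zero).differentiableOn fun x hx => ?_
    rw [interior_Icc] at hx
    have := hρJ x ⟨hx.1, by linarith [hx.2, min_le_left (ρ / 2) 1]⟩
    rw [iteratedDeriv_succ, iteratedDeriv_one] at this
    exact this.le
  refine ⟨min (ρ / 2) 1, by positivity, min_le_right _ _, hmono, fun h hh t ht => ?_⟩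
  have hconv : ConvexOn ℝ (Icc 0 (min (ρ / 2) 1)) J := by
    refine MonotoneOn.convexOn_of_deriv (convex_Icc _ _) hd.continuous.continuousOn
      hd.differentiableOn (hmono.mono interior_subset)
  rcases lt_trichotomy h t with hlt | heq | hgt
  · have := hconv.le_slope_of_hasDerivAt hh ht hlt (hd h).hasDerivAt
    rw [slope_def_field, le_div_iff₀ (by linarith)] at this
    linarith
  · simp [heq]
  · have := hconv.slope_le_of_hasDerivAt ht hh hgt (hd h).hasDerivAt
    rw [slope_def_field, div_le_iff₀ (by linarith)] at this
    linarith

/-- Up to a constant factor, `J` has support lines on `[0,1]`. -/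
theorem IsPotential.exists_support_line {J : ℝ → ℝ} (hJ : IsPotential J) :
    ∃ κ : ℝ, 0 < κ ∧ ∀ h ∈ Icc (0 : ℝ) 1, ∃ s : ℝ, ∀ t ∈ Icc (0 : ℝ) 1,
      κ * J h + s * (t - h) ≤ J t := by
  obtain ⟨η, hη, hη1, hmono, htan⟩ := hJ.exists_tangent_le
  have hJη : 0 < J η := hJ.pos η hη
  have hD : 0 ≤ deriv J η := hJ.deriv_nonneg hη.le hη1
  have hJ1 : J η ≤ J 1 := hJ.mono hη.le hη1 le_rfl
  have hJ1p : 0 < J 1 := hJη.trans_le hJ1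
  -- `A` bounds on `[0,1]` every tangent to `J` taken at a point of `[0,η]`. The factor `J η / A`
  -- pushes these tangents below `J η`, and `J η / J 1` compensates for replacing `h > η` by `η`.
  set A : ℝ := J η + deriv J η with hA
  have hAp : 0 < A := by positivity
  have hAη : J η ≤ A := by linarith
  refine ⟨J η / A * (J η / J 1), by positivity, fun h hh => ?_⟩
  have hq1 : J η / A ≤ 1 := (div_le_one hAp).2 hAη
  have hq2 : J η / J 1 ≤ 1 := (div_le_one hJ1p).2 hJ1
  have hq1p : 0 < J η / A := by positivity
  have hq2p : 0 < J η / J 1 := by positivity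
  have hqA : J η / A * A = J η := div_mul_cancel₀ _ hAp.ne'
  have hq : J η / A * (J η / J 1) ≤ J η / A := by
    exact mul_le_of_le_one_right hq1p.le hq2
  rcases le_total h η with hle | hle
  -- For `h ≤ η`, the scaled tangent at `h`: convexity handles `t ≤ η`, and the bound by `A` handles
  -- `t ≥ η`.
  · refine ⟨J η / A * (J η / J 1) * deriv J h, fun t ht => ?_⟩
    have hJt := hJ.nonneg t
    have e : J η / A * (J η / J 1) * J h + J η / A * (J η / J 1) * deriv J h * (t - h)
        = J η / A * (J η / J 1) * (J h + deriv J h * (t - h)) := by ring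
    rw [e]
    have hqp : 0 < J η / A * (J η / J 1) := by positivity
    rcases le_total t η with htη | htη
    · have h1 := htan h ⟨hh.1, hle⟩ t ⟨ht.1, htη⟩
      calc _ ≤ J η / A * (J η / J 1) * J t := by gcongr
        _ ≤ 1 * J t := by gcongr; exact hq.trans hq1
        _ = J t := one_mul _
    · have h1 : J h ≤ J η := hJ.mono hh.1 hle hη1
      have h2 : deriv J h ≤ deriv J η := hmono ⟨hh.1, hle⟩ ⟨hη.le, le_rfl⟩ hle
      have h3 : 0 ≤ deriv J h := hJ.deriv_nonneg hh.1 hh.2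
      have h4 : J η ≤ J t := hJ.mono hη.le htη ht.2
      have h5 : J h + deriv J h * (t - h) ≤ A := by
        have : deriv J h * (t - h) ≤ deriv J η * 1 := by
          apply mul_le_mul h2 _ _ hD
          · linarith [ht.2, hh.1]
          · linarith
        linarith
      calc _ ≤ J η / A * (J η / J 1) * A := by gcongr
        _ ≤ J η / A * A := by gcongr
        _ = J η := hqA
        _ ≤ J t := h4
  -- For `h ≥ η`, where convexity may fail, a scaled tangent at `η` serves.
  · refine ⟨J η / A * deriv J η, fun t ht => ?_⟩
    have h1 : J h ≤ J 1 := hJ.mono hh.1 hh.2 le_rfl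
    have h2 : J η / A * (J η / J 1) * J h ≤ J η / A * J η := by
      calc _ ≤ J η / A * (J η / J 1) * J 1 := by gcongr
        _ = J η / A * J η := by field_simp
    have h3 : deriv J η * (t - h) ≤ deriv J η * (t - η) := by gcongr
    have h4 : J η / A * (deriv J η * (t - h)) ≤ J η / A * (deriv J η * (t - η)) := by gcongr
    have h5 : J η / A * (J η + deriv J η * (t - η)) ≤ J t := by
      rcases le_total t η with htη | htη
      · calc _ ≤ J η / A * J t := by
              gcongr; exact htan η ⟨hη.le, le_rfl⟩ t ⟨ht.1, htη⟩
          _ ≤ 1 * J t := by gcongr; exact hJ.nonneg t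
          _ = J t := one_mul _
      · have : deriv J η * (t - η) ≤ deriv J η * 1 := by
          gcongr; linarith [ht.2]
        calc _ ≤ J η / A * A := by gcongr; linarith
          _ = J η := hqA
          _ ≤ J t := hJ.mono hη.le htη ht.2
    linarith

/-- A form of Jensen's inequality: the harmonic mean of `1 - t` on a circle, `t = 1 - 1/W`. -/
theorem potential_circleAverage_le {J : ℝ → ℝ} (hJ : IsPotential J) {κ : ℝ} (hκ : 0 < κ)
    (hκJ : ∀ h ∈ Icc (0 : ℝ) 1, ∃ s : ℝ, ∀ t ∈ Icc (0 : ℝ) 1, κ * J h + s * (t - h) ≤ J t)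
    {W : ℂ → ℝ} (hW : Measurable W) {M : ℝ} (hW1 : ∀ z, 1 ≤ W z) (hWM : ∀ z, W z ≤ M)
    (c : ℂ) (r : ℝ) :
    κ * J (1 - (Real.circleAverage W c r)⁻¹)
      ≤ M * Real.circleAverage (fun z => J (1 - (W z)⁻¹)) c r := by
  set A := Real.circleAverage W c r with hA
  have hJc := hJ.contDiff.continuous
  have hWi : CircleIntegrable W c r :=
    circleIntegrable_of_bounded hW (M := M) (fun z => by
      rw [abs_of_nonneg (by linarith [hW1 z])]; exact hWM z) c r
  have hci : ∀ k : ℝ, CircleIntegrable (fun _ => k) c r := fun k => circleIntegrable_const k c r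
  have hA1 : 1 ≤ A := by
    have := Real.circleAverage_mono (hci 1) hWi fun z _ => hW1 z
    rwa [Real.circleAverage_const] at this
  have ht : ∀ z, 1 - (W z)⁻¹ ∈ Icc (0 : ℝ) 1 := fun z => by
    have := inv_le_one_of_one_le₀ (hW1 z)
    have : 0 ≤ (W z)⁻¹ := inv_nonneg.2 (by linarith [hW1 z])
    constructor <;> linarith
  have hh : 1 - A⁻¹ ∈ Icc (0 : ℝ) 1 := by
    have := inv_le_one_of_one_le₀ hA1
    have : 0 ≤ A⁻¹ := inv_nonneg.2 (by linarith)
    constructor <;> linarith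
  obtain ⟨s, hs⟩ := hκJ _ hh
  have hJm : Measurable fun z => J (1 - (W z)⁻¹) :=
    hJc.measurable.comp (measurable_const.sub hW.inv)
  have hJi : CircleIntegrable (fun z => M * J (1 - (W z)⁻¹)) c r := by
    refine circleIntegrable_of_bounded (hJm.const_mul M) (M := M * J 1) (fun z => ?_) c r
    have hM : 0 ≤ M := by linarith [hW1 z, hWM z]
    rw [abs_of_nonneg (mul_nonneg hM (hJ.nonneg _))]
    exact mul_le_mul_of_nonneg_left (hJ.mono (ht z).1 (ht z).2 le_rfl) hM
  -- Multiplying the support line at `t = 1 - 1/W` by `W` makes its lower bound the affine function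
  -- `p W - s` of `W`, whose average is known exactly. The factor `W` on the other side is absorbed
  -- by `M`.
  set p : ℝ := κ * J (1 - A⁻¹) + s * A⁻¹ with hp
  have hlin : CircleIntegrable (fun z => p * W z - s) c r := by
    exact (hWi.const_smul (a := p)).sub (hci s)
  have key : ∀ z ∈ Metric.sphere c |r|, p * W z - s ≤ M * J (1 - (W z)⁻¹) := by
    intro z _
    have h1 := hs _ (ht z)
    have hWp : 0 < W z := by linarith [hW1 z]
    have h2 := mul_le_mul_of_nonneg_left h1 hWp.le
    have h3 : W z * (κ * J (1 - A⁻¹) + s * (1 - (W z)⁻¹ - (1 - A⁻¹))) = p * W z - s := by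
      rw [hp]; field_simp; ring
    rw [h3] at h2
    exact h2.trans (mul_le_mul_of_nonneg_right (hWM z) (hJ.nonneg _))
  have h1 := Real.circleAverage_mono hlin hJi key
  have h2 : Real.circleAverage (fun z => p * W z - s) c r = p * A - s := by
    have hpW : CircleIntegrable (fun z => p * W z) c r := hWi.const_smul (a := p)
    rw [Real.circleAverage_fun_sub hpW (hci s), Real.circleAverage_const,
      circleAverage_const_mul]
  have h3 : Real.circleAverage (fun z => M * J (1 - (W z)⁻¹)) c r
      = M * Real.circleAverage (fun z => J (1 - (W z)⁻¹)) c r := circleAverage_const_mul _ _ _ _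
  rw [h2, h3] at h1
  have h4 : p * A - s = κ * J (1 - A⁻¹) * A := by
    have : A ≠ 0 := by linarith
    rw [hp]; field_simp; ring
  rw [h4] at h1
  refine le_trans ?_ h1
  exact le_mul_of_one_le_right (mul_nonneg hκ.le (hJ.nonneg _)) hA1

/-! ### The one-dimensional profile problem -/

/-- Rescaling a profile of budget `B R₀²` to one of budget `1` changes `∫ h/r` by a bounded
amount. -/
theorem integral_div_le_profileI {J : ℝ → ℝ} (hJ : IsPotential J) {h : ℝ → ℝ} (hm : Measurable h)
    (h01 : ∀ r, h r ∈ Icc (0 : ℝ) 1) {R R₀ lam : ℝ} (hR₀ : 0 < R₀) (hR : R₀ < R) (hlam : 1 ≤ lam)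
    (hi : IntegrableOn (fun r => J (h r) * r) (Ioi 0))
    (hb : ∫ r in Ioi 0, J (h r) * r ≤ lam ^ 2 * R₀ ^ 2) :
    ∫ r in R₀..R, h r / r ≤ profileI J (R / R₀) + Real.log lam := by
  have hRp : 0 < R := hR₀.trans hR
  set c := lam * R₀ with hc
  have hcp : 0 < c := by positivity
  have hx1 : 1 < R / R₀ := (one_lt_div hR₀).2 hR
  have hcR : c * (R / R₀) = lam * R := by rw [hc]; field_simp
  have hcl : c ≤ lam * R := by rw [hc]; gcongr
  have hint : ∀ x y : ℝ, 0 < x → x ≤ y →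
      IntervalIntegrable (fun r => h r / r) volume x y := by
    intro x y hx hxy
    rw [intervalIntegrable_iff, uIoc_of_le hxy]
    refine Measure.integrableOn_of_bounded (M := 1 / x) measure_Ioc_lt_top.ne
      (hm.div measurable_id).aestronglyMeasurable ?_
    refine (ae_restrict_iff' measurableSet_Ioc).2 (Filter.Eventually.of_forall fun r hr => ?_)
    have hr0 : 0 < r := hx.trans hr.1
    rw [Real.norm_eq_abs, abs_of_nonneg (div_nonneg (h01 r).1 hr0.le)]
    exact div_le_div₀ zero_le_one (h01 r).2 hx hr.1.le
  -- Dilation by `c = lam * R₀` divides the budget by `c²` and leaves `dr/r` invariant.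
  let f : ℝ → ℝ := fun s => Real.sqrt (1 - h (c * s))
  have hf : ∀ s, 1 - f s ^ 2 = h (c * s) := fun s => by
    simp only [f]
    rw [Real.sq_sqrt (by linarith [(h01 (c * s)).2])]; ring
  have hJint : IntervalIntegrable (fun r => J (h r) * r) volume c (lam * R) := by
    rw [intervalIntegrable_iff, uIoc_of_le hcl]
    exact hi.mono_set fun r hr => hcp.trans hr.1
  have e1 : ∫ s in (1 : ℝ)..R / R₀, h (c * s) / s = ∫ r in c..lam * R, h r / r := by
    have h1 := intervalIntegral.integral_comp_mul_left (a := 1) (b := R / R₀)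
      (fun r => h r / r) hcp.ne'
    rw [hcR, mul_one, smul_eq_mul] at h1
    rw [← mul_right_inj' (inv_ne_zero hcp.ne'), ← h1, ← intervalIntegral.integral_const_mul]
    refine intervalIntegral.integral_congr fun s _ => ?_
    rw [mul_comm c s, div_mul_eq_div_div]
    ring
  have e2 : ∫ s in (1 : ℝ)..R / R₀, J (h (c * s)) * s
      = (c ^ 2)⁻¹ * ∫ r in c..lam * R, J (h r) * r := by
    have h1 := intervalIntegral.integral_comp_mul_left (a := 1) (b := R / R₀)
      (fun r => J (h r) * r) hcp.ne'
    rw [hcR, mul_one, smul_eq_mul] at h1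
    rw [sq, mul_inv, mul_assoc, ← h1, ← intervalIntegral.integral_const_mul]
    refine intervalIntegral.integral_congr fun s _ => ?_
    field_simp
  have hadm : Admissible J (R / R₀) 1 f := by
    refine ⟨(measurable_const.sub (hm.comp (measurable_const.mul measurable_id))).sqrt, ?_, ?_, ?_⟩
    · simp only [hf]
      have := (hint c (lam * R) hcp hcl).comp_mul_left (c := c)
      rw [div_self hcp.ne', ← hcR, mul_div_cancel_left₀ _ hcp.ne'] at this
      refine (this.const_mul c).congr fun s _ => ?_
      field_simp
    · simp only [hf]
      have := hJint.comp_mul_left (c := c)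
      rw [div_self hcp.ne', ← hcR, mul_div_cancel_left₀ _ hcp.ne'] at this
      refine (this.const_mul c⁻¹).congr fun s _ => ?_
      field_simp
    · simp only [hf]
      rw [e2]
      have h1 : ∫ r in c..lam * R, J (h r) * r ≤ ∫ r in Ioi 0, J (h r) * r := by
        rw [intervalIntegral.integral_of_le hcl]
        refine setIntegral_mono_set hi ?_ (LE.le.eventuallyLE fun r hr => hcp.trans hr.1)
        refine (ae_restrict_iff' measurableSet_Ioi).2 (Filter.Eventually.of_forall fun r hr => ?_)
        exact mul_nonneg (hJ.nonneg _) (le_of_lt hr)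
      rw [inv_mul_le_iff₀ (by positivity), mul_one, hc, mul_pow]
      exact h1.trans hb
  have hlub := (profileSup_isLUB hJ hx1 zero_le_one).1 ⟨f, hadm, rfl⟩
  simp only [hf] at hlub
  rw [e1] at hlub
  -- The rescaled profile sees `[lam R₀, lam R]`. This covers `[R₀, R]` except for part of `[R₀, lam
  -- R₀]`, where `h ≤ 1` costs at most `log lam`.
  have hRl : R ≤ lam * R := le_mul_of_one_le_left hRp.le hlam
  have hcR0 : R₀ ≤ c := le_mul_of_one_le_left hR₀.le hlam
  have h2 : ∫ r in R₀..R, h r / r ≤ ∫ r in R₀..lam * R, h r / r := by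
    refine intervalIntegral.integral_mono_interval le_rfl hR.le hRl ?_
      (hint R₀ (lam * R) hR₀ (hR.le.trans hRl))
    refine (ae_restrict_iff' measurableSet_Ioc).2 (Filter.Eventually.of_forall fun r hr => ?_)
    exact div_nonneg (h01 r).1 (hR₀.le.trans hr.1.le)
  have h3 : ∫ r in R₀..c, h r / r ≤ Real.log lam := by
    have h4 : ∫ r in R₀..c, h r / r ≤ ∫ r in R₀..c, 1 / r := by
      refine intervalIntegral.integral_mono_on hcR0 (hint _ _ hR₀ hcR0) ?_ fun r hr => ?_
      · refine intervalIntegral.intervalIntegrable_one_div (fun r hr => ?_) continuousOn_id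
        rw [uIcc_of_le hcR0] at hr
        exact (hR₀.trans_le hr.1).ne'
      · exact div_le_div_of_nonneg_right (h01 r).2 (hR₀.le.trans hr.1)
    rw [integral_one_div_of_pos hR₀ hcp, hc, mul_div_cancel_right₀ _ hR₀.ne'] at h4
    exact h4
  have h5 := intervalIntegral.integral_add_adjacent_intervals (hint R₀ c hR₀ hcR0)
    (hint c (lam * R) hcp hcl)
  rw [profileI]
  linarith

/-! ### Good radii -/

/-- The radii `r ∈ [2R₀, R/4]` for which the circle of radius `r` around `aⱼ` stays at distance at
least `R₀` from the other holes. -/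
def goodRadii {m : ℕ} (R R₀ : ℝ) (pts : Fin m → ℂ) (j : Fin m) : Set ℝ :=
  {r | 2 * R₀ ≤ r ∧ r ≤ R / 4 ∧ ∀ k, k ≠ j → 2 * R₀ ≤ |r - ‖pts k - pts j‖|}

theorem isClosed_goodRadii {m : ℕ} (R R₀ : ℝ) (pts : Fin m → ℂ) (j : Fin m) :
    IsClosed (goodRadii R R₀ pts j) := by
  have h : goodRadii R R₀ pts j = {r | 2 * R₀ ≤ r} ∩ ({r | r ≤ R / 4} ∩
      ⋂ k, ⋂ (_ : k ≠ j), {r | 2 * R₀ ≤ |r - ‖pts k - pts j‖|}) := by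
    ext r; simp [goodRadii]
  rw [h]
  refine (isClosed_le continuous_const continuous_id).inter
    ((isClosed_le continuous_id continuous_const).inter ?_)
  refine isClosed_iInter fun k => isClosed_iInter fun _ => ?_
  exact isClosed_le continuous_const (by fun_prop)

theorem measurableSet_goodRadii {m : ℕ} (R R₀ : ℝ) (pts : Fin m → ℂ) (j : Fin m) :
    MeasurableSet (goodRadii R R₀ pts j) :=
  (isClosed_goodRadii R R₀ pts j).measurableSet

theorem integrableOn_one_div_Ioc {x y : ℝ} (hx : 0 < x) :
    IntegrableOn (fun r : ℝ => 1 / r) (Ioc x y) := by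
  refine Measure.integrableOn_of_bounded (M := 1 / x) measure_Ioc_lt_top.ne
    (measurable_const.div measurable_id).aestronglyMeasurable ?_
  refine (ae_restrict_iff' measurableSet_Ioc).2 (Filter.Eventually.of_forall fun r hr => ?_)
  have hr0 : 0 < r := hx.trans hr.1
  rw [Real.norm_eq_abs, abs_of_nonneg (by positivity)]
  exact one_div_le_one_div_of_le hx hr.1.le

theorem setIntegral_one_div_Ioc {x y : ℝ} (hx : 0 < x) (hxy : x ≤ y) :
    ∫ r in Ioc x y, 1 / r = Real.log (y / x) := by
  rw [← intervalIntegral.integral_of_le hxy, integral_one_div_of_pos hx (hx.trans_le hxy)]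

theorem goodRadii_inter_subset {m : ℕ} {R R₀ : ℝ} (pts : Fin m → ℂ) (j : Fin m) (hR : 0 < R)
    (A : ℝ) : goodRadii R R₀ pts j ∩ Ioi A ⊆ Ioc A R :=
  fun r hr => ⟨hr.2, by linarith [hr.1.2.1]⟩

theorem integral_goodRadii_le {m : ℕ} {R R₀ A : ℝ} (pts : Fin m → ℂ) (j : Fin m)
    (hA : 0 < A) (hAR : A ≤ R) :
    ∫ r in goodRadii R R₀ pts j ∩ Ioi A, 1 / r ≤ Real.log (R / A) := by
  rw [← setIntegral_one_div_Ioc hA hAR]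
  refine setIntegral_mono_set (integrableOn_one_div_Ioc hA) ?_
    (LE.le.eventuallyLE (goodRadii_inter_subset pts j (hA.trans_le hAR) A))
  refine (ae_restrict_iff' measurableSet_Ioc).2 (Filter.Eventually.of_forall fun r hr => ?_)
  exact (one_div_pos.2 (hA.trans hr.1)).le

/-- Measured by `dr/r`, few radii are lost. Stopping at `R/4` costs `log 4`. The window around `L =
‖pts k - pts j‖` costs `log ((L + 2R₀)/(L - 2R₀)) ≤ log 3`, because `L ≥ 4R₀`. -/
theorem le_integral_goodRadii {m : ℕ} {R R₀ A : ℝ} {pts : Fin m → ℂ} (j : Fin m) (hR₀ : 0 < R₀)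
    (hsep : ∀ k, k ≠ j → 4 * R₀ ≤ ‖pts k - pts j‖) (hA : 2 * R₀ ≤ A) (hAR : A ≤ R) :
    Real.log (R / A) - Real.log 4 - m * Real.log 3
      ≤ ∫ r in goodRadii R R₀ pts j ∩ Ioi A, 1 / r := by
  classical
  have hAp : 0 < A := by linarith
  have hRp : 0 < R := hAp.trans_le hAR
  set S := goodRadii R R₀ pts j ∩ Ioi A with hS
  have hSm : MeasurableSet S := (measurableSet_goodRadii R R₀ pts j).inter measurableSet_Ioi
  let I : Fin m → Set ℝ := fun k =>
    if k = j then ∅ else Ioc (‖pts k - pts j‖ - 2 * R₀) (‖pts k - pts j‖ + 2 * R₀)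
  have hIm : ∀ k, MeasurableSet (I k) := fun k => by
    simp only [I]; split_ifs; exacts [MeasurableSet.empty, measurableSet_Ioc]
  have hSi : IntegrableOn (fun r : ℝ => 1 / r) S :=
    (integrableOn_one_div_Ioc hAp).mono_set (goodRadii_inter_subset pts j hRp A)
  have hIi : ∀ k, IntegrableOn (fun r : ℝ => 1 / r) (I k) := fun k => by
    by_cases hk : k = j
    · simp [I, hk]
    · simp only [I, if_neg hk]
      exact integrableOn_one_div_Ioc (by linarith [hsep k hk])
  have hIpos : ∀ k, ∀ r ∈ I k, 0 < r := fun k r hr => by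
    by_cases hk : k = j
    · simp [I, hk] at hr
    · simp only [I, if_neg hk] at hr
      linarith [hsep k hk, hr.1]
  have hIle : ∀ k, ∫ r in I k, 1 / r ≤ Real.log 3 := fun k => by
    by_cases hk : k = j
    · simp [I, hk, Real.log_nonneg]
    · simp only [I, if_neg hk]
      have hs := hsep k hk
      rw [setIntegral_one_div_Ioc (by linarith) (by linarith)]
      refine Real.log_le_log (div_pos (by linarith) (by linarith)) ?_
      rw [div_le_iff₀ (by linarith)]
      linarith
  have hlow : Real.log (R / A) - Real.log 4 ≤ ∫ r in Ioc A (R / 4), 1 / r := by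
    rw [← Real.log_div (by positivity) (by norm_num)]
    rcases le_total A (R / 4) with h | h
    · rw [setIntegral_one_div_Ioc hAp h]
      exact le_of_eq (by congr 1; field_simp)
    · rw [Ioc_eq_empty (not_lt.2 h), setIntegral_empty]
      refine Real.log_nonpos (by positivity) ?_
      rw [div_div, div_le_one (by positivity)]
      linarith
  have hpt : ∀ r, (Ioc A (R / 4)).indicator (fun r : ℝ => 1 / r) r
      ≤ S.indicator (fun r : ℝ => 1 / r) r + ∑ k, (I k).indicator (fun r : ℝ => 1 / r) r := by
    intro r
    have hSn : 0 ≤ S.indicator (fun r : ℝ => 1 / r) r :=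
      indicator_nonneg (fun r hr => (one_div_pos.2 (hAp.trans hr.2)).le) r
    have hIn : ∀ k, 0 ≤ (I k).indicator (fun r : ℝ => 1 / r) r := fun k =>
      indicator_nonneg (fun r hr => (one_div_pos.2 (hIpos k r hr)).le) r
    have hIs : 0 ≤ ∑ k, (I k).indicator (fun r : ℝ => 1 / r) r :=
      Finset.sum_nonneg fun k _ => hIn k
    by_cases hr : r ∈ Ioc A (R / 4)
    · rw [indicator_of_mem hr]
      by_cases hrS : r ∈ S
      · rw [indicator_of_mem hrS]; linarith
      · obtain ⟨k, hk, hkr⟩ : ∃ k, k ≠ j ∧ |r - ‖pts k - pts j‖| < 2 * R₀ := by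
          by_contra hcon
          push Not at hcon
          exact hrS ⟨⟨hA.trans hr.1.le, hr.2, hcon⟩, hr.1⟩
        have hrk : r ∈ I k := by
          simp only [I, if_neg hk]
          rw [abs_lt] at hkr
          constructor <;> linarith [hkr.1, hkr.2]
        have := Finset.single_le_sum (fun k _ => hIn k) (Finset.mem_univ k)
        rw [indicator_of_mem hrk] at this
        linarith
    · rw [indicator_of_notMem hr]
      linarith
  have hIint : Integrable fun r => ∑ k, (I k).indicator (fun r : ℝ => 1 / r) r :=
    integrable_finsetSum _ fun k _ => (integrable_indicator_iff (hIm k)).2 (hIi k)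
  have h1 := integral_mono
    ((integrable_indicator_iff measurableSet_Ioc).2 (integrableOn_one_div_Ioc hAp))
    (((integrable_indicator_iff hSm).2 hSi).add hIint) hpt
  simp only [Pi.add_apply] at h1
  rw [integral_add ((integrable_indicator_iff hSm).2 hSi) hIint,
    integral_finsetSum _ fun k _ => (integrable_indicator_iff (hIm k)).2 (hIi k),
    integral_indicator measurableSet_Ioc, integral_indicator hSm] at h1
  have h2 : ∑ k, ∫ r, (I k).indicator (fun r : ℝ => 1 / r) r ≤ m * Real.log 3 := by
    calc _ ≤ ∑ _k : Fin m, Real.log 3 := by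
          refine Finset.sum_le_sum fun k _ => ?_
          rw [integral_indicator (hIm k)]
          exact hIle k
      _ = m * Real.log 3 := by simp
  linarith

/-! ### Planar integrals -/

theorem integrable_of_bounded_of_support {f : ℂ → ℝ} (hf : Measurable f) {M ρ : ℝ} {c : ℂ}
    (hM : ∀ z, |f z| ≤ M) (hs : ∀ z, ρ < ‖z - c‖ → f z = 0) : Integrable f := by
  have h : IntegrableOn f (Metric.closedBall c ρ) :=
    Measure.integrableOn_of_bounded (M := M) measure_closedBall_lt_top.ne hf.aestronglyMeasurable
      (Filter.Eventually.of_forall hM)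
  refine (integrableOn_iff_integrable_of_support_subset fun z hz => ?_).1 h
  by_contra hcon
  rw [Metric.mem_closedBall, dist_eq_norm, not_le] at hcon
  exact hz (hs z hcon)

/-- The polar Jacobian `r` cancels the singularity. -/
theorem integrableOn_inv_norm_sub_ball_self (b : ℂ) (ρ : ℝ) :
    IntegrableOn (fun z => ‖z - b‖⁻¹) (Metric.ball b ρ) := by
  have hm : Measurable fun z : ℂ => ‖z - b‖⁻¹ := by fun_prop
  refine ⟨hm.aestronglyMeasurable, ?_⟩
  have h1 : ∫⁻ z in Metric.ball b ρ, ‖‖z - b‖⁻¹‖ₑ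
      ≤ ∫⁻ _ in Ioo 0 ρ ×ˢ Ioo (-Real.pi) Real.pi, (1 : ENNReal) := by
    rw [← lintegral_indicator Metric.isOpen_ball.measurableSet,
      ← lintegral_add_left_eq_self _ b, ← Complex.lintegral_comp_polarCoord_symm,
      polarCoord_target, ← lintegral_indicator (measurableSet_Ioo.prod measurableSet_Ioo),
      ← lintegral_indicator (measurableSet_Ioi.prod measurableSet_Ioo)]
    refine lintegral_mono fun p => ?_
    by_cases hp : p ∈ Ioi (0 : ℝ) ×ˢ Ioo (-Real.pi) Real.pi
    · rw [indicator_of_mem hp]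
      have hp0 : 0 < p.1 := hp.1
      have hn : ‖Complex.polarCoord.symm p‖ = p.1 := by
        rw [Complex.norm_polarCoord_symm, abs_of_pos hp0]
      by_cases hb : b + Complex.polarCoord.symm p ∈ Metric.ball b ρ
      · have hpρ : p.1 < ρ := by
          rwa [Metric.mem_ball, dist_eq_norm, add_sub_cancel_left, hn] at hb
        rw [indicator_of_mem hb, indicator_of_mem (show p ∈ Ioo 0 ρ ×ˢ Ioo (-Real.pi) Real.pi from
          ⟨⟨hp0, hpρ⟩, hp.2⟩), add_sub_cancel_left, hn, Real.enorm_eq_ofReal (by positivity),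
          smul_eq_mul, ← ENNReal.ofReal_mul hp0.le, mul_inv_cancel₀ hp0.ne', ENNReal.ofReal_one]
      · rw [indicator_of_notMem hb]; simp
    · rw [indicator_of_notMem hp]; exact zero_le
  refine lt_of_le_of_lt h1 ?_
  rw [setLIntegral_one, Measure.volume_eq_prod, Measure.prod_prod]
  exact ENNReal.mul_lt_top (by simp) (by simp)

theorem integral_inv_norm_sub_ball_self (b : ℂ) {ρ : ℝ} (hρ : 0 ≤ ρ) :
    ∫ z in Metric.ball b ρ, ‖z - b‖⁻¹ = 2 * Real.pi * ρ := by
  let g : ℝ → ℝ := (Iio ρ).indicator fun r => r⁻¹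
  have hgm : Measurable g := (measurable_inv).indicator measurableSet_Iio
  have e : (Metric.ball b ρ).indicator (fun z => ‖z - b‖⁻¹) = fun z => g ‖z - b‖ * 1 := by
    classical
    ext z
    simp only [g, mul_one, indicator_apply, Metric.mem_ball, dist_eq_norm, mem_Iio]
  have hi : Integrable fun z => g ‖z - b‖ * 1 := by
    rw [← e, integrable_indicator_iff Metric.isOpen_ball.measurableSet]
    exact integrableOn_inv_norm_sub_ball_self b ρ
  rw [← integral_indicator Metric.isOpen_ball.measurableSet, e,
    integral_radial_mul (F := fun _ => (1 : ℝ)) hi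
      ((hgm.comp (by fun_prop)).mul measurable_const)]
  simp only [Real.circleAverage_const]
  have h2 : ∀ r ∈ Ioi (0 : ℝ), 2 * Real.pi * r * (g r * 1)
      = (Iio ρ).indicator (fun _ => 2 * Real.pi) r := by
    intro r hr
    have hr0 : r ≠ 0 := (mem_Ioi.1 hr).ne'
    simp only [g, indicator_apply]
    split_ifs
    · field_simp
    · simp
  rw [setIntegral_congr_fun measurableSet_Ioi h2, setIntegral_indicator measurableSet_Iio,
    Ioi_inter_Iio]
  simp [hρ, mul_comm]

theorem integrableOn_inv_norm_sub_ball (b c : ℂ) (ρ : ℝ) :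
    IntegrableOn (fun z => ‖z - b‖⁻¹) (Metric.ball c ρ) := by
  refine (integrableOn_inv_norm_sub_ball_self b (ρ + dist c b)).mono_set ?_
  exact Metric.ball_subset_ball' le_rfl

/-- Points within `ρ` of `b` contribute at most `2πρ`; elsewhere the integrand is at most `1/ρ` on a
set of area at most `πρ²`. -/
theorem integral_inv_norm_sub_ball_le (b c : ℂ) {ρ : ℝ} (hρ : 0 < ρ) :
    ∫ z in Metric.ball c ρ, ‖z - b‖⁻¹ ≤ 3 * Real.pi * ρ := by
  have hpt : ∀ z, (Metric.ball c ρ).indicator (fun z => ‖z - b‖⁻¹) z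
      ≤ (Metric.ball b ρ).indicator (fun z => ‖z - b‖⁻¹) z
        + (Metric.ball c ρ).indicator (fun _ => ρ⁻¹) z := by
    classical
    intro z
    simp only [indicator_apply]
    by_cases h2 : z ∈ Metric.ball b ρ
    · rw [if_pos h2]
      split_ifs <;> first | (have : 0 < ρ⁻¹ := by positivity); linarith [norm_nonneg (z - b)] | skip
      have : 0 ≤ ‖z - b‖⁻¹ := by positivity
      linarith
    · rw [if_neg h2, zero_add]
      rw [Metric.mem_ball, dist_eq_norm, not_lt] at h2
      split_ifs
      · exact inv_anti₀ hρ h2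
      · exact le_rfl
  have hc : Integrable ((Metric.ball c ρ).indicator fun _ => ρ⁻¹) :=
    (integrable_indicator_iff Metric.isOpen_ball.measurableSet).2
      (integrableOn_const measure_ball_lt_top.ne)
  have hb := (integrable_indicator_iff Metric.isOpen_ball.measurableSet).2
    (integrableOn_inv_norm_sub_ball_self b ρ)
  have h := integral_mono ((integrable_indicator_iff Metric.isOpen_ball.measurableSet).2
    (integrableOn_inv_norm_sub_ball b c ρ)) (hb.add hc) hpt
  simp only [Pi.add_apply] at h
  rw [integral_add hb hc, integral_indicator Metric.isOpen_ball.measurableSet,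
    integral_indicator Metric.isOpen_ball.measurableSet,
    integral_indicator Metric.isOpen_ball.measurableSet, integral_inv_norm_sub_ball_self b hρ.le,
    setIntegral_const, Measure.real, Complex.volume_ball] at h
  refine h.trans (le_of_eq ?_)
  simp [ENNReal.toReal_ofReal hρ.le]
  field_simp
  ring

/-! ### Gradients of the angles -/

/-- The gradient of the angle around `b`. -/
def gradAngle (b z : ℂ) : ℂ := Complex.I / (starRingEnd ℂ) (z - b)

/-- The inner product of the gradients of the angles around `a` and `b`. -/
def angleKernel (a b z : ℂ) : ℝ := (gradAngle b z / (z - a)).im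

theorem angleKernel_eq (a b z : ℂ) :
    angleKernel a b z = (((z - a) * (starRingEnd ℂ) (z - b))⁻¹).re := by
  rw [angleKernel, gradAngle, div_div, mul_comm, div_eq_mul_inv, Complex.I_mul_im]

theorem angleKernel_self (a z : ℂ) : angleKernel a a z = (‖z - a‖ ^ 2)⁻¹ := by
  rw [angleKernel_eq, Complex.mul_conj, Complex.normSq_eq_norm_sq, ← Complex.ofReal_inv,
    Complex.ofReal_re]

theorem abs_angleKernel_le (a b z : ℂ) : |angleKernel a b z| ≤ ‖z - a‖⁻¹ * ‖z - b‖⁻¹ := by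
  rw [angleKernel_eq]
  refine (Complex.abs_re_le_norm _).trans (le_of_eq ?_)
  rw [norm_inv, norm_mul, RCLike.norm_conj, mul_inv]

theorem re_conj_gradAngle_mul (a b z : ℂ) :
    ((starRingEnd ℂ) (gradAngle a z) * gradAngle b z).re = angleKernel a b z := by
  rw [angleKernel_eq, gradAngle, gradAngle, map_div₀, Complex.conj_conj, Complex.conj_I,
    div_mul_div_comm, neg_mul, Complex.I_mul_I, neg_neg, one_div]

theorem measurable_gradAngle (b : ℂ) : Measurable (gradAngle b) := by
  unfold gradAngle
  exact measurable_const.div ((Complex.continuous_conj.measurable).comp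
    (measurable_id.sub measurable_const))

theorem measurable_angleKernel (a b : ℂ) : Measurable (angleKernel a b) := by
  unfold angleKernel
  exact Complex.measurable_im.comp ((measurable_gradAngle b).div (measurable_id.sub measurable_const))

/-- The gradient of the angle is tangent to circles about `b`, so averaging a derivative in its
direction computes a circulation. -/
theorem gradAngle_circleMap (b : ℂ) {r : ℝ} (hr : 0 < r) (t : ℝ) :
    gradAngle b (circleMap b r t) = (r ^ 2)⁻¹ • deriv (circleMap b r) t := by
  have h1 : circleMap b r t - b = circleMap 0 r t := by simp [circleMap]
  have h0 : circleMap 0 r t ≠ 0 := by simp [circleMap, hr.ne']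
  have h2 : (starRingEnd ℂ) (circleMap 0 r t) = r ^ 2 / circleMap 0 r t := by
    rw [eq_div_iff h0, mul_comm, Complex.mul_conj, Complex.normSq_eq_norm_sq]
    simp [abs_of_pos hr]
  have hr' : (r : ℂ) ≠ 0 := by exact_mod_cast hr.ne'
  rw [gradAngle, h1, h2, deriv_circleMap, Complex.real_smul]
  push_cast
  field_simp

/-- Up to the factor `r⁻²`, this is the winding number of the circle around `a`: Cauchy's formula
inside, Cauchy's theorem outside. -/
theorem circleAverage_angleKernel {a b : ℂ} {r : ℝ} (hr : 0 < r) (hne : r ≠ ‖a - b‖) :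
    Real.circleAverage (angleKernel a b) b r = if ‖a - b‖ < r then (r ^ 2)⁻¹ else 0 := by
  have hγne : ∀ t, circleMap b r t - a ≠ 0 := by
    intro t h0
    refine hne ?_
    rw [← sub_eq_zero.1 h0]
    simp [circleMap, abs_of_pos hr]
  have h1 : ∀ t, angleKernel a b (circleMap b r t)
      = (r ^ 2)⁻¹ * Complex.imCLM (deriv (circleMap b r) t • (circleMap b r t - a)⁻¹) := by
    intro t
    rw [angleKernel, gradAngle_circleMap b hr, div_eq_mul_inv, smul_mul_assoc, Complex.smul_im]
    rfl
  have hc : Continuous fun t => deriv (circleMap b r) t • (circleMap b r t - a)⁻¹ := by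
    have : deriv (circleMap b r) = fun t => circleMap 0 r t * Complex.I := by
      ext t; exact deriv_circleMap b r t
    rw [this]
    have h2 : Continuous fun t => circleMap 0 r t * Complex.I := by fun_prop
    exact h2.smul (((continuous_circleMap b r).sub continuous_const).inv₀ hγne)
  rw [Real.circleAverage_def]
  simp only [h1]
  rw [intervalIntegral.integral_const_mul,
    Complex.imCLM.intervalIntegral_comp_comm (hc.intervalIntegrable _ _)]
  have h2 : (∫ t in (0 : ℝ)..2 * Real.pi, deriv (circleMap b r) t • (circleMap b r t - a)⁻¹)
      = circleIntegral (fun z => (z - a)⁻¹) b r := rfl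
  rw [h2]
  split_ifs with h
  · rw [circleIntegral.integral_sub_inv_of_mem_ball (by rwa [Metric.mem_ball, dist_eq_norm])]
    simp
    field_simp
  · have hlt : r < ‖a - b‖ := lt_of_le_of_ne (not_lt.1 h) hne
    have hd : DiffContOnCl ℂ (fun z => (z - a)⁻¹) (Metric.ball b r) := by
      refine DifferentiableOn.diffContOnCl fun z hz => ?_
      have hz' : z - a ≠ 0 := by
        intro h0
        rw [sub_eq_zero] at h0
        have := Metric.closure_ball_subset_closedBall hz
        rw [h0, Metric.mem_closedBall, dist_eq_norm] at this
        linarith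
      exact ((differentiableAt_id.sub_const a).inv hz').differentiableWithinAt
    rw [hd.circleIntegral_eq_zero hr.le]
    simp

/-- The defect between the current of `u` and the canonical field of the degrees has zero
circulation. -/
theorem circleAverage_current_sub {m : ℕ} {ρ R₀ : ℝ} {pts : Fin m → ℂ} {deg : Fin m → ℤ}
    {u Ψ : ℂ → ℂ} (hΨ : ContinuousOn Ψ (Metric.ball 0 ρ))
    (hΨe : ∀ z ∈ Metric.ball 0 ρ \ ⋃ j, Metric.ball (pts j) R₀,
        Complex.exp (Ψ z) = u z * ∏ i, (z - pts i) ^ (-deg i))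
    {Ω : Set ℂ} (hΩ : IsOpen Ω) (hu : ContDiffOn ℝ 1 u Ω) (hu0 : ∀ z ∈ Ω, u z ≠ 0)
    (hΩp : ∀ z ∈ Ω, ∀ i, z ≠ pts i) {c : ℂ} {r : ℝ} (hr : 0 < r)
    (hcΩ : ∀ t, circleMap c r t ∈ Ω)
    (hcb : ∀ t, circleMap c r t ∈ Metric.ball 0 ρ \ ⋃ j, Metric.ball (pts j) R₀) :
    Real.circleAverage (fun z => (fderiv ℝ u z (gradAngle c z) / u z).im
      - ∑ i, (deg i : ℝ) * angleKernel (pts i) c z) c r = 0 := by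
  have key := integral_logDeriv_circleMap hΨ hΨe hΩ hu hu0 hΩp hcΩ hcb
  have hγc : Continuous (circleMap c r) := continuous_circleMap c r
  have hγ'c : Continuous (deriv (circleMap c r)) := by
    have : deriv (circleMap c r) = fun t => circleMap 0 r t * Complex.I := by
      ext t; exact deriv_circleMap c r t
    rw [this]
    fun_prop
  have hqc : Continuous fun t =>
      (fderiv ℝ u (circleMap c r t) (deriv (circleMap c r) t) / u (circleMap c r t)
        - ∑ i, (deg i : ℂ) * (deriv (circleMap c r) t / (circleMap c r t - pts i))) := by
    have h1 : ContinuousOn (fderiv ℝ u) Ω := hu.continuousOn_fderiv_of_isOpen hΩ le_rfl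
    have h2 : Continuous fun t => fderiv ℝ u (circleMap c r t) (deriv (circleMap c r) t) :=
      (h1.comp_continuous hγc hcΩ).clm_apply hγ'c
    refine (h2.div (hu.continuousOn.comp_continuous hγc hcΩ) fun t => hu0 _ (hcΩ t)).sub
      (continuous_finsetSum _ fun i _ => ?_)
    exact continuous_const.mul (hγ'c.div (by fun_prop) fun t => sub_ne_zero.2 (hΩp _ (hcΩ t) i))
  have h1 := Complex.imCLM.intervalIntegral_comp_comm (μ := volume)
    (hqc.intervalIntegrable 0 (2 * Real.pi))
  rw [key, map_zero] at h1
  rw [Real.circleAverage_def, smul_eq_mul]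
  have h2 : ∀ t, (fderiv ℝ u (circleMap c r t) (gradAngle c (circleMap c r t))
        / u (circleMap c r t)).im
      - ∑ i, (deg i : ℝ) * angleKernel (pts i) c (circleMap c r t)
      = (r ^ 2)⁻¹ * Complex.imCLM
        (fderiv ℝ u (circleMap c r t) (deriv (circleMap c r) t) / u (circleMap c r t)
        - ∑ i, (deg i : ℂ) * (deriv (circleMap c r) t / (circleMap c r t - pts i))) := by
    intro t
    simp only [angleKernel]
    rw [gradAngle_circleMap c hr, map_smul, Complex.imCLM_apply, Complex.sub_im, Complex.im_sum,
      mul_sub, Finset.mul_sum, smul_div_assoc, Complex.smul_im, smul_eq_mul]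
    congr 1
    refine Finset.sum_congr rfl fun i _ => ?_
    rw [smul_div_assoc, Complex.smul_im, smul_eq_mul, ← Complex.ofReal_intCast, Complex.im_ofReal_mul]
    ring
  simp only [h2]
  rw [intervalIntegral.integral_const_mul, h1]
  simp

/-! ### Integrals of the interaction kernel -/

/-- A majorant of `1/(|z-a||z-b|)` on the disc of radius `R` around `b`. -/
theorem exists_kernel_majorant {a b : ℂ} {R : ℝ} (hab : a ≠ b) (hR : ‖a - b‖ ≤ R) :
    ∃ g : ℂ → ℝ, Integrable g ∧
      (∀ z ∈ Metric.closedBall b R, ‖z - a‖⁻¹ * ‖z - b‖⁻¹ ≤ g z) ∧ (∀ z, 0 ≤ g z) ∧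
      ∫ z, g z = (∫ z in Metric.ball b (2 * ‖a - b‖), ‖a - b‖⁻¹ * (‖z - a‖⁻¹ + ‖z - b‖⁻¹))
        + 4 * Real.pi * Real.log (R / ‖a - b‖) := by
  classical
  set L := ‖a - b‖ with hL
  have hLp : 0 < L := norm_pos_iff.2 (sub_ne_zero.2 hab)
  -- Only needed for `r ≥ 2L`, where `|z - a| ≥ |z - b|/2`. Starting already at `L` keeps a majorant
  -- and yields `log (R/L)` without assuming `2L ≤ R`.
  let w : ℝ → ℝ := (Ioc L R).indicator fun r => 2 * (r ^ 2)⁻¹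
  have hwm : Measurable w := (by fun_prop : Measurable fun r : ℝ => 2 * (r ^ 2)⁻¹).indicator
    measurableSet_Ioc
  have hw0 : ∀ r, 0 ≤ w r := fun r => indicator_nonneg (fun r _ => by positivity) r
  let g1 : ℂ → ℝ := (Metric.ball b (2 * L)).indicator fun z => L⁻¹ * (‖z - a‖⁻¹ + ‖z - b‖⁻¹)
  have hg1 : Integrable g1 := (integrable_indicator_iff Metric.isOpen_ball.measurableSet).2
    (((integrableOn_inv_norm_sub_ball a b _).add (integrableOn_inv_norm_sub_ball b b _)).const_mul _)
  have hg2m : Measurable fun z : ℂ => w ‖z - b‖ * 1 :=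
    (hwm.comp (by fun_prop)).mul measurable_const
  have hg2 : Integrable fun z : ℂ => w ‖z - b‖ * 1 := by
    refine integrable_of_bounded_of_support hg2m (M := 2 * (L ^ 2)⁻¹) (ρ := R) (c := b)
      (fun z => ?_) fun z hz => ?_
    · rw [mul_one, abs_of_nonneg (hw0 _)]
      simp only [w, indicator_apply]
      split_ifs with h
      · have := h.1
        gcongr
      · positivity
    · rw [mul_one]
      exact indicator_of_notMem (fun h => absurd h.2 (not_le.2 hz)) _
  refine ⟨fun z => g1 z + w ‖z - b‖ * 1, hg1.add hg2, fun z hz => ?_, fun z => ?_, ?_⟩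
  · beta_reduce
    rw [Metric.mem_closedBall, dist_eq_norm] at hz
    have htri : L ≤ ‖z - a‖ + ‖z - b‖ := by
      rw [hL, norm_sub_rev z a]
      simpa using norm_add_le (a - z) (z - b)
    by_cases hb : z ∈ Metric.ball b (2 * L)
    · have h1 : g1 z = L⁻¹ * (‖z - a‖⁻¹ + ‖z - b‖⁻¹) := indicator_of_mem hb _
      have h2 := hw0 ‖z - b‖
      rw [h1]
      have h1' : 0 ≤ L⁻¹ * (‖z - a‖⁻¹ + ‖z - b‖⁻¹) := by positivity
      -- At the two centres the convention `0⁻¹ = 0` makes the left side vanish.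
      rcases eq_or_lt_of_le (norm_nonneg (z - a)) with h0 | h0
      · rw [← h0] at h1' ⊢; rw [inv_zero, zero_mul]; rw [inv_zero] at h1'; linarith
      rcases eq_or_lt_of_le (norm_nonneg (z - b)) with h0' | h0'
      · rw [← h0'] at h1' h2 ⊢; rw [inv_zero, mul_zero]; rw [inv_zero] at h1'; linarith
      -- Partial fractions, from `L ≤ |z - a| + |z - b|`.
      have h3 : ‖z - a‖⁻¹ * ‖z - b‖⁻¹ ≤ L⁻¹ * (‖z - a‖⁻¹ + ‖z - b‖⁻¹) := by
        rw [inv_mul_eq_div L, le_div_iff₀ hLp]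
        calc ‖z - a‖⁻¹ * ‖z - b‖⁻¹ * L ≤ ‖z - a‖⁻¹ * ‖z - b‖⁻¹ * (‖z - a‖ + ‖z - b‖) := by
              gcongr
          _ = ‖z - a‖⁻¹ + ‖z - b‖⁻¹ := by field_simp; ring
      linarith
    · rw [Metric.mem_ball, dist_eq_norm, not_lt] at hb
      have h1 : 0 ≤ g1 z := indicator_nonneg (fun z _ => by positivity) z
      have hzb : 0 < ‖z - b‖ := by linarith
      have h2 : w ‖z - b‖ = 2 * (‖z - b‖ ^ 2)⁻¹ := 
        indicator_of_mem (show ‖z - b‖ ∈ Ioc L R from ⟨by linarith, hz⟩) _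
      have htri2 : ‖z - b‖ ≤ ‖z - a‖ + L := by
        simpa [hL] using norm_add_le (z - a) (a - b)
      have h3 : ‖z - a‖⁻¹ ≤ 2 * ‖z - b‖⁻¹ := by
        rw [← div_eq_mul_inv, ← inv_div]
        exact inv_anti₀ (by positivity) (by linarith)
      rw [h2]
      have h4 : ‖z - a‖⁻¹ * ‖z - b‖⁻¹ ≤ 2 * ‖z - b‖⁻¹ * ‖z - b‖⁻¹ := by gcongr
      have h5 : 2 * ‖z - b‖⁻¹ * ‖z - b‖⁻¹ = 2 * (‖z - b‖ ^ 2)⁻¹ := by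
        rw [sq, mul_inv]; ring
      linarith
  · exact add_nonneg (indicator_nonneg (fun z _ => by positivity) z) (by linarith [hw0 ‖z - b‖])
  · rw [integral_add hg1 hg2, integral_indicator Metric.isOpen_ball.measurableSet,
      integral_radial_mul (F := fun _ => (1 : ℝ)) hg2 hg2m]
    congr 1
    simp only [Real.circleAverage_const]
    have h2 : ∀ r ∈ Ioi (0 : ℝ), 2 * Real.pi * r * (w r * 1)
        = (Ioc L R).indicator (fun r => 4 * Real.pi * (1 / r)) r := by
      intro r hr
      have hr0 : r ≠ 0 := (mem_Ioi.1 hr).ne'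
      simp only [w, indicator_apply]
      split_ifs
      · field_simp; ring
      · simp
    have h3 : Ioi (0 : ℝ) ∩ Ioc L R = Ioc L R :=
      inter_eq_right.2 fun r hr => hLp.trans hr.1
    rw [setIntegral_congr_fun measurableSet_Ioi h2, setIntegral_indicator measurableSet_Ioc, h3,
      integral_const_mul, setIntegral_one_div_Ioc hLp hR]

theorem measurable_inv_norm_mul (a b : ℂ) : Measurable fun z : ℂ => ‖z - a‖⁻¹ * ‖z - b‖⁻¹ := by
  fun_prop

theorem integrableOn_kernel {a b : ℂ} {R : ℝ} (hab : a ≠ b) (hR : ‖a - b‖ ≤ R) :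
    IntegrableOn (fun z => ‖z - a‖⁻¹ * ‖z - b‖⁻¹) (Metric.closedBall b R) := by
  obtain ⟨g, hg, hle, -, -⟩ := exists_kernel_majorant hab hR
  refine hg.integrableOn.mono' (measurable_inv_norm_mul a b).aestronglyMeasurable ?_
  refine (ae_restrict_iff' Metric.isClosed_closedBall.measurableSet).2
    (Filter.Eventually.of_forall fun z hz => ?_)
  rw [Real.norm_eq_abs, abs_of_nonneg (by positivity)]
  exact hle z hz

/-- Within `2L` of `b` each of the two singularities contributes at most `L⁻¹ · 3π · 2L = 6π`; the
logarithm is the far part. -/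
theorem integral_kernel_le {a b : ℂ} {R : ℝ} (hab : a ≠ b) (hR : ‖a - b‖ ≤ R) :
    ∫ z in Metric.closedBall b R, ‖z - a‖⁻¹ * ‖z - b‖⁻¹
      ≤ 12 * Real.pi + 4 * Real.pi * Real.log (R / ‖a - b‖) := by
  obtain ⟨g, hg, hle, hg0, hint⟩ := exists_kernel_majorant hab hR
  have hLp : 0 < ‖a - b‖ := norm_pos_iff.2 (sub_ne_zero.2 hab)
  have h1 : ∫ z in Metric.closedBall b R, ‖z - a‖⁻¹ * ‖z - b‖⁻¹ ≤ ∫ z, g z :=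
    (setIntegral_mono_on (integrableOn_kernel hab hR) hg.integrableOn
      Metric.isClosed_closedBall.measurableSet hle).trans
      (setIntegral_le_integral hg (Filter.Eventually.of_forall hg0))
  have h2 : ∫ z in Metric.ball b (2 * ‖a - b‖), ‖a - b‖⁻¹ * (‖z - a‖⁻¹ + ‖z - b‖⁻¹)
      ≤ 12 * Real.pi := by
    rw [integral_const_mul, integral_add (integrableOn_inv_norm_sub_ball a b _)
      (integrableOn_inv_norm_sub_ball b b _)]
    have h3 := integral_inv_norm_sub_ball_le a b (ρ := 2 * ‖a - b‖) (by positivity)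
    have h4 := integral_inv_norm_sub_ball_le b b (ρ := 2 * ‖a - b‖) (by positivity)
    rw [inv_mul_le_iff₀ hLp]
    linarith
  linarith

/-! ### Good sets and the interaction kernel over them -/

/-- The points whose distance to `aⱼ` is a good radius. -/
def goodSet {m : ℕ} (R R₀ : ℝ) (pts : Fin m → ℂ) (j : Fin m) : Set ℂ :=
  {z | ‖z - pts j‖ ∈ goodRadii R R₀ pts j}

theorem isClosed_goodSet {m : ℕ} (R R₀ : ℝ) (pts : Fin m → ℂ) (j : Fin m) :
    IsClosed (goodSet R R₀ pts j) :=
  (isClosed_goodRadii R R₀ pts j).preimage (by fun_prop)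

theorem measurableSet_goodSet {m : ℕ} (R R₀ : ℝ) (pts : Fin m → ℂ) (j : Fin m) :
    MeasurableSet (goodSet R R₀ pts j) := (isClosed_goodSet R R₀ pts j).measurableSet

theorem norm_sub_le_of_mem_goodSet {m : ℕ} {R R₀ : ℝ} {pts : Fin m → ℂ} {j : Fin m} {z : ℂ}
    (hz : z ∈ goodSet R R₀ pts j) : ‖z - pts j‖ ≤ R / 4 := hz.2.1

/-- The reverse triangle inequality turns the condition on the radius into a distance from every
other centre. -/
theorem le_norm_sub_of_mem_goodSet {m : ℕ} {R R₀ : ℝ} {pts : Fin m → ℂ} {j : Fin m} {z : ℂ}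
    (hz : z ∈ goodSet R R₀ pts j) (i : Fin m) : 2 * R₀ ≤ ‖z - pts i‖ := by
  by_cases hij : i = j
  · rw [hij]; exact hz.1
  · refine (hz.2.2 i hij).trans ?_
    have h := abs_norm_sub_norm_le (z - pts j) (pts i - pts j)
    simpa using h

theorem isCompact_goodSet {m : ℕ} (R R₀ : ℝ) (pts : Fin m → ℂ) (j : Fin m) :
    IsCompact (goodSet R R₀ pts j) := by
  refine (isCompact_closedBall (pts j) (R / 4)).of_isClosed_subset (isClosed_goodSet R R₀ pts j)
    fun z hz => ?_
  rw [Metric.mem_closedBall, dist_eq_norm]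
  exact norm_sub_le_of_mem_goodSet hz

theorem goodSet_subset_closedBall {m : ℕ} {R R₀ : ℝ} (hR : 0 ≤ R) (pts : Fin m → ℂ) (j : Fin m) :
    goodSet R R₀ pts j ⊆ Metric.closedBall (pts j) R := fun z hz => by
  rw [Metric.mem_closedBall, dist_eq_norm]
  linarith [norm_sub_le_of_mem_goodSet hz]

/-- The kernel has bounded integral over the points that are good for `aⱼ` but not for `aᵢ`. -/
theorem integral_kernel_goodSet_diff_le {m : ℕ} {R R₀ : ℝ} {pts : Fin m → ℂ} {i j : Fin m}
    (hR₀ : 0 < R₀) (hR : 0 < R) (hsep : ∀ k, k ≠ i → 4 * R₀ ≤ ‖pts k - pts i‖) (hij : i ≠ j)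
    (hLR : ‖pts i - pts j‖ ≤ R) :
    ∫ z in goodSet R R₀ pts j \ goodSet R R₀ pts i, ‖z - pts i‖⁻¹ * ‖z - pts j‖⁻¹
      ≤ 6 * Real.pi + m * (12 * Real.pi) := by
  classical
  have hab : pts i ≠ pts j := by
    intro h
    have := hsep j hij.symm
    rw [h, sub_self, norm_zero] at this
    linarith
  let B := goodSet R R₀ pts j \ goodSet R R₀ pts i
  have hBm : MeasurableSet B :=
    (measurableSet_goodSet R R₀ pts j).diff (measurableSet_goodSet R R₀ pts i)
  -- There are two ways to be bad for `aᵢ`. If `|z - aᵢ|` is near some `|aₖ - aᵢ|`, then `|z - aᵢ|⁻¹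
  -- ≤ 2|aₖ - aᵢ|⁻¹` on a ball of comparable radius, and `F k` applies. If `|z - aᵢ| > R/4`, then
  -- `G` applies. Both majorants have scale-invariant integrals.
  let I : Fin m → Set ℂ := fun k => if k = i then ∅ else Metric.ball (pts i) (2 * ‖pts k - pts i‖)
  let F : Fin m → ℂ → ℝ := fun k =>
    (I k).indicator fun z => 2 * ‖pts k - pts i‖⁻¹ * ‖z - pts j‖⁻¹
  have hIm : ∀ k, MeasurableSet (I k) := fun k => by
    simp only [I]; split_ifs; exacts [MeasurableSet.empty, Metric.isOpen_ball.measurableSet]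
  have hFi : ∀ k, Integrable (F k) := fun k => by
    refine (integrable_indicator_iff (hIm k)).2 ?_
    by_cases hk : k = i
    · simp [I, hk]
    · simp only [I, if_neg hk]
      exact (integrableOn_inv_norm_sub_ball _ _ _).const_mul _
  have hF0 : ∀ k z, 0 ≤ F k z := fun k z => indicator_nonneg (fun z _ => by positivity) z
  have hFint : ∀ k, ∫ z, F k z ≤ 12 * Real.pi := fun k => by
    rw [integral_indicator (hIm k)]
    by_cases hk : k = i
    · simp [I, hk]; positivity
    · simp only [I, if_neg hk]
      have hs : 0 < ‖pts k - pts i‖ := by linarith [hsep k hk]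
      rw [integral_const_mul]
      have := integral_inv_norm_sub_ball_le (pts j) (pts i) (ρ := 2 * ‖pts k - pts i‖)
        (by positivity)
      calc _ ≤ 2 * ‖pts k - pts i‖⁻¹ * (3 * Real.pi * (2 * ‖pts k - pts i‖)) := by gcongr
        _ = 12 * Real.pi := by field_simp; norm_num
  let G : ℂ → ℝ := (Metric.ball (pts j) (R / 2)).indicator fun z => 4 / R * ‖z - pts j‖⁻¹
  have hGi : Integrable G := (integrable_indicator_iff Metric.isOpen_ball.measurableSet).2
    ((integrableOn_inv_norm_sub_ball _ _ _).const_mul _)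
  have hG0 : ∀ z, 0 ≤ G z := fun z => indicator_nonneg (fun z _ => by positivity) z
  have hGint : ∫ z, G z ≤ 6 * Real.pi := by
    rw [integral_indicator Metric.isOpen_ball.measurableSet, integral_const_mul]
    have := integral_inv_norm_sub_ball_le (pts j) (pts j) (ρ := R / 2) (by positivity)
    calc _ ≤ 4 / R * (3 * Real.pi * (R / 2)) := by gcongr
      _ = 6 * Real.pi := by field_simp; norm_num
  have hsum : Integrable fun z => ∑ k, F k z := integrable_finsetSum _ fun k _ => hFi k
  have hpt : ∀ z ∈ B, ‖z - pts i‖⁻¹ * ‖z - pts j‖⁻¹ ≤ G z + ∑ k, F k z := by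
    rintro z ⟨hzj, hzi⟩
    have hS : 0 ≤ ∑ k, F k z := Finset.sum_nonneg fun k _ => hF0 k z
    by_cases hfar : R / 4 < ‖z - pts i‖
    · have h1 : G z = 4 / R * ‖z - pts j‖⁻¹ := by
        refine indicator_of_mem ?_ _
        rw [Metric.mem_ball, dist_eq_norm]
        linarith [norm_sub_le_of_mem_goodSet hzj]
      have h2 : ‖z - pts i‖⁻¹ ≤ 4 / R := by
        rw [← inv_div]; exact inv_anti₀ (by positivity) hfar.le
      have h3 : ‖z - pts i‖⁻¹ * ‖z - pts j‖⁻¹ ≤ 4 / R * ‖z - pts j‖⁻¹ := by gcongr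
      linarith
    · obtain ⟨k, hk, hkz⟩ : ∃ k, k ≠ i ∧ |‖z - pts i‖ - ‖pts k - pts i‖| < 2 * R₀ := by
        by_contra hcon
        push Not at hcon
        exact hzi ⟨le_norm_sub_of_mem_goodSet hzj i, not_lt.1 hfar, hcon⟩
      have hs := hsep k hk
      rw [abs_lt] at hkz
      have h1 : F k z = 2 * ‖pts k - pts i‖⁻¹ * ‖z - pts j‖⁻¹ := by
        refine indicator_of_mem ?_ _
        simp only [I, if_neg hk]
        rw [Metric.mem_ball, dist_eq_norm]
        linarith [hkz.2]
      have h2 : ‖z - pts i‖⁻¹ ≤ 2 * ‖pts k - pts i‖⁻¹ := by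
        rw [← div_eq_mul_inv, ← inv_div]
        refine inv_anti₀ (div_pos (by linarith) two_pos) ?_
        linarith [hkz.1]
      have h3 : ‖z - pts i‖⁻¹ * ‖z - pts j‖⁻¹ ≤ 2 * ‖pts k - pts i‖⁻¹ * ‖z - pts j‖⁻¹ := by
        gcongr
      have h4 := Finset.single_le_sum (fun k _ => hF0 k z) (Finset.mem_univ k)
      have h5 := hG0 z
      linarith
  have hBi : IntegrableOn (fun z => ‖z - pts i‖⁻¹ * ‖z - pts j‖⁻¹) B :=
    (integrableOn_kernel hab hLR).mono_set
      (sdiff_subset.trans (goodSet_subset_closedBall hR.le pts j))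
  calc _ ≤ ∫ z in B, (G z + ∑ k, F k z) :=
        setIntegral_mono_on hBi (hGi.add hsum).integrableOn hBm hpt
    _ ≤ ∫ z, (G z + ∑ k, F k z) := setIntegral_le_integral (hGi.add hsum)
        (Filter.Eventually.of_forall fun z =>
          add_nonneg (hG0 z) (Finset.sum_nonneg fun k _ => hF0 k z))
    _ = (∫ z, G z) + ∑ k, ∫ z, F k z := by
        rw [integral_add hGi hsum, integral_finsetSum _ fun k _ => hFi k]
    _ ≤ 6 * Real.pi + ∑ _k : Fin m, 12 * Real.pi := by
        gcongr with k _
        exact hFint k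
    _ = 6 * Real.pi + m * (12 * Real.pi) := by simp

/-- The exact interaction energy over the points that are good for `aⱼ`. -/
theorem integral_angleKernel_goodSet {m : ℕ} {R R₀ : ℝ} {pts : Fin m → ℂ} {i j : Fin m}
    (hR₀ : 0 < R₀) (hij : i ≠ j) :
    ∫ z in goodSet R R₀ pts j, angleKernel (pts i) (pts j) z
      = 2 * Real.pi * ∫ r in goodRadii R R₀ pts j ∩ Ioi ‖pts i - pts j‖, 1 / r := by
  classical
  set S := goodRadii R R₀ pts j with hS
  set L := ‖pts i - pts j‖ with hL
  let χ : ℝ → ℝ := S.indicator fun _ => 1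
  have hSm : MeasurableSet S := measurableSet_goodRadii R R₀ pts j
  have hχm : Measurable χ := measurable_const.indicator hSm
  have e : (goodSet R R₀ pts j).indicator (angleKernel (pts i) (pts j))
      = fun z => χ ‖z - pts j‖ * angleKernel (pts i) (pts j) z := by
    ext z
    by_cases hz : z ∈ goodSet R R₀ pts j
    · have : ‖z - pts j‖ ∈ S := hz
      simp [χ, hz, this]
    · have : ‖z - pts j‖ ∉ S := hz
      simp [χ, hz, this]
  have hm : Measurable fun z => χ ‖z - pts j‖ * angleKernel (pts i) (pts j) z :=
    (hχm.comp (by fun_prop)).mul (measurable_angleKernel _ _)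
  have hi : Integrable fun z => χ ‖z - pts j‖ * angleKernel (pts i) (pts j) z := by
    refine integrable_of_bounded_of_support hm (M := (2 * R₀)⁻¹ * (2 * R₀)⁻¹) (ρ := R / 4)
      (c := pts j) (fun z => ?_) fun z hz => ?_
    · by_cases hz : z ∈ goodSet R R₀ pts j
      · have h1 : χ ‖z - pts j‖ = 1 := indicator_of_mem (show ‖z - pts j‖ ∈ S from hz) _
        rw [h1, one_mul]
        refine (abs_angleKernel_le _ _ _).trans ?_
        have h2 := le_norm_sub_of_mem_goodSet hz i
        have h3 := le_norm_sub_of_mem_goodSet hz j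
        gcongr
      · have h1 : χ ‖z - pts j‖ = 0 := indicator_of_notMem (show ‖z - pts j‖ ∉ S from hz) _
        rw [h1, zero_mul, abs_zero]
        positivity
    · have h1 : χ ‖z - pts j‖ = 0 :=
        indicator_of_notMem (fun h => absurd h.2.1 (not_le.2 hz)) _
      rw [h1, zero_mul]
  rw [← integral_indicator (measurableSet_goodSet R R₀ pts j), e, integral_radial_mul hi hm,
    ← integral_const_mul, ← integral_indicator (hSm.inter measurableSet_Ioi),
    ← integral_indicator measurableSet_Ioi]
  congr 1
  ext r
  by_cases hrS : r ∈ S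
  · have hr0 : 0 < r := by linarith [hrS.1]
    -- Good radii stay `2R₀` away from the one radius whose circle passes through `aᵢ`.
    have hne : r ≠ ‖pts i - pts j‖ := by
      intro h
      have := hrS.2.2 i hij
      rw [h, sub_self, abs_zero] at this
      linarith
    have h1 : χ r = 1 := indicator_of_mem hrS _
    rw [indicator_of_mem (mem_Ioi.2 hr0), h1, circleAverage_angleKernel hr0 hne]
    by_cases hlt : ‖pts i - pts j‖ < r
    · rw [if_pos hlt, indicator_of_mem (show r ∈ S ∩ Ioi L from ⟨hrS, hlt⟩)]
      field_simp
    · rw [if_neg hlt, indicator_of_notMem (s := S ∩ Ioi L) fun h => hlt h.2]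
      ring
  · have h1 : χ r = 0 := indicator_of_notMem hrS _
    rw [indicator_of_notMem (s := S ∩ Ioi L) fun h => hrS h.1, indicator_apply, h1]
    simp

/-! ### Weighted interactions -/

/-- For `t, h, k` in `[0, 1 - a²]` the weight `2(1-k) - (1-h)(1-k)/(1-t)` is close to `1`, up to an
error controlled by the potential. -/
theorem IsPotential.exists_weight_error {J : ℝ → ℝ} (hJ : IsPotential J) {a : ℝ} (ha : 0 < a)
    (ha1 : a ≤ 1) : ∃ C : ℝ, 0 ≤ C ∧ ∀ t ∈ Icc 0 (1 - a ^ 2), ∀ h ∈ Icc 0 (1 - a ^ 2),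
      ∀ k ∈ Icc 0 (1 - a ^ 2),
      |2 * (1 - k) - (1 - h) * (1 - k) * (1 - t)⁻¹ - 1|
        ≤ (1 - a ^ 2) / 2 + C * (J t + J h + J k) := by
  have ha2 : 0 < a ^ 2 := by positivity
  rcases eq_or_lt_of_le ha1 with rfl | hlt
  -- For `a = 1` all three variables are zero and so is the error.
  · refine ⟨0, le_rfl, ?_⟩
    rintro t ⟨ht, ht'⟩ h ⟨hh, hh'⟩ k ⟨hk, hk'⟩
    have e1 : t = 0 := by linarith
    have e2 : h = 0 := by linarith
    have e3 : k = 0 := by linarith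
    rw [e1, e2, e3]
    norm_num
  have h1a : 0 < 1 - a ^ 2 := by nlinarith
  -- If all variables are at most `ε`, the error is at most `4ε = (1 - a²)/2`. Otherwise the
  -- potential terms total at least `J ε`, and the crude bound `N` on the error is paid for by `N /
  -- J ε`.
  set ε := (1 - a ^ 2) / 8 with hε
  have hεp : 0 < ε := by positivity
  have hε1 : ε ≤ 1 / 8 := by rw [hε]; linarith
  have hJε : 0 < J ε := hJ.pos ε hεp
  set N : ℝ := 2 + (a ^ 2)⁻¹ with hN
  have hNp : 0 < N := by positivity
  refine ⟨N / J ε, by positivity, ?_⟩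
  rintro t ⟨ht, ht'⟩ h ⟨hh, hh'⟩ k ⟨hk, hk'⟩
  have hJt := hJ.nonneg t
  have hJh := hJ.nonneg h
  have hJk := hJ.nonneg k
  have htp : 0 < 1 - t := by linarith
  have hinv1 : 1 ≤ (1 - t)⁻¹ := (one_le_inv₀ htp).2 (by linarith)
  by_cases hsmall : t ≤ ε ∧ h ≤ ε ∧ k ≤ ε
  · obtain ⟨h1, h2, h3⟩ := hsmall
    have hC : 0 ≤ N / J ε * (J t + J h + J k) := by positivity
    have hinv2 : (1 - t)⁻¹ ≤ 1 + 2 * ε := by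
      rw [inv_le_iff_one_le_mul₀ htp]
      nlinarith
    have hp : 0 ≤ (1 - h) * (1 - k) := mul_nonneg (by linarith) (by linarith)
    have hp1 : (1 - h) * (1 - k) ≤ 1 := by nlinarith
    have hp2 : 1 - 2 * ε ≤ (1 - h) * (1 - k) := by nlinarith
    have h4 : (1 - h) * (1 - k) * (1 - t)⁻¹ ≤ 1 + 2 * ε := by
      calc _ ≤ 1 * (1 + 2 * ε) := by gcongr
        _ = _ := one_mul _
    have h5 : 1 - 2 * ε ≤ (1 - h) * (1 - k) * (1 - t)⁻¹ :=
      hp2.trans (le_mul_of_one_le_right hp hinv1)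
    have h6 : (1 - a ^ 2) / 2 = 4 * ε := by rw [hε]; ring
    rw [h6, abs_le]
    constructor <;> linarith
  · have hbig : J ε ≤ J t + J h + J k := by
      by_contra hcon
      refine hsmall ⟨?_, ?_, ?_⟩ <;> by_contra hc <;> push Not at hc
      · linarith [hJ.mono hεp.le hc.le (by linarith)]
      · linarith [hJ.mono hεp.le hc.le (by linarith)]
      · linarith [hJ.mono hεp.le hc.le (by linarith)]
    have h1 : N ≤ N / J ε * (J t + J h + J k) := by
      rw [div_mul_eq_mul_div, le_div_iff₀ hJε]
      gcongr
    have hinv2 : (1 - t)⁻¹ ≤ (a ^ 2)⁻¹ := inv_anti₀ ha2 (by linarith)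
    have hp : 0 ≤ (1 - h) * (1 - k) := mul_nonneg (by linarith) (by linarith)
    have hp1 : (1 - h) * (1 - k) ≤ 1 := by nlinarith
    have h4 : (1 - h) * (1 - k) * (1 - t)⁻¹ ≤ (a ^ 2)⁻¹ := by
      calc _ ≤ 1 * (a ^ 2)⁻¹ := by gcongr
        _ = _ := one_mul _
    have h5 : 0 ≤ (1 - h) * (1 - k) * (1 - t)⁻¹ := mul_nonneg hp (by linarith)
    have ha3 : 0 < (a ^ 2)⁻¹ := by positivity
    rw [abs_le]
    constructor <;> linarith

/-- A weight function `1 ≤ W ≤ a⁻²` equal to `1` off the disc of radius `R`. In the application,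
`W = 1/|u|²`. -/
structure IsWeight (W : ℂ → ℝ) (a R : ℝ) : Prop where
  measurable : Measurable W
  one_le : ∀ z, 1 ≤ W z
  le : ∀ z, W z ≤ (a ^ 2)⁻¹
  eq_one : ∀ z, R ≤ ‖z‖ → W z = 1

/-- The deficit `h = 1 - 1/W̄`, `W̄` being the average of `W` on the circle of radius `r`. -/
def deficit (W : ℂ → ℝ) (c : ℂ) (r : ℝ) : ℝ := 1 - (Real.circleAverage W c r)⁻¹

/-! ### Weights and their circular means -/

namespace IsWeight

variable {W : ℂ → ℝ} {a R : ℝ}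

theorem circleIntegrable (hW : IsWeight W a R) (c : ℂ) (r : ℝ) : CircleIntegrable W c r :=
  circleIntegrable_of_bounded hW.measurable (M := (a ^ 2)⁻¹) (fun z => by
    rw [abs_of_nonneg (by linarith [hW.one_le z])]; exact hW.le z) c r

theorem one_le_circleAverage (hW : IsWeight W a R) (c : ℂ) (r : ℝ) :
    1 ≤ Real.circleAverage W c r := by
  have := Real.circleAverage_mono (circleIntegrable_const (1 : ℝ) c r) (hW.circleIntegrable c r)
    fun z _ => hW.one_le z
  rwa [Real.circleAverage_const] at this

theorem circleAverage_le (hW : IsWeight W a R) (c : ℂ) (r : ℝ) :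
    Real.circleAverage W c r ≤ (a ^ 2)⁻¹ := by
  have := Real.circleAverage_mono (hW.circleIntegrable c r)
    (circleIntegrable_const ((a ^ 2)⁻¹ : ℝ) c r) fun z _ => hW.le z
  rwa [Real.circleAverage_const] at this

theorem deficit_mem (hW : IsWeight W a R) (c : ℂ) (r : ℝ) :
    deficit W c r ∈ Icc 0 (1 - a ^ 2) := by
  have h1 := hW.one_le_circleAverage c r
  have h2 := inv_anti₀ (by linarith) (hW.circleAverage_le c r)
  rw [inv_inv] at h2
  have h3 := inv_le_one_of_one_le₀ h1
  unfold deficit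
  constructor <;> linarith

theorem deficit_mem' (hW : IsWeight W a R) (ha : 0 < a) (c : ℂ) (r : ℝ) :
    deficit W c r ∈ Icc (0 : ℝ) 1 :=
  ⟨(hW.deficit_mem c r).1, by
    have := (hW.deficit_mem c r).2
    have : 0 < a ^ 2 := by positivity
    linarith⟩

theorem one_sub_inv_mem (hW : IsWeight W a R) (z : ℂ) :
    1 - (W z)⁻¹ ∈ Icc 0 (1 - a ^ 2) := by
  have h1 := hW.one_le z
  have h2 := inv_anti₀ (by linarith) (hW.le z)
  rw [inv_inv] at h2
  have h3 := inv_le_one_of_one_le₀ h1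
  constructor <;> linarith

theorem measurable_deficit (hW : IsWeight W a R) (c : ℂ) : Measurable (deficit W c) :=
  measurable_const.sub (measurable_circleAverage hW.measurable c).inv

/-- Such circles lie outside the disc of radius `R`, where `W = 1`. This gives the radial potential
bounded support. -/
theorem deficit_eq_zero (hW : IsWeight W a R) {c : ℂ} (hc : ‖c‖ ≤ R) {r : ℝ} (hr : 2 * R < r) :
    deficit W c r = 0 := by
  have hr0 : 0 < r := by linarith [norm_nonneg c]
  have : Real.circleAverage W c r = 1 := by
    refine Real.circleAverage_const_on_circle fun z hz => hW.eq_one z ?_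
    rw [Metric.mem_sphere, dist_eq_norm, abs_of_pos hr0] at hz
    have := norm_sub_le z c
    linarith
  rw [deficit, this, inv_one, sub_self]

variable {J : ℝ → ℝ}

theorem measurable_potential (hW : IsWeight W a R) (hJ : IsPotential J) :
    Measurable fun z => J (1 - (W z)⁻¹) :=
  hJ.contDiff.continuous.measurable.comp (measurable_const.sub hW.measurable.inv)

theorem abs_J_le (hJ : IsPotential J) (ha : 0 < a) {t : ℝ} (ht : t ∈ Icc 0 (1 - a ^ 2)) :
    |J t| ≤ J 1 := by
  have : 0 < a ^ 2 := by positivity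
  rw [abs_of_nonneg (hJ.nonneg t)]
  exact hJ.mono ht.1 (by linarith [ht.2]) le_rfl

theorem integrable_potential (hW : IsWeight W a R) (hJ : IsPotential J) (ha : 0 < a) :
    Integrable fun z => J (1 - (W z)⁻¹) := by
  refine integrable_of_bounded_of_support (hW.measurable_potential hJ) (M := J 1) (ρ := R) (c := 0)
    (fun z => abs_J_le hJ ha (hW.one_sub_inv_mem z)) fun z hz => ?_
  rw [sub_zero] at hz
  rw [hW.eq_one z hz.le, inv_one, sub_self, hJ.zero]

theorem measurable_deficit_norm (hW : IsWeight W a R) (hJ : IsPotential J) (c : ℂ) :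
    Measurable fun z : ℂ => J (deficit W c ‖z - c‖) :=
  hJ.contDiff.continuous.measurable.comp ((hW.measurable_deficit c).comp (by fun_prop))

theorem integrable_deficit (hW : IsWeight W a R) (hJ : IsPotential J) (ha : 0 < a) {c : ℂ}
    (hc : ‖c‖ ≤ R) : Integrable fun z => J (deficit W c ‖z - c‖) := by
  refine integrable_of_bounded_of_support (hW.measurable_deficit_norm hJ c) (M := J 1)
    (ρ := 2 * R) (c := c) (fun z => abs_J_le hJ ha (hW.deficit_mem c _)) fun z hz => ?_
  rw [hW.deficit_eq_zero hc hz, hJ.zero]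

theorem integrable_deficit_radial (hW : IsWeight W a R) (hJ : IsPotential J) (ha : 0 < a) {c : ℂ}
    (hc : ‖c‖ ≤ R) : IntegrableOn (fun r => J (deficit W c r) * r) (Ioi 0) ∧
      ∫ z, J (deficit W c ‖z - c‖) = 2 * Real.pi * ∫ r in Ioi 0, J (deficit W c r) * r := by
  have h1 : Integrable fun z : ℂ => J (deficit W c ‖z - c‖) * 1 := by
    simpa using hW.integrable_deficit hJ ha hc
  have h1m : Measurable fun z : ℂ => J (deficit W c ‖z - c‖) * 1 :=
    (hW.measurable_deficit_norm hJ c).mul_const 1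
  have h2 := integrableOn_circleAverage h1 h1m c
  have h3 := integral_radial_mul (g := fun r => J (deficit W c r)) (F := fun _ => (1 : ℝ)) h1 h1m
  have hpi := Real.two_pi_pos.ne'
  constructor
  · refine IntegrableOn.congr_fun (h2.const_mul (2 * Real.pi)⁻¹) (fun r hr => ?_) measurableSet_Ioi
    have := circleAverage_radial_mul (fun r => J (deficit W c r)) (fun _ => 1) c
      (le_of_lt (mem_Ioi.1 hr))
    rw [Real.circleAverage_const] at this
    simp only [this]
    field_simp
  · simp only [Real.circleAverage_const, mul_one] at h3
    rw [h3, ← integral_const_mul]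
    refine setIntegral_congr_fun measurableSet_Ioi fun r _ => ?_
    ring

/-- The budget of the circular means. -/
theorem integral_deficit_le (hW : IsWeight W a R) (hJ : IsPotential J) (ha : 0 < a) {κ : ℝ}
    (hκ : 0 < κ)
    (hκJ : ∀ h ∈ Icc (0 : ℝ) 1, ∃ s : ℝ, ∀ t ∈ Icc (0 : ℝ) 1, κ * J h + s * (t - h) ≤ J t)
    {c : ℂ} (hc : ‖c‖ ≤ R) :
    ∫ z, J (deficit W c ‖z - c‖) ≤ (a ^ 2)⁻¹ / κ * ∫ z, J (1 - (W z)⁻¹) := by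
  obtain ⟨h1, h2⟩ := hW.integrable_deficit_radial hJ ha hc
  have h3 := integrableOn_circleAverage (hW.integrable_potential hJ ha) (hW.measurable_potential hJ)
    c
  rw [h2, integral_eq_integral_circleAverage (hW.integrable_potential hJ ha)
    (hW.measurable_potential hJ) c, ← integral_const_mul, ← integral_const_mul]
  refine setIntegral_mono_on (h1.const_mul _) (h3.const_mul _) measurableSet_Ioi fun r hr => ?_
  have hr0 : 0 < r := hr
  have h4 := potential_circleAverage_le hJ hκ hκJ hW.measurable hW.one_le hW.le c r
  have h5 : J (deficit W c r)
      ≤ (a ^ 2)⁻¹ / κ * Real.circleAverage (fun z => J (1 - (W z)⁻¹)) c r := by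
    rw [div_mul_eq_mul_div, le_div_iff₀ hκ, mul_comm]
    exact h4
  have hpi := Real.two_pi_pos
  calc 2 * Real.pi * (J (deficit W c r) * r)
      ≤ 2 * Real.pi * ((a ^ 2)⁻¹ / κ * Real.circleAverage (fun z => J (1 - (W z)⁻¹)) c r * r) := by
        gcongr
    _ = _ := by ring

end IsWeight

/-! ### Interaction integrals of the test field -/

/-- The radial coefficient `β_j` of the test field. -/
def radialWeight {m : ℕ} (W : ℂ → ℝ) (R R₀ : ℝ) (pts : Fin m → ℂ) (j : Fin m) (r : ℝ) : ℝ :=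
  (goodRadii R R₀ pts j).indicator (fun r => (Real.circleAverage W (pts j) r)⁻¹) r

/-- The interaction density of the test field between `aᵢ` and `aⱼ`. -/
def interaction {m : ℕ} (W : ℂ → ℝ) (R R₀ : ℝ) (pts : Fin m → ℂ) (i j : Fin m) (z : ℂ) : ℝ :=
  (2 * radialWeight W R R₀ pts j ‖z - pts j‖
    - radialWeight W R R₀ pts i ‖z - pts i‖ * radialWeight W R R₀ pts j ‖z - pts j‖ * W z)
    * angleKernel (pts i) (pts j) z

variable {m : ℕ} {W : ℂ → ℝ} {a R R₀ : ℝ} {pts : Fin m → ℂ}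

theorem IsWeight.measurable_radialWeight (hW : IsWeight W a R) (R₀ : ℝ) (pts : Fin m → ℂ)
    (j : Fin m) : Measurable (radialWeight W R R₀ pts j) :=
  (measurable_circleAverage hW.measurable _).inv.indicator (measurableSet_goodRadii R R₀ pts j)

theorem radialWeight_of_mem {j : Fin m} {r : ℝ} (hr : r ∈ goodRadii R R₀ pts j) :
    radialWeight W R R₀ pts j r = 1 - deficit W (pts j) r := by
  rw [radialWeight, indicator_of_mem hr, deficit, sub_sub_cancel]

theorem radialWeight_of_notMem {j : Fin m} {r : ℝ} (hr : r ∉ goodRadii R R₀ pts j) :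
    radialWeight W R R₀ pts j r = 0 := indicator_of_notMem hr _

theorem IsWeight.radialWeight_mem (hW : IsWeight W a R) (ha : 0 < a) (j : Fin m) (r : ℝ) :
    radialWeight W R R₀ pts j r ∈ Icc (0 : ℝ) 1 := by
  by_cases hr : r ∈ goodRadii R R₀ pts j
  · rw [radialWeight_of_mem hr]
    have := hW.deficit_mem' ha (pts j) r
    constructor <;> linarith [this.1, this.2]
  · rw [radialWeight_of_notMem hr]; simp

theorem IsWeight.measurable_interaction (hW : IsWeight W a R) (R₀ : ℝ) (pts : Fin m → ℂ)
    (i j : Fin m) : Measurable (interaction W R R₀ pts i j) := by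
  have h : ∀ k, Measurable fun z : ℂ => radialWeight W R R₀ pts k ‖z - pts k‖ := fun k =>
    (hW.measurable_radialWeight R₀ pts k).comp (by fun_prop)
  exact (((h j).const_mul 2).sub (((h i).mul (h j)).mul hW.measurable)).mul
    (measurable_angleKernel _ _)

theorem interaction_of_notMem {i j : Fin m} {z : ℂ} (hz : z ∉ goodSet R R₀ pts j) :
    interaction W R R₀ pts i j z = 0 := by
  rw [interaction, radialWeight_of_notMem (show ‖z - pts j‖ ∉ goodRadii R R₀ pts j from hz)]
  ring

theorem inv_norm_mul_le_of_mem_goodSet {i j : Fin m} {z : ℂ} (hR₀ : 0 < R₀)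
    (hz : z ∈ goodSet R R₀ pts j) : ‖z - pts i‖⁻¹ * ‖z - pts j‖⁻¹ ≤ (4 * R₀ ^ 2)⁻¹ := by
  have h2 := le_norm_sub_of_mem_goodSet hz i
  have h3 := le_norm_sub_of_mem_goodSet hz j
  calc _ ≤ (2 * R₀)⁻¹ * (2 * R₀)⁻¹ := by gcongr
    _ = _ := by rw [← mul_inv]; ring_nf

/-- The coefficient `βⱼ` confines the density to the good set of `aⱼ`, where both distances are at
least `2R₀` and the kernel is not singular. -/
theorem IsWeight.integrable_interaction (hW : IsWeight W a R) (ha : 0 < a) (hR₀ : 0 < R₀)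
    (pts : Fin m → ℂ) (i j : Fin m) : Integrable (interaction W R R₀ pts i j) := by
  have ha3 : 0 < (a ^ 2)⁻¹ := by positivity
  refine integrable_of_bounded_of_support (hW.measurable_interaction R₀ pts i j)
    (M := (2 + (a ^ 2)⁻¹) * (4 * R₀ ^ 2)⁻¹) (ρ := R / 4) (c := pts j) (fun z => ?_) fun z hz => ?_
  · by_cases hz : z ∈ goodSet R R₀ pts j
    · rw [interaction, abs_mul]
      refine mul_le_mul ?_ ((abs_angleKernel_le _ _ _).trans (inv_norm_mul_le_of_mem_goodSet hR₀ hz))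
        (abs_nonneg _) (by positivity)
      have h1 := hW.radialWeight_mem (R₀ := R₀) (pts := pts) ha j ‖z - pts j‖
      have h2 := hW.radialWeight_mem (R₀ := R₀) (pts := pts) ha i ‖z - pts i‖
      have h3 : radialWeight W R R₀ pts i ‖z - pts i‖ * radialWeight W R R₀ pts j ‖z - pts j‖ ≤ 1 :=
        mul_le_one₀ h2.2 h1.1 h1.2
      have h3' := mul_nonneg h2.1 h1.1
      have h4 : radialWeight W R R₀ pts i ‖z - pts i‖ * radialWeight W R R₀ pts j ‖z - pts j‖ * W z
          ≤ 1 * (a ^ 2)⁻¹ := mul_le_mul h3 (hW.le z) (by linarith [hW.one_le z]) zero_le_one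
      have h5 := mul_nonneg h3' (by linarith [hW.one_le z] : 0 ≤ W z)
      rw [abs_le]
      constructor <;> linarith [h1.1, h1.2]
    · rw [interaction_of_notMem hz, abs_zero]; positivity
  · exact interaction_of_notMem fun h => absurd (norm_sub_le_of_mem_goodSet h) (not_le.2 hz)

/-- Self-interaction. -/
theorem IsWeight.integral_interaction_self (hW : IsWeight W a R) (ha : 0 < a) (hR₀ : 0 < R₀)
    (j : Fin m) : ∫ z, interaction W R R₀ pts j j z
      = 2 * Real.pi * ∫ r in goodRadii R R₀ pts j, (1 - deficit W (pts j) r) / r := by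
  have hpt : ∀ z, interaction W R R₀ pts j j z = (fun z =>
      2 * radialWeight W R R₀ pts j ‖z - pts j‖ * (‖z - pts j‖ ^ 2)⁻¹
      - radialWeight W R R₀ pts j ‖z - pts j‖ ^ 2 * (‖z - pts j‖ ^ 2)⁻¹ * W z) z := fun z => by
    rw [interaction, angleKernel_self]; ring
  rw [integral_eq_integral_circleAverage (hW.integrable_interaction ha hR₀ pts j j)
    (hW.measurable_interaction R₀ pts j j) (pts j), ← integral_const_mul,
    ← integral_indicator (measurableSet_goodRadii R R₀ pts j),
    ← integral_indicator measurableSet_Ioi]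
  congr 1
  ext r
  by_cases hr : r ∈ goodRadii R R₀ pts j
  · have hr0 : 0 < r := by linarith [hr.1]
    rw [indicator_of_mem hr, indicator_of_mem (mem_Ioi.2 hr0), funext hpt]
    have hA := hW.one_le_circleAverage (pts j) r
    set b := radialWeight W R R₀ pts j r with hb
    have hcirc : ∀ z ∈ Metric.sphere (pts j) |r|,
        2 * radialWeight W R R₀ pts j ‖z - pts j‖ * (‖z - pts j‖ ^ 2)⁻¹
        - radialWeight W R R₀ pts j ‖z - pts j‖ ^ 2 * (‖z - pts j‖ ^ 2)⁻¹ * W z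
        = 2 * b * (r ^ 2)⁻¹ - b ^ 2 * (r ^ 2)⁻¹ * W z := by
      intro z hz
      rw [Metric.mem_sphere, dist_eq_norm, abs_of_pos hr0] at hz
      rw [hz]
    have hWc : CircleIntegrable (fun z => b ^ 2 * (r ^ 2)⁻¹ * W z) (pts j) r :=
      (hW.circleIntegrable (pts j) r).const_smul (a := b ^ 2 * (r ^ 2)⁻¹)
    rw [Real.circleAverage_congr_sphere hcirc, Real.circleAverage_fun_sub
      (circleIntegrable_const _ _ _) hWc, Real.circleAverage_const, circleAverage_const_mul]
    -- This `b` maximizes `2b - b² W̄`, and the maximum is `b` itself.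
    have hbA : b = (Real.circleAverage W (pts j) r)⁻¹ := by
      rw [hb, radialWeight, indicator_of_mem hr]
    rw [deficit, sub_sub_cancel, hbA]
    have : Real.circleAverage W (pts j) r ≠ 0 := by linarith
    field_simp
    ring
  · rw [indicator_of_notMem hr]
    by_cases hr0 : 0 < r
    · rw [indicator_of_mem (mem_Ioi.2 hr0), funext hpt]
      have hcirc : ∀ z ∈ Metric.sphere (pts j) |r|,
          2 * radialWeight W R R₀ pts j ‖z - pts j‖ * (‖z - pts j‖ ^ 2)⁻¹
          - radialWeight W R R₀ pts j ‖z - pts j‖ ^ 2 * (‖z - pts j‖ ^ 2)⁻¹ * W z = 0 := by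
        intro z hz
        rw [Metric.mem_sphere, dist_eq_norm, abs_of_pos hr0] at hz
        rw [hz, radialWeight_of_notMem hr]
        ring
      rw [Real.circleAverage_const_on_circle hcirc, mul_zero]
    · rw [indicator_of_notMem (by simpa using hr0)]

/-- In `∫ (1 - h)/r` over good radii beyond `2R₀`, the term `1/r` gives the logarithm up to `log 8 +
m log 3` (`log 4` for the cut at `R/4`, `log 2` for starting at `2R₀`). The term `h/r`, enlarged to
all of `[R₀, R]`, is bounded by the profile problem with budget `lam² R₀²`. -/
theorem IsWeight.le_integral_interaction_self {J : ℝ → ℝ} (hW : IsWeight W a R)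
    (hJ : IsPotential J) (ha : 0 < a)
    (hR₀ : 0 < R₀) (hR : 4 * R₀ ≤ R) (j : Fin m)
    (hsep : ∀ k, k ≠ j → 4 * R₀ ≤ ‖pts k - pts j‖) (hpts : ‖pts j‖ ≤ R) {lam : ℝ} (hlam : 1 ≤ lam)
    (hb : ∫ z, J (deficit W (pts j) ‖z - pts j‖) ≤ 2 * Real.pi * (lam ^ 2 * R₀ ^ 2)) :
    2 * Real.pi * (Real.log (R / R₀) - profileI J (R / R₀)
      - (Real.log 8 + m * Real.log 3 + Real.log lam)) ≤ ∫ z, interaction W R R₀ pts j j z := by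
  obtain ⟨h1, h2⟩ := hW.integrable_deficit_radial hJ ha hpts
  have hRp : 0 < R := by linarith
  have hpi := Real.two_pi_pos
  rw [h2] at hb
  have hprof := integral_div_le_profileI (R := R) hJ (hW.measurable_deficit (pts j))
    (hW.deficit_mem' ha (pts j)) hR₀ (by linarith) hlam h1 (le_of_mul_le_mul_left hb hpi)
  have hlow := le_integral_goodRadii (R := R) (A := 2 * R₀) j hR₀ hsep le_rfl (by linarith)
  have hdm := hW.measurable_deficit (pts j)
  have hi : ∀ x y : ℝ, 0 < x →
      IntegrableOn (fun r => deficit W (pts j) r / r) (Ioc x y) := by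
    intro x y hx
    refine (integrableOn_one_div_Ioc hx).mono' (hdm.div measurable_id).aestronglyMeasurable ?_
    refine (ae_restrict_iff' measurableSet_Ioc).2 (Filter.Eventually.of_forall fun r hr => ?_)
    have hr0 : 0 < r := hx.trans hr.1
    have := hW.deficit_mem' ha (pts j) r
    rw [Real.norm_eq_abs, abs_of_nonneg (div_nonneg this.1 hr0.le)]
    exact div_le_div_of_nonneg_right this.2 hr0.le
  have hS := goodRadii_inter_subset (R₀ := R₀) pts j hRp (2 * R₀)
  have hsub : goodRadii R R₀ pts j ∩ Ioi (2 * R₀) ⊆ Ioc R₀ R := fun r hr =>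
    ⟨by linarith [(hS hr).1], (hS hr).2⟩
  have hsub' : goodRadii R R₀ pts j ⊆ Ioc R₀ R := fun r hr =>
    ⟨by linarith [hr.1], by linarith [hr.2.1]⟩
  have h3 : ∫ r in goodRadii R R₀ pts j ∩ Ioi (2 * R₀), deficit W (pts j) r / r
      ≤ ∫ r in R₀..R, deficit W (pts j) r / r := by
    rw [intervalIntegral.integral_of_le (by linarith)]
    refine setIntegral_mono_set (hi _ _ hR₀) ?_ (LE.le.eventuallyLE hsub)
    refine (ae_restrict_iff' measurableSet_Ioc).2 (Filter.Eventually.of_forall fun r hr => ?_)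
    exact div_nonneg (hW.deficit_mem (pts j) r).1 (hR₀.le.trans hr.1.le)
  have h4 : ∫ r in goodRadii R R₀ pts j ∩ Ioi (2 * R₀), (1 - deficit W (pts j) r) / r
      ≤ ∫ r in goodRadii R R₀ pts j, (1 - deficit W (pts j) r) / r := by
    have e : (fun r => (1 - deficit W (pts j) r) / r)
        = fun r => 1 / r - deficit W (pts j) r / r := by ext r; ring
    refine setIntegral_mono_set ?_ ?_ (LE.le.eventuallyLE inter_subset_left)
    · rw [e]
      exact ((integrableOn_one_div_Ioc hR₀).sub (hi _ _ hR₀)).mono_set hsub'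
    · refine (ae_restrict_iff' (measurableSet_goodRadii R R₀ pts j)).2
        (Filter.Eventually.of_forall fun r hr => ?_)
      have := hW.deficit_mem' ha (pts j) r
      exact div_nonneg (by linarith [this.2]) (hR₀.le.trans (hsub' hr).1.le)
  have h5 : ∫ r in goodRadii R R₀ pts j ∩ Ioi (2 * R₀), (1 - deficit W (pts j) r) / r
      = (∫ r in goodRadii R R₀ pts j ∩ Ioi (2 * R₀), 1 / r)
        - ∫ r in goodRadii R R₀ pts j ∩ Ioi (2 * R₀), deficit W (pts j) r / r := by
    rw [← integral_sub ((integrableOn_one_div_Ioc hR₀).mono_set hsub)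
      ((hi _ _ hR₀).mono_set hsub)]
    congr 1
    ext r
    ring
  have h6 : Real.log (R / (2 * R₀)) - Real.log 4 = Real.log (R / R₀) - Real.log 8 := by
    rw [← Real.log_div (by positivity) (by norm_num), ← Real.log_div (by positivity) (by norm_num)]
    congr 1
    field_simp
    norm_num
  rw [hW.integral_interaction_self ha hR₀ j]
  refine mul_le_mul_of_nonneg_left ?_ hpi.le
  linarith

/-- Up to a bounded error and a multiple of `1 - a²`, the weights do not change the interaction. -/
theorem IsWeight.abs_integral_interaction_sub_le {J : ℝ → ℝ} (hW : IsWeight W a R)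
    (hJ : IsPotential J) (ha : 0 < a) (ha1 : a ≤ 1) (hR₀ : 0 < R₀) (hR : 0 < R) {i j : Fin m}
    (hij : i ≠ j) (hsep : ∀ k, k ≠ i → 4 * R₀ ≤ ‖pts k - pts i‖) (hLR : ‖pts i - pts j‖ ≤ R)
    (hpts : ∀ k, ‖pts k‖ ≤ R) {C P : ℝ} (hC : 0 ≤ C)
    (hCerr : ∀ t ∈ Icc 0 (1 - a ^ 2), ∀ h ∈ Icc 0 (1 - a ^ 2), ∀ k ∈ Icc 0 (1 - a ^ 2),
      |2 * (1 - k) - (1 - h) * (1 - k) * (1 - t)⁻¹ - 1|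
        ≤ (1 - a ^ 2) / 2 + C * (J t + J h + J k))
    (hP : ∫ z, J (1 - (W z)⁻¹) ≤ P * R₀ ^ 2)
    (hPd : ∀ k, ∫ z, J (deficit W (pts k) ‖z - pts k‖) ≤ P * R₀ ^ 2) :
    |(∫ z, interaction W R R₀ pts i j z)
      - ∫ z in goodSet R R₀ pts j, angleKernel (pts i) (pts j) z|
      ≤ 2 * Real.pi * (1 - a ^ 2) * Real.log (R / ‖pts i - pts j‖)
        + (12 * Real.pi + m * (12 * Real.pi) + C * P) := by
  have hpi := Real.pi_pos
  have hab : pts i ≠ pts j := by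
    intro h
    have := hsep j hij.symm
    rw [h, sub_self, norm_zero] at this
    linarith
  have h1a : 0 ≤ 1 - a ^ 2 := by nlinarith
  have ha2 : 0 < a ^ 2 := by positivity
  set gj := goodSet R R₀ pts j with hgj
  set gi := goodSet R R₀ pts i with hgi
  have hjm : MeasurableSet gj := measurableSet_goodSet R R₀ pts j
  have him : MeasurableSet gi := measurableSet_goodSet R R₀ pts i
  let K : ℂ → ℝ := fun z => ‖z - pts i‖⁻¹ * ‖z - pts j‖⁻¹
  have hK0 : ∀ z, 0 ≤ K z := fun z => by positivity
  have hKj : IntegrableOn K gj :=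
    (integrableOn_kernel hab hLR).mono_set (goodSet_subset_closedBall hR.le pts j)
  have hki : IntegrableOn (angleKernel (pts i) (pts j)) gj := by
    refine hKj.mono' (measurable_angleKernel _ _).aestronglyMeasurable ?_
    exact Filter.Eventually.of_forall fun z => abs_angleKernel_le _ _ _
  -- Three error terms. `A` covers the points where `βᵢ` is switched off, and `B` the `(1 - a²)/2`
  -- part of the weight error; half of the kernel bound `12π + 4π log` gives its `2π (1 - a²) log`.
  -- `E` is the potential part, with the kernel bounded by `1/(4R₀²)`.
  let A : ℂ → ℝ := (gj \ gi).indicator K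
  let B : ℂ → ℝ := fun z => (1 - a ^ 2) / 2 * gj.indicator K z
  let E : ℂ → ℝ := fun z => C * (4 * R₀ ^ 2)⁻¹ * (J (1 - (W z)⁻¹)
    + J (deficit W (pts i) ‖z - pts i‖) + J (deficit W (pts j) ‖z - pts j‖))
  have hAi : Integrable A :=
    (integrable_indicator_iff (hjm.diff him)).2 (hKj.mono_set sdiff_subset)
  have hBi : Integrable B := ((integrable_indicator_iff hjm).2 hKj).const_mul _
  have hE1 := hW.integrable_potential hJ ha
  have hE2 := fun k => hW.integrable_deficit hJ ha (hpts k)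
  have hEi : Integrable E := ((hE1.add (hE2 i)).add (hE2 j)).const_mul _
  have hA0 : ∀ z, 0 ≤ A z := fun z => indicator_nonneg (fun z _ => hK0 z) z
  have hB0 : ∀ z, 0 ≤ B z := fun z =>
    mul_nonneg (by linarith) (indicator_nonneg (fun z _ => hK0 z) z)
  have hE0 : ∀ z, 0 ≤ E z := fun z => by
    have h1 := hJ.nonneg (1 - (W z)⁻¹)
    have h2 := hJ.nonneg (deficit W (pts i) ‖z - pts i‖)
    have h3 := hJ.nonneg (deficit W (pts j) ‖z - pts j‖)
    simp only [E]
    positivity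
  have hpt : ∀ z, |interaction W R R₀ pts i j z
      - gj.indicator (angleKernel (pts i) (pts j)) z| ≤ A z + B z + E z := by
    intro z
    by_cases hzj : z ∈ gj
    · have hkz : |angleKernel (pts i) (pts j) z| ≤ K z := abs_angleKernel_le _ _ _
      have hzj' : ‖z - pts j‖ ∈ goodRadii R R₀ pts j := hzj
      rw [indicator_of_mem hzj]
      by_cases hzi : z ∈ gi
      · have hzi' : ‖z - pts i‖ ∈ goodRadii R R₀ pts i := hzi
        have hBz : B z = (1 - a ^ 2) / 2 * K z := by simp only [B, indicator_of_mem hzj]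
        have herr := hCerr _ (hW.one_sub_inv_mem z) _ (hW.deficit_mem (pts i) ‖z - pts i‖) _
          (hW.deficit_mem (pts j) ‖z - pts j‖)
        rw [sub_sub_cancel, inv_inv] at herr
        have e : interaction W R R₀ pts i j z - angleKernel (pts i) (pts j) z
            = (2 * (1 - deficit W (pts j) ‖z - pts j‖) - (1 - deficit W (pts i) ‖z - pts i‖)
              * (1 - deficit W (pts j) ‖z - pts j‖) * W z - 1) * angleKernel (pts i) (pts j) z := by
          rw [interaction, radialWeight_of_mem hzj', radialWeight_of_mem hzi']
          ring
        rw [e, abs_mul]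
        have hKle : K z ≤ (4 * R₀ ^ 2)⁻¹ := inv_norm_mul_le_of_mem_goodSet hR₀ hzj
        have hs : 0 ≤ J (1 - (W z)⁻¹) + J (deficit W (pts i) ‖z - pts i‖)
            + J (deficit W (pts j) ‖z - pts j‖) :=
          add_nonneg (add_nonneg (hJ.nonneg _) (hJ.nonneg _)) (hJ.nonneg _)
        have h1 := mul_le_mul herr hkz (abs_nonneg _)
          (add_nonneg (by linarith) (mul_nonneg hC hs))
        have h2 : C * (J (1 - (W z)⁻¹) + J (deficit W (pts i) ‖z - pts i‖)
            + J (deficit W (pts j) ‖z - pts j‖)) * K z ≤ E z := by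
          calc _ ≤ C * (J (1 - (W z)⁻¹) + J (deficit W (pts i) ‖z - pts i‖)
              + J (deficit W (pts j) ‖z - pts j‖)) * (4 * R₀ ^ 2)⁻¹ :=
                mul_le_mul_of_nonneg_left hKle (mul_nonneg hC hs)
            _ = E z := by simp only [E]; ring
        rw [hBz]
        refine h1.trans ?_
        rw [add_mul]
        linarith [hA0 z]
      · have hzi' : ‖z - pts i‖ ∉ goodRadii R R₀ pts i := hzi
        have hAz : A z = K z := indicator_of_mem (show z ∈ gj \ gi from ⟨hzj, hzi⟩) _
        have e : interaction W R R₀ pts i j z - angleKernel (pts i) (pts j) z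
            = (2 * radialWeight W R R₀ pts j ‖z - pts j‖ - 1) * angleKernel (pts i) (pts j) z := by
          rw [interaction, radialWeight_of_notMem hzi']
          ring
        have hr := hW.radialWeight_mem (R₀ := R₀) (pts := pts) ha j ‖z - pts j‖
        have h1 : |2 * radialWeight W R R₀ pts j ‖z - pts j‖ - 1| ≤ 1 := by
          rw [abs_le]; constructor <;> linarith [hr.1, hr.2]
        rw [e, abs_mul, hAz]
        have := mul_le_mul h1 hkz (abs_nonneg _) zero_le_one
        linarith [hB0 z, hE0 z]
    · rw [interaction_of_notMem hzj, indicator_of_notMem hzj, sub_zero, abs_zero]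
      linarith [hA0 z, hB0 z, hE0 z]
  have hIi := hW.integrable_interaction ha hR₀ pts i j
  have hkind := (integrable_indicator_iff hjm).2 hki
  rw [← integral_indicator hjm, ← integral_sub hIi hkind]
  have hAint : ∫ z, A z ≤ 6 * Real.pi + m * (12 * Real.pi) := by
    rw [integral_indicator (hjm.diff him)]
    exact integral_kernel_goodSet_diff_le hR₀ hR hsep hij hLR
  have hBint : ∫ z, B z ≤ 6 * Real.pi
      + 2 * Real.pi * (1 - a ^ 2) * Real.log (R / ‖pts i - pts j‖) := by
    have h1 : ∫ z in gj, K z ≤ ∫ z in Metric.closedBall (pts j) R, K z :=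
      setIntegral_mono_set (integrableOn_kernel hab hLR)
        (Filter.Eventually.of_forall hK0)
        (LE.le.eventuallyLE (goodSet_subset_closedBall hR.le pts j))
    have h2 := h1.trans (integral_kernel_le hab hLR)
    simp only [B]
    rw [integral_const_mul, integral_indicator hjm]
    have h3 := mul_le_mul_of_nonneg_left h2 (by linarith : 0 ≤ (1 - a ^ 2) / 2)
    refine h3.trans ?_
    nlinarith [mul_nonneg hpi.le ha2.le]
  have hEint : ∫ z, E z ≤ C * P := by
    have e : ∫ z, E z = C * (4 * R₀ ^ 2)⁻¹ * ((∫ z, J (1 - (W z)⁻¹))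
        + (∫ z, J (deficit W (pts i) ‖z - pts i‖))
        + ∫ z, J (deficit W (pts j) ‖z - pts j‖)) := by
      simp only [E]
      have h12 : Integrable fun z => J (1 - (W z)⁻¹) + J (deficit W (pts i) ‖z - pts i‖) :=
        hE1.add (hE2 i)
      rw [integral_const_mul, integral_add h12 (hE2 j), integral_add hE1 (hE2 i)]
    rw [e]
    have hP0 : 0 ≤ P * R₀ ^ 2 := (integral_nonneg fun z => hJ.nonneg _).trans hP
    calc _ ≤ C * (4 * R₀ ^ 2)⁻¹ * (P * R₀ ^ 2 + P * R₀ ^ 2 + P * R₀ ^ 2 + P * R₀ ^ 2) := by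
          refine mul_le_mul_of_nonneg_left ?_ (by positivity)
          linarith [hPd i, hPd j]
      _ = C * P := by field_simp; ring
  calc _ ≤ ∫ z, |interaction W R R₀ pts i j z
        - gj.indicator (angleKernel (pts i) (pts j)) z| := abs_integral_le_integral_abs
    _ ≤ ∫ z, (A z + B z + E z) :=
        integral_mono (hIi.sub hkind).abs ((hAi.add hBi).add hEi) hpt
    _ = (∫ z, A z) + (∫ z, B z) + ∫ z, E z := by
        have h12 : Integrable fun z => A z + B z := hAi.add hBi
        rw [integral_add h12 hEi, integral_add hAi hBi]
    _ ≤ _ := by linarith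

/-- Lower bound for the interaction of two holes of degrees `p` and `q`. -/
theorem IsWeight.le_mul_integral_interaction {J : ℝ → ℝ} (hW : IsWeight W a R)
    (hJ : IsPotential J) (ha : 0 < a) (ha1 : a ≤ 1) (hR₀ : 0 < R₀) (hR : 0 < R) {i j : Fin m}
    (hij : i ≠ j) (hsep : ∀ k l, k ≠ l → 4 * R₀ ≤ ‖pts k - pts l‖)
    (hLR : ‖pts i - pts j‖ ≤ R) (hpts : ∀ k, ‖pts k‖ ≤ R) {C P : ℝ} (hC : 0 ≤ C)
    (hCerr : ∀ t ∈ Icc 0 (1 - a ^ 2), ∀ h ∈ Icc 0 (1 - a ^ 2), ∀ k ∈ Icc 0 (1 - a ^ 2),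
      |2 * (1 - k) - (1 - h) * (1 - k) * (1 - t)⁻¹ - 1|
        ≤ (1 - a ^ 2) / 2 + C * (J t + J h + J k))
    (hP : ∫ z, J (1 - (W z)⁻¹) ≤ P * R₀ ^ 2)
    (hPd : ∀ k, ∫ z, J (deficit W (pts k) ‖z - pts k‖) ≤ P * R₀ ^ 2) (x : ℝ) :
    2 * Real.pi * ((x - (1 - a ^ 2) * |x|) * Real.log (R / ‖pts i - pts j‖))
      - |x| * (12 * Real.pi + m * (12 * Real.pi) + C * P
        + 2 * Real.pi * (Real.log 4 + m * Real.log 3))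
      ≤ x * ∫ z, interaction W R R₀ pts i j z := by
  have h1 := hW.abs_integral_interaction_sub_le hJ ha ha1 hR₀ hR hij (fun k hk => hsep k i hk) hLR
    hpts hC hCerr hP hPd
  have hL := hsep i j hij
  have hup := integral_goodRadii_le (R₀ := R₀) pts j (by linarith : 0 < ‖pts i - pts j‖) hLR
  have hlow := le_integral_goodRadii j hR₀ (fun k hk => hsep k j hk)
    (by linarith : 2 * R₀ ≤ ‖pts i - pts j‖) hLR
  rw [integral_angleKernel_goodSet hR₀ hij] at h1
  set S := ∫ r in goodRadii R R₀ pts j ∩ Ioi ‖pts i - pts j‖, 1 / r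
  set T := ∫ z, interaction W R R₀ pts i j z
  set ℓ := Real.log (R / ‖pts i - pts j‖)
  have hpi := Real.two_pi_pos
  have h2 : |S - ℓ| ≤ Real.log 4 + m * Real.log 3 := by
    have : 0 ≤ Real.log 4 := Real.log_nonneg (by norm_num)
    have : 0 ≤ m * Real.log 3 := mul_nonneg (Nat.cast_nonneg m) (Real.log_nonneg (by norm_num))
    rw [abs_le]
    constructor <;> linarith
  have h3 : |T - 2 * Real.pi * ℓ| ≤ 2 * Real.pi * (1 - a ^ 2) * ℓ
      + (12 * Real.pi + m * (12 * Real.pi) + C * P)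
      + 2 * Real.pi * (Real.log 4 + m * Real.log 3) := by
    have e : T - 2 * Real.pi * ℓ = (T - 2 * Real.pi * S) + 2 * Real.pi * (S - ℓ) := by ring
    rw [e]
    refine (abs_add_le _ _).trans (add_le_add h1 ?_)
    rw [abs_mul, abs_of_pos hpi]
    exact mul_le_mul_of_nonneg_left h2 hpi.le
  have h4 : |x * (T - 2 * Real.pi * ℓ)| ≤ |x| * (2 * Real.pi * (1 - a ^ 2) * ℓ
      + (12 * Real.pi + m * (12 * Real.pi) + C * P)
      + 2 * Real.pi * (Real.log 4 + m * Real.log 3)) := by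
    rw [abs_mul]
    exact mul_le_mul_of_nonneg_left h3 (abs_nonneg x)
  have h5 := (abs_le.1 h4).1
  linarith

/-! ### The test field -/

theorem isOpen_perforatedDisc {m : ℕ} (R R₀ : ℝ) (pts : Fin m → ℂ) :
    IsOpen (perforatedDisc R R₀ pts) :=
  Metric.isOpen_ball.sdiff (isClosed_iUnion_of_finite fun _ => Metric.isClosed_closedBall)

theorem mem_perforatedDisc {m : ℕ} {R R₀ : ℝ} {pts : Fin m → ℂ} {z : ℂ} :
    z ∈ perforatedDisc R R₀ pts ↔ ‖z‖ < R ∧ ∀ j, R₀ < ‖z - pts j‖ := by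
  simp [perforatedDisc, dist_eq_norm]

/-- Young's inequality for the derivative in the direction of a test vector. -/
theorem two_mul_im_sub_le (A : ℂ →L[ℝ] ℂ) {w : ℂ} (hw : w ≠ 0) (X : ℂ) :
    2 * (A X / w).im - ‖X‖ ^ 2 * (‖w‖ ^ 2)⁻¹ ≤ ‖A 1‖ ^ 2 + ‖A Complex.I‖ ^ 2 := by
  have hwp : 0 < ‖w‖ := norm_pos_iff.2 hw
  have h1 : A X = X.re • A 1 + X.im • A Complex.I := by
    rw [← map_smul, ← map_smul, ← map_add]
    congr 1
    simp
  have h2 : ‖A X‖ ≤ |X.re| * ‖A 1‖ + |X.im| * ‖A Complex.I‖ := by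
    rw [h1]
    refine (norm_add_le _ _).trans ?_
    rw [norm_smul, norm_smul, Real.norm_eq_abs, Real.norm_eq_abs]
  have h3 : (A X / w).im ≤ (|X.re| * ‖A 1‖ + |X.im| * ‖A Complex.I‖) * ‖w‖⁻¹ := by
    refine (Complex.im_le_norm _).trans ?_
    rw [norm_div, div_eq_mul_inv]
    gcongr
  have h4 : ‖X‖ ^ 2 * (‖w‖ ^ 2)⁻¹ = (|X.re| * ‖w‖⁻¹) ^ 2 + (|X.im| * ‖w‖⁻¹) ^ 2 := by
    rw [← Complex.normSq_eq_norm_sq, Complex.normSq_apply, mul_pow, mul_pow, sq_abs, sq_abs]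
    ring
  rw [h4]
  nlinarith [sq_nonneg (|X.re| * ‖w‖⁻¹ - ‖A 1‖), sq_nonneg (|X.im| * ‖w‖⁻¹ - ‖A Complex.I‖)]

theorem norm_sum_smul_gradAngle_sq {m : ℕ} (c : Fin m → ℝ) (pts : Fin m → ℂ) (z : ℂ) :
    ‖∑ j, c j • gradAngle (pts j) z‖ ^ 2
      = ∑ j, ∑ i, c i * c j * angleKernel (pts i) (pts j) z := by
  have h : ‖∑ j, c j • gradAngle (pts j) z‖ ^ 2 = ((starRingEnd ℂ)
      (∑ j, c j • gradAngle (pts j) z) * ∑ j, c j • gradAngle (pts j) z).re := by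
    rw [mul_comm, Complex.mul_conj, Complex.ofReal_re, Complex.normSq_eq_norm_sq]
  rw [h, map_sum, Finset.sum_mul_sum, Finset.sum_comm, Complex.re_sum]
  refine Finset.sum_congr rfl fun j _ => ?_
  rw [Complex.re_sum]
  refine Finset.sum_congr rfl fun i _ => ?_
  rw [← re_conj_gradAngle_mul, Complex.real_smul, Complex.real_smul, map_mul, Complex.conj_ofReal,
    mul_mul_mul_comm, ← Complex.ofReal_mul, Complex.re_ofReal_mul]

/-- The weight `1/|u|²`, extended by `1` off `Ω`. -/
def invSqWeight {m : ℕ} (R R₀ : ℝ) (pts : Fin m → ℂ) (u : ℂ → ℂ) : ℂ → ℝ :=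
  open Classical in (perforatedDisc R R₀ pts).piecewise (fun z => (‖u z‖ ^ 2)⁻¹) fun _ => 1

/-- The defect between the current of `u` around `aⱼ` and that of the canonical field. -/
def currentDefect {m : ℕ} (R R₀ : ℝ) (pts : Fin m → ℂ) (deg : Fin m → ℤ) (u : ℂ → ℂ) (j : Fin m)
    (z : ℂ) : ℝ :=
  (fderiv ℝ u z (gradAngle (pts j) z) / (perforatedDisc R R₀ pts).indicator u z).im
    - ∑ i, (deg i : ℝ) * angleKernel (pts i) (pts j) z

/-- The lower bound for `|∇u|²` given by the test field. -/
def energyMinorant {m : ℕ} (R R₀ : ℝ) (pts : Fin m → ℂ) (deg : Fin m → ℤ) (u : ℂ → ℂ) (z : ℂ) :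
    ℝ :=
  ∑ j, ∑ i, (deg i : ℝ) * deg j * interaction (invSqWeight R R₀ pts u) R R₀ pts i j z
    + 2 * ∑ j, (deg j : ℝ) * (radialWeight (invSqWeight R R₀ pts u) R R₀ pts j ‖z - pts j‖
      * currentDefect R R₀ pts deg u j z)

/-! ### The weight and the energy minorant of a configuration -/

namespace IsConfiguration

variable {J : ℝ → ℝ} {a K R R₀ : ℝ} {m : ℕ} {pts : Fin m → ℂ} {deg : Fin m → ℤ} {u : ℂ → ℂ}

theorem radius_pos' (h : IsConfiguration J a K R R₀ pts deg u) : 0 < R := by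
  linarith [h.radius_pos, h.radius_le]

theorem goodSet_subset (h : IsConfiguration J a K R R₀ pts deg u) (j : Fin m) :
    goodSet R R₀ pts j ⊆ perforatedDisc R R₀ pts := by
  intro z hz
  have hR := h.radius_pos'
  have hR₀ := h.radius_pos
  rw [mem_perforatedDisc]
  refine ⟨?_, fun i => by linarith [le_norm_sub_of_mem_goodSet hz i]⟩
  have h1 : ‖z‖ ≤ ‖z - pts j‖ + ‖pts j‖ := by simpa using norm_add_le (z - pts j) (pts j)
  linarith [norm_sub_le_of_mem_goodSet hz, h.norm_le j]

/-- A point on the boundary of a hole is approached by pushing it radially outward; separation keeps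
it off the other holes, and `7/8 * R` leaves room inside the disc. -/
theorem mem_closure (h : IsConfiguration J a K R R₀ pts deg u) {z : ℂ} (hz : ‖z‖ ≤ 7 / 8 * R)
    (hzp : ∀ j, R₀ ≤ ‖z - pts j‖) : z ∈ closure (perforatedDisc R R₀ pts) := by
  have hR := h.radius_pos'
  have hR₀ := h.radius_pos
  have hle := h.radius_le
  by_cases hall : ∀ j, R₀ < ‖z - pts j‖
  · exact subset_closure (mem_perforatedDisc.2 ⟨by linarith, hall⟩)
  push Not at hall
  obtain ⟨i, hi⟩ := hall
  have hzi : ‖z - pts i‖ = R₀ := le_antisymm hi (hzp i)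
  rw [Metric.mem_closure_iff]
  intro ε hε
  set δ := min (ε / (2 * R₀)) (1 / 8) with hδ
  have hδp : 0 < δ := by positivity
  have hδ1 : δ ≤ 1 / 8 := min_le_right _ _
  have hδ2 : δ * R₀ ≤ ε / 2 := by
    calc δ * R₀ ≤ ε / (2 * R₀) * R₀ := by gcongr; exact min_le_left _ _
      _ = ε / 2 := by field_simp
  have hδR : δ * R₀ ≤ 1 / 8 * R₀ := by gcongr
  have hn : ‖δ • (z - pts i)‖ = δ * R₀ := by
    rw [norm_smul, Real.norm_eq_abs, abs_of_pos hδp, hzi]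
  refine ⟨z + δ • (z - pts i), mem_perforatedDisc.2 ⟨?_, fun k => ?_⟩, ?_⟩
  · have := norm_add_le z (δ • (z - pts i))
    linarith
  · have hi' : ‖z + δ • (z - pts i) - pts i‖ = (1 + δ) * R₀ := by
      have : z + δ • (z - pts i) - pts i = (1 + δ) • (z - pts i) := by
        rw [add_smul, one_smul]; ring
      rw [this, norm_smul, Real.norm_eq_abs, abs_of_pos (by linarith), hzi]
    by_cases hk : k = i
    · rw [hk, hi']; nlinarith
    · have h1 := h.separated k i hk
      have h2 : ‖pts k - pts i‖ ≤ ‖z + δ • (z - pts i) - pts k‖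
          + ‖z + δ • (z - pts i) - pts i‖ := by
        rw [norm_sub_rev (z + δ • (z - pts i)) (pts k)]
        simpa using norm_add_le (pts k - (z + δ • (z - pts i))) (z + δ • (z - pts i) - pts i)
      rw [hi'] at h2
      linarith
  · rw [dist_eq_norm, sub_add_cancel_left, norm_neg, hn]
    linarith

theorem le_norm_of_mem_closure (h : IsConfiguration J a K R R₀ pts deg u) {z : ℂ}
    (hz : z ∈ closure (perforatedDisc R R₀ pts)) : a ≤ ‖u z‖ := by
  have hcl : IsClosed {w : ℂ | a ≤ ‖w‖} := isClosed_le continuous_const continuous_norm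
  have := MapsTo.closure_of_continuousOn (t := {w : ℂ | a ≤ ‖w‖})
    (fun z hz => (h.bounds z hz).1) h.continuousOn hz
  rwa [hcl.closure_eq] at this

/-- A hole has a boundary point in the closure of `Ω`, so `Ω` is nonempty and both bounds on `‖u‖`
hold at a common point. -/
theorem le_one (h : IsConfiguration J a K R R₀ pts deg u) (j : Fin m) : a ≤ 1 := by
  have hR₀ := h.radius_pos
  have hmem : pts j + R₀ ∈ closure (perforatedDisc R R₀ pts) := by
    refine h.mem_closure ?_ fun k => ?_
    · have := norm_add_le (pts j) (R₀ : ℂ)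
      rw [Complex.norm_real, Real.norm_eq_abs, abs_of_pos hR₀] at this
      linarith [h.norm_le j, h.radius_le]
    · by_cases hk : k = j
      · rw [hk, add_sub_cancel_left, Complex.norm_real, Real.norm_eq_abs, abs_of_pos hR₀]
      · have h1 := h.separated j k (Ne.symm hk)
        have h2 : ‖pts j - pts k‖ ≤ ‖pts j + R₀ - pts k‖ + ‖(R₀ : ℂ)‖ := by
          have := norm_sub_le (pts j + R₀ - pts k) (R₀ : ℂ)
          rwa [show pts j + R₀ - pts k - R₀ = pts j - pts k by ring] at this
        rw [Complex.norm_real, Real.norm_eq_abs, abs_of_pos hR₀] at h2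
        linarith
  obtain ⟨z, hz⟩ := closure_nonempty_iff.1 ⟨_, hmem⟩
  exact (h.bounds z hz).1.trans (h.bounds z hz).2

theorem ne_zero (h : IsConfiguration J a K R R₀ pts deg u) (ha : 0 < a) {z : ℂ}
    (hz : z ∈ perforatedDisc R R₀ pts) : u z ≠ 0 :=
  norm_pos_iff.1 (ha.trans_le (h.bounds z hz).1)

/-- Holes and good circles lie within `3/4 * R` of the origin; the radius `7/8 * R` leaves a margin
on both sides. -/
theorem exists_log (h : IsConfiguration J a K R R₀ pts deg u) (ha : 0 < a) :
    ∃ Ψ : ℂ → ℂ, ContinuousOn Ψ (Metric.ball 0 (7 / 8 * R)) ∧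
      ∀ z ∈ Metric.ball 0 (7 / 8 * R) \ ⋃ j, Metric.ball (pts j) R₀,
        Complex.exp (Ψ z) = u z * ∏ i, (z - pts i) ^ (-deg i) := by
  have hR := h.radius_pos'
  have hR₀ := h.radius_pos
  have hsub : Metric.closedBall 0 (7 / 8 * R) \ ⋃ j, Metric.ball (pts j) R₀
      ⊆ closure (perforatedDisc R R₀ pts) := by
    rintro z ⟨hz, hzp⟩
    simp only [mem_iUnion, Metric.mem_ball, dist_eq_norm, not_exists, not_lt] at hzp
    exact h.mem_closure (by simpa using hz) hzp
  refine exists_continuousOn_log (by positivity) hR₀ (fun i j hij => ?_) (fun i => ?_)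
    (h.continuousOn.mono hsub) (fun z hz => ?_) h.degree
  · linarith [h.separated i j hij]
  · linarith [h.norm_le i, h.radius_le]
  · exact norm_pos_iff.1 (ha.trans_le (h.le_norm_of_mem_closure (hsub hz)))

theorem invSqWeight_of_mem {z : ℂ} (hz : z ∈ perforatedDisc R R₀ pts) :
    invSqWeight R R₀ pts u z = (‖u z‖ ^ 2)⁻¹ := by
  classical exact piecewise_eq_of_mem _ _ _ hz

theorem invSqWeight_of_notMem {z : ℂ} (hz : z ∉ perforatedDisc R R₀ pts) :
    invSqWeight R R₀ pts u z = 1 := by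
  classical exact piecewise_eq_of_notMem _ _ _ hz

theorem isWeight (h : IsConfiguration J a K R R₀ pts deg u) (ha : 0 < a) (ha1 : a ≤ 1) :
    IsWeight (invSqWeight R R₀ pts u) a R where
  measurable := by
    classical
    have hΩ := isOpen_perforatedDisc R R₀ pts
    refine ContinuousOn.measurable_piecewise ?_ continuousOn_const hΩ.measurableSet
    refine ((h.contDiffOn.continuousOn.norm).pow 2).inv₀ fun z hz => ?_
    exact pow_ne_zero 2 (norm_ne_zero_iff.2 (h.ne_zero ha hz))
  one_le z := by
    by_cases hz : z ∈ perforatedDisc R R₀ pts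
    · rw [invSqWeight_of_mem hz]
      have h1 := norm_pos_iff.2 (h.ne_zero ha hz)
      exact (one_le_inv₀ (by positivity)).2 (pow_le_one₀ h1.le (h.bounds z hz).2)
    · rw [invSqWeight_of_notMem hz]
  le z := by
    by_cases hz : z ∈ perforatedDisc R R₀ pts
    · rw [invSqWeight_of_mem hz]
      have := (h.bounds z hz).1
      gcongr
    · rw [invSqWeight_of_notMem hz]
      exact (one_le_inv₀ (by positivity)).2 (pow_le_one₀ ha.le ha1)
  eq_one z hz := by
    refine invSqWeight_of_notMem fun hz' => ?_
    linarith [(mem_perforatedDisc.1 hz').1]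

theorem integral_potential_le (h : IsConfiguration J a K R R₀ pts deg u) (hJ : IsPotential J) :
    ∫ z, J (1 - (invSqWeight R R₀ pts u z)⁻¹) ≤ K * R₀ ^ 2 := by
  have hR₀ := h.radius_pos
  have h1 : ∫ z in perforatedDisc R R₀ pts, J (1 - (invSqWeight R R₀ pts u z)⁻¹)
      = ∫ z, J (1 - (invSqWeight R R₀ pts u z)⁻¹) :=
    setIntegral_eq_integral_of_forall_compl_eq_zero fun z hz => by
      rw [invSqWeight_of_notMem hz, inv_one, sub_self, hJ.zero]
  have h2 : ∫ z in perforatedDisc R R₀ pts, J (1 - (invSqWeight R R₀ pts u z)⁻¹)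
      = ∫ z in perforatedDisc R R₀ pts, J (1 - ‖u z‖ ^ 2) :=
    setIntegral_congr_fun (isOpen_perforatedDisc R R₀ pts).measurableSet fun z hz => by
      simp only [invSqWeight_of_mem hz, inv_inv]
  rw [← h1, h2]
  have := h.potential_le
  rw [one_div, inv_mul_le_iff₀ (by positivity)] at this
  linarith

/-- This is Young's inequality for the test field, with the canonical current `Σ dᵢ ∇θᵢ` added and
subtracted in the linear term. The canonical part joins the quadratic term to form the interactions;
the rest is the current defect. -/
theorem energyMinorant_le (h : IsConfiguration J a K R R₀ pts deg u) (ha : 0 < a) {z : ℂ}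
    (hz : z ∈ perforatedDisc R R₀ pts) : energyMinorant R R₀ pts deg u z ≤ gradSq u z := by
  set W := invSqWeight R R₀ pts u with hW
  let c : Fin m → ℝ := fun j => deg j * radialWeight W R R₀ pts j ‖z - pts j‖
  have key := two_mul_im_sub_le (fderiv ℝ u z) (h.ne_zero ha hz)
    (∑ j, c j • gradAngle (pts j) z)
  refine le_trans (le_of_eq ?_) key
  rw [norm_sum_smul_gradAngle_sq, map_sum, Finset.sum_div, Complex.im_sum]
  have hWz : (‖u z‖ ^ 2)⁻¹ = W z := (invSqWeight_of_mem hz).symm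
  rw [hWz, energyMinorant, Finset.sum_mul, Finset.mul_sum, Finset.mul_sum,
    ← Finset.sum_sub_distrib, ← Finset.sum_add_distrib]
  refine Finset.sum_congr rfl fun j _ => ?_
  rw [currentDefect, indicator_of_mem hz, map_smul, smul_div_assoc, Complex.smul_im, smul_eq_mul,
    mul_sub, mul_sub, mul_sub, Finset.mul_sum, Finset.mul_sum, Finset.mul_sum, Finset.sum_mul,
    add_sub, sub_eq_sub_iff_add_eq_add]
  have e : ∀ i, (deg i : ℝ) * deg j * interaction W R R₀ pts i j z
      + c i * c j * angleKernel (pts i) (pts j) z * W z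
      = 2 * (deg j * (radialWeight W R R₀ pts j ‖z - pts j‖
        * (deg i * angleKernel (pts i) (pts j) z))) := fun i => by
    simp only [interaction, c]
    ring
  have e2 : (∑ i, (deg i : ℝ) * deg j * interaction W R R₀ pts i j z)
      + ∑ i, c i * c j * angleKernel (pts i) (pts j) z * W z
      = ∑ i, 2 * (deg j * (radialWeight W R R₀ pts j ‖z - pts j‖
        * (deg i * angleKernel (pts i) (pts j) z))) := by
    rw [← Finset.sum_add_distrib]
    exact Finset.sum_congr rfl fun i _ => e i
  rw [add_right_comm, e2]
  simp only [c]
  ring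

theorem measurable_currentDefect (h : IsConfiguration J a K R R₀ pts deg u) (j : Fin m) :
    Measurable (currentDefect R R₀ pts deg u j) := by
  have hΩ := isOpen_perforatedDisc R R₀ pts
  -- Nothing is known about `u` far from `Ω`, so the denominator is cut off to be measurable on the
  -- whole plane.
  have hU : Measurable ((perforatedDisc R R₀ pts).indicator u) := by
    classical
    rw [← piecewise_eq_indicator]
    exact ContinuousOn.measurable_piecewise h.contDiffOn.continuousOn continuousOn_const
      hΩ.measurableSet
  have hT := measurable_gradAngle (pts j)
  have h1 : ∀ z, fderiv ℝ u z (gradAngle (pts j) z)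
      = ((gradAngle (pts j) z).re : ℂ) * fderiv ℝ u z 1
        + ((gradAngle (pts j) z).im : ℂ) * fderiv ℝ u z Complex.I := fun z => by
    rw [← Complex.real_smul, ← Complex.real_smul, ← map_smul, ← map_smul, ← map_add]
    congr 1
    simp
  have h2 : Measurable fun z => fderiv ℝ u z (gradAngle (pts j) z) := by
    simp only [h1]
    exact ((Complex.measurable_ofReal.comp (Complex.measurable_re.comp hT)).mul
      (measurable_fderiv_apply_const ℝ u 1)).add
      ((Complex.measurable_ofReal.comp (Complex.measurable_im.comp hT)).mul
      (measurable_fderiv_apply_const ℝ u Complex.I))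
  refine (Complex.measurable_im.comp (h2.div hU)).sub (Finset.measurable_sum _ fun i _ => ?_)
  exact (measurable_angleKernel _ _).const_mul _

theorem continuousOn_currentDefect (h : IsConfiguration J a K R R₀ pts deg u) (ha : 0 < a)
    (j : Fin m) : ContinuousOn (currentDefect R R₀ pts deg u j) (perforatedDisc R R₀ pts) := by
  have hΩ := isOpen_perforatedDisc R R₀ pts
  have hne : ∀ z ∈ perforatedDisc R R₀ pts, ∀ i, z - pts i ≠ 0 := fun z hz i h0 => by
    have := (mem_perforatedDisc.1 hz).2 i
    rw [h0, norm_zero] at this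
    linarith [h.radius_pos]
  have hT : ContinuousOn (gradAngle (pts j)) (perforatedDisc R R₀ pts) := by
    refine continuousOn_const.div (Complex.continuous_conj.comp_continuousOn (by fun_prop))
      fun z hz => ?_
    exact (map_ne_zero _).2 (hne z hz j)
  have hf : ContinuousOn (fderiv ℝ u) (perforatedDisc R R₀ pts) :=
    h.contDiffOn.continuousOn_fderiv_of_isOpen hΩ le_rfl
  refine ContinuousOn.sub ?_ (continuousOn_finsetSum _ fun i _ => ?_)
  · refine Complex.continuous_im.comp_continuousOn ?_
    refine (hf.clm_apply hT).div ?_ fun z hz => ?_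
    · exact h.contDiffOn.continuousOn.congr fun z hz => indicator_of_mem hz u
    · rw [indicator_of_mem hz]; exact h.ne_zero ha hz
  · refine continuousOn_const.mul (Complex.continuous_im.comp_continuousOn ?_)
    exact hT.div (by fun_prop) fun z hz => hne z hz i

theorem measurable_defect (h : IsConfiguration J a K R R₀ pts deg u) (ha : 0 < a) (ha1 : a ≤ 1)
    (j : Fin m) : Measurable fun z =>
      radialWeight (invSqWeight R R₀ pts u) R R₀ pts j ‖z - pts j‖
        * currentDefect R R₀ pts deg u j z :=
  (((h.isWeight ha ha1).measurable_radialWeight R₀ pts j).comp (by fun_prop)).mul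
    (h.measurable_currentDefect j)

/-- The derivative of `u` may blow up at `∂Ω`, but the good set is a compact subset of `Ω`, on which
the defect is bounded. -/
theorem integrable_defect (h : IsConfiguration J a K R R₀ pts deg u) (ha : 0 < a) (ha1 : a ≤ 1)
    (j : Fin m) : Integrable fun z =>
      radialWeight (invSqWeight R R₀ pts u) R R₀ pts j ‖z - pts j‖
        * currentDefect R R₀ pts deg u j z := by
  obtain ⟨M, hM⟩ := (isCompact_goodSet R R₀ pts j).exists_bound_of_continuousOn
    ((h.continuousOn_currentDefect ha j).mono (h.goodSet_subset j))
  refine integrable_of_bounded_of_support (h.measurable_defect ha ha1 j) (M := max M 0)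
    (ρ := R / 4) (c := pts j) (fun z => ?_) fun z hz => ?_
  · by_cases hz : z ∈ goodSet R R₀ pts j
    · have h1 := (h.isWeight ha ha1).radialWeight_mem (R₀ := R₀) (pts := pts) ha j ‖z - pts j‖
      rw [abs_mul, abs_of_nonneg h1.1]
      have h2 := hM z hz
      rw [Real.norm_eq_abs] at h2
      calc _ ≤ 1 * |currentDefect R R₀ pts deg u j z| := by gcongr; exact h1.2
        _ ≤ max M 0 := by rw [one_mul]; exact h2.trans (le_max_left _ _)
    · rw [radialWeight_of_notMem (show ‖z - pts j‖ ∉ goodRadii R R₀ pts j from hz), zero_mul,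
        abs_zero]
      exact le_max_right _ _
  · rw [radialWeight_of_notMem fun h => absurd h.2.1 (not_le.2 hz), zero_mul]

/-- On each good circle the radial weight factors out of the average, and the defect has zero
circulation. -/
theorem integral_defect (h : IsConfiguration J a K R R₀ pts deg u) (ha : 0 < a) (ha1 : a ≤ 1)
    (j : Fin m) : ∫ z, radialWeight (invSqWeight R R₀ pts u) R R₀ pts j ‖z - pts j‖
        * currentDefect R R₀ pts deg u j z = 0 := by
  have hR := h.radius_pos'
  have hR₀ := h.radius_pos
  obtain ⟨Ψ, hΨ, hΨe⟩ := h.exists_log ha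
  rw [integral_radial_mul (h.integrable_defect ha ha1 j) (h.measurable_defect ha ha1 j)]
  refine (setIntegral_congr_fun measurableSet_Ioi (g := fun _ => (0 : ℝ)) fun r hr => ?_).trans
    (by simp)
  have hr0 : 0 < r := hr
  beta_reduce
  by_cases hrS : r ∈ goodRadii R R₀ pts j
  · have hmem : ∀ t, circleMap (pts j) r t ∈ goodSet R R₀ pts j := fun t => by
      have : ‖circleMap (pts j) r t - pts j‖ = r := by simp [circleMap, abs_of_pos hr0]
      change ‖circleMap (pts j) r t - pts j‖ ∈ goodRadii R R₀ pts j
      rwa [this]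
    have hΩ : ∀ t, circleMap (pts j) r t ∈ perforatedDisc R R₀ pts := fun t =>
      h.goodSet_subset j (hmem t)
    have hb : ∀ t, circleMap (pts j) r t
        ∈ Metric.ball 0 (7 / 8 * R) \ ⋃ j, Metric.ball (pts j) R₀ := fun t => by
      refine ⟨?_, ?_⟩
      · rw [mem_ball_zero_iff]
        have h1 : ‖circleMap (pts j) r t‖ ≤ ‖circleMap (pts j) r t - pts j‖ + ‖pts j‖ :=
          norm_le_norm_sub_add _ _
        linarith [norm_sub_le_of_mem_goodSet (hmem t), h.norm_le j]
      · simp only [mem_iUnion, Metric.mem_ball, dist_eq_norm, not_exists, not_lt]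
        exact fun i => by linarith [le_norm_sub_of_mem_goodSet (hmem t) i]
    have h0 := circleAverage_current_sub hΨ hΨe (isOpen_perforatedDisc R R₀ pts) h.contDiffOn
      (fun z hz => h.ne_zero ha hz) (fun z hz i h0 => by
        have := (mem_perforatedDisc.1 hz).2 i
        rw [h0, sub_self, norm_zero] at this
        linarith) hr0 hΩ hb
    have h1 : Real.circleAverage (currentDefect R R₀ pts deg u j) (pts j) r = 0 := by
      rw [← h0]
      refine Real.circleAverage_congr_sphere fun z hz => ?_
      have hzr : ‖z - pts j‖ = r := by simpa [dist_eq_norm, abs_of_pos hr0] using hz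
      have hz' : z ∈ perforatedDisc R R₀ pts :=
        h.goodSet_subset j (show ‖z - pts j‖ ∈ goodRadii R R₀ pts j by rwa [hzr])
      simp only [currentDefect, indicator_of_mem hz']
    rw [h1]
    ring
  · rw [radialWeight_of_notMem hrS]
    ring

theorem integrable_energyMinorant (h : IsConfiguration J a K R R₀ pts deg u) (ha : 0 < a)
    (ha1 : a ≤ 1) : Integrable (energyMinorant R R₀ pts deg u) := by
  refine Integrable.add (integrable_finsetSum _ fun j _ => integrable_finsetSum _ fun i _ => ?_)
    (Integrable.const_mul (integrable_finsetSum _ fun j _ => ?_) 2)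
  · exact ((h.isWeight ha ha1).integrable_interaction ha h.radius_pos pts i j).const_mul _
  · exact (h.integrable_defect ha ha1 j).const_mul _

theorem integral_energyMinorant (h : IsConfiguration J a K R R₀ pts deg u) (ha : 0 < a)
    (ha1 : a ≤ 1) : ∫ z, energyMinorant R R₀ pts deg u z
      = ∑ j, ∑ i, (deg i : ℝ) * deg j
        * ∫ z, interaction (invSqWeight R R₀ pts u) R R₀ pts i j z := by
  have h1 : ∀ i j, Integrable fun z => (deg i : ℝ) * deg j
      * interaction (invSqWeight R R₀ pts u) R R₀ pts i j z := fun i j =>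
    ((h.isWeight ha ha1).integrable_interaction ha h.radius_pos pts i j).const_mul _
  have h2 : ∀ j, Integrable fun z => (deg j : ℝ)
      * (radialWeight (invSqWeight R R₀ pts u) R R₀ pts j ‖z - pts j‖
        * currentDefect R R₀ pts deg u j z) := fun j => (h.integrable_defect ha ha1 j).const_mul _
  unfold energyMinorant
  rw [integral_add (integrable_finsetSum _ fun j _ => integrable_finsetSum _ fun i _ => h1 i j)
    (Integrable.const_mul (integrable_finsetSum _ fun j _ => h2 j) 2), integral_const_mul,
    integral_finsetSum _ fun j _ => h2 j,
    integral_finsetSum _ fun j _ => integrable_finsetSum _ fun i _ => h1 i j]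
  have h3 : ∀ j, ∫ z, (deg j : ℝ) * (radialWeight (invSqWeight R R₀ pts u) R R₀ pts j ‖z - pts j‖
      * currentDefect R R₀ pts deg u j z) = 0 := fun j => by
    rw [integral_const_mul, h.integral_defect ha ha1 j, mul_zero]
  simp only [h3, Finset.sum_const_zero, mul_zero, add_zero]
  refine Finset.sum_congr rfl fun j _ => ?_
  rw [integral_finsetSum _ fun i _ => h1 i j]
  exact Finset.sum_congr rfl fun i _ => integral_const_mul _ _

theorem energyMinorant_of_notMem (h : IsConfiguration J a K R R₀ pts deg u) {z : ℂ}
    (hz : z ∉ perforatedDisc R R₀ pts) : energyMinorant R R₀ pts deg u z = 0 := by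
  have hj : ∀ j, z ∉ goodSet R R₀ pts j := fun j hzj => hz (h.goodSet_subset j hzj)
  have h1 : ∀ j, radialWeight (invSqWeight R R₀ pts u) R R₀ pts j ‖z - pts j‖ = 0 := fun j =>
    radialWeight_of_notMem (hj j)
  simp only [energyMinorant, interaction, h1]
  simp

/-- The minorant may be negative, so its positive part is compared with `gradSq`, which is
nonnegative; this also permits replacing `p₀` by `p`. -/
theorem ofReal_le_weightedEnergy (h : IsConfiguration J a K R R₀ pts deg u) (ha : 0 < a)
    (ha1 : a ≤ 1) {p : ℂ → ℝ} {p₀ : ℝ} (hp₀ : 0 < p₀)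
    (hp : ∀ z ∈ perforatedDisc R R₀ pts, p₀ ≤ p z) :
    ENNReal.ofReal (p₀ * ∑ j, ∑ i, (deg i : ℝ) * deg j
        * ∫ z, interaction (invSqWeight R R₀ pts u) R R₀ pts i j z)
      ≤ weightedEnergy p u (perforatedDisc R R₀ pts) := by
  have hΩ := (isOpen_perforatedDisc R R₀ pts).measurableSet
  have hi := h.integrable_energyMinorant ha ha1
  set G := energyMinorant R R₀ pts deg u with hG
  rw [← h.integral_energyMinorant ha ha1, ← hG, ← integral_const_mul,
    ← setIntegral_eq_integral_of_forall_compl_eq_zero (s := perforatedDisc R R₀ pts) fun z hz => by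
      rw [hG, h.energyMinorant_of_notMem hz, mul_zero]]
  have hpi : IntegrableOn (fun z => p₀ * G z) (perforatedDisc R R₀ pts) :=
    (hi.const_mul p₀).integrableOn
  calc _ ≤ ENNReal.ofReal (∫ z in perforatedDisc R R₀ pts, max (p₀ * G z) 0) :=
        ENNReal.ofReal_le_ofReal (integral_mono hpi hpi.pos_part fun z => le_max_left _ _)
    _ = ∫⁻ z in perforatedDisc R R₀ pts, ENNReal.ofReal (max (p₀ * G z) 0) :=
        ofReal_integral_eq_lintegral_ofReal hpi.pos_part
          (Filter.Eventually.of_forall fun z => le_max_right _ _)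
    _ ≤ weightedEnergy p u (perforatedDisc R R₀ pts) := by
        refine setLIntegral_mono' hΩ fun z hz => ?_
        have hg : 0 ≤ gradSq u z := by unfold gradSq; positivity
        refine ENNReal.ofReal_le_ofReal (max_le ?_ ?_)
        · calc p₀ * G z ≤ p₀ * gradSq u z := by
                gcongr; exact h.energyMinorant_le ha hz
            _ ≤ p z * gradSq u z := by gcongr; exact hp z hz
        · exact mul_nonneg (hp₀.le.trans (hp z hz)) hg

end IsConfiguration

/-! ### Summing the interactions -/

theorem sum_sum_eq_sum_add_sum_offDiag {m : ℕ} (f : Fin m → Fin m → ℝ) :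
    ∑ j, ∑ i, f i j
      = ∑ i, f i i + ∑ q ∈ (Finset.univ : Finset (Fin m)).offDiag, f q.1 q.2 := by
  rw [Finset.sum_comm, ← Finset.sum_product' Finset.univ Finset.univ f,
    ← Finset.diag_union_offDiag, Finset.sum_union (Finset.disjoint_diag_offDiag _),
    Finset.sum_diag]

/-- The lower bound for the energy of the test field. -/
theorem IsPotential.exists_interaction_bound {J : ℝ → ℝ} (hJ : IsPotential J) {a : ℝ} (K : ℝ)
    (ha : 0 < a) (ha1 : a ≤ 1) (m d : ℕ) :
    ∃ C : ℝ, 0 ≤ C ∧ ∀ (R R₀ : ℝ) (pts : Fin m → ℂ) (deg : Fin m → ℤ) (u : ℂ → ℂ),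
      IsConfiguration J a K R R₀ pts deg u → ∑ j, |deg j| = (d : ℤ) →
      2 * Real.pi * (∑ i, (deg i : ℝ) ^ 2) * (Real.log (R / R₀) - profileI J (R / R₀))
        + 2 * Real.pi * (∑ q ∈ (Finset.univ : Finset (Fin m)).offDiag,
            ((deg q.1 : ℝ) * (deg q.2 : ℝ) - (1 - a ^ 2) * |(deg q.1 : ℝ)| * |(deg q.2 : ℝ)|)
              * Real.log (R / ‖pts q.1 - pts q.2‖)) - C
      ≤ ∑ j, ∑ i, (deg i : ℝ) * deg j
        * ∫ z, interaction (invSqWeight R R₀ pts u) R R₀ pts i j z := by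
  obtain ⟨κ, hκ, hκJ⟩ := hJ.exists_support_line
  obtain ⟨C₀, hC₀, hCerr⟩ := hJ.exists_weight_error ha ha1
  -- In units of `R₀²`, `P` bounds both the potential of `u` and that of its circular means; the
  -- latter carries the Jensen factor `(a²)⁻¹/κ`.
  set P : ℝ := max 1 ((a ^ 2)⁻¹ / κ) * max K 0 with hP
  have hP0 : 0 ≤ P := by positivity
  set C₁ : ℝ := 2 * Real.pi * (Real.log 8 + m * Real.log 3 + Real.log (1 + P)) with hC₁
  set C₂ : ℝ := 12 * Real.pi + m * (12 * Real.pi) + C₀ * P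
    + 2 * Real.pi * (Real.log 4 + m * Real.log 3) with hC₂
  have hpi := Real.pi_pos
  have hl8 : 0 ≤ Real.log 8 := Real.log_nonneg (by norm_num)
  have hl4 : 0 ≤ Real.log 4 := Real.log_nonneg (by norm_num)
  have hl3 : 0 ≤ Real.log 3 := Real.log_nonneg (by norm_num)
  have hlP : 0 ≤ Real.log (1 + P) := Real.log_nonneg (by linarith)
  have hC₁0 : 0 ≤ C₁ := by positivity
  have hC₂0 : 0 ≤ C₂ := by positivity
  -- There are `m` diagonal and at most `m²` off-diagonal pairs, each with `|dᵢ dⱼ| ≤ d²`.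
  refine ⟨(m * d ^ 2) * C₁ + ((m * m : ℕ) * d ^ 2) * C₂, by positivity, ?_⟩
  intro R R₀ pts deg u h hdeg
  have hR₀ := h.radius_pos
  have hR := h.radius_pos'
  have hR4 : 4 * R₀ ≤ R := by linarith [h.radius_le]
  set W := invSqWeight R R₀ pts u with hWdef
  have hW : IsWeight W a R := h.isWeight ha ha1
  have hpts : ∀ k, ‖pts k‖ ≤ R := fun k => by linarith [h.norm_le k]
  have hdist : ∀ i j, ‖pts i - pts j‖ ≤ R := fun i j => by
    linarith [norm_sub_le (pts i) (pts j), h.norm_le i, h.norm_le j]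
  have hpot : ∫ z, J (1 - (W z)⁻¹) ≤ max K 0 * R₀ ^ 2 :=
    (h.integral_potential_le hJ).trans (by gcongr; exact le_max_left _ _)
  have hpotP : ∫ z, J (1 - (W z)⁻¹) ≤ P * R₀ ^ 2 := by
    refine hpot.trans ?_
    gcongr
    exact le_mul_of_one_le_left (le_max_right _ _) (le_max_left _ _)
  have hdefP : ∀ k, ∫ z, J (deficit W (pts k) ‖z - pts k‖) ≤ P * R₀ ^ 2 := fun k => by
    refine (hW.integral_deficit_le hJ ha hκ hκJ (hpts k)).trans ?_
    calc _ ≤ (a ^ 2)⁻¹ / κ * (max K 0 * R₀ ^ 2) := by gcongr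
      _ ≤ max 1 ((a ^ 2)⁻¹ / κ) * (max K 0 * R₀ ^ 2) := by gcongr; exact le_max_right _ _
      _ = P * R₀ ^ 2 := by rw [hP]; ring
  -- The dilation factor is `1 + P`: at least `1`, with a square large enough for the budget.
  have hlam : P * R₀ ^ 2 ≤ 2 * Real.pi * ((1 + P) ^ 2 * R₀ ^ 2) := by
    have h1 : P ≤ 2 * Real.pi * (1 + P) ^ 2 := by
      have : (1 : ℝ) ≤ 2 * Real.pi := by linarith [Real.pi_gt_three]
      calc P ≤ 1 * (1 + P) ^ 2 := by nlinarith
        _ ≤ 2 * Real.pi * (1 + P) ^ 2 := by gcongr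
    calc P * R₀ ^ 2 ≤ 2 * Real.pi * (1 + P) ^ 2 * R₀ ^ 2 := by gcongr
      _ = _ := by ring
  have hd : ∀ i, |(deg i : ℝ)| ≤ d := fun i => by
    have h1 : |deg i| ≤ (d : ℤ) := by
      rw [← hdeg]
      exact Finset.single_le_sum (fun j _ => abs_nonneg (deg j)) (Finset.mem_univ i)
    exact_mod_cast h1
  have hself : ∀ i, (deg i : ℝ) ^ 2 * (2 * Real.pi * (Real.log (R / R₀) - profileI J (R / R₀)))
      - d ^ 2 * C₁ ≤ (deg i : ℝ) * deg i * ∫ z, interaction W R R₀ pts i i z := fun i => by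
    have h1 := hW.le_integral_interaction_self hJ ha hR₀ hR4 i (fun k hk => h.separated k i hk)
      (hpts i) (lam := 1 + P) (by linarith) ((hdefP i).trans hlam)
    have h2 := mul_le_mul_of_nonneg_left h1 (sq_nonneg (deg i : ℝ))
    have h3 : (deg i : ℝ) ^ 2 * C₁ ≤ d ^ 2 * C₁ := by
      have : (deg i : ℝ) ^ 2 ≤ d ^ 2 := by
        rw [← sq_abs]
        exact pow_le_pow_left₀ (abs_nonneg _) (hd i) 2
      gcongr
    have h4 : (deg i : ℝ) * deg i = (deg i : ℝ) ^ 2 := (sq _).symm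
    rw [h4]
    have h5 : (deg i : ℝ) ^ 2 * (2 * Real.pi * (Real.log (R / R₀) - profileI J (R / R₀)
        - (Real.log 8 + m * Real.log 3 + Real.log (1 + P))))
        = (deg i : ℝ) ^ 2 * (2 * Real.pi * (Real.log (R / R₀) - profileI J (R / R₀)))
          - (deg i : ℝ) ^ 2 * C₁ := by rw [hC₁]; ring
    linarith
  have hoff : ∀ q ∈ (Finset.univ : Finset (Fin m)).offDiag,
      2 * Real.pi * (((deg q.1 : ℝ) * (deg q.2 : ℝ)
        - (1 - a ^ 2) * |(deg q.1 : ℝ)| * |(deg q.2 : ℝ)|)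
          * Real.log (R / ‖pts q.1 - pts q.2‖)) - d ^ 2 * C₂
      ≤ (deg q.1 : ℝ) * deg q.2 * ∫ z, interaction W R R₀ pts q.1 q.2 z := by
    intro q hq
    have hne : q.1 ≠ q.2 := (Finset.mem_offDiag.1 hq).2.2
    have h1 := hW.le_mul_integral_interaction hJ ha ha1 hR₀ hR hne h.separated
      (hdist _ _) hpts hC₀ hCerr hpotP hdefP ((deg q.1 : ℝ) * deg q.2)
    rw [abs_mul] at h1
    have h3 : |(deg q.1 : ℝ)| * |(deg q.2 : ℝ)| * C₂ ≤ d ^ 2 * C₂ := by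
      rw [sq]
      gcongr
      · exact hd _
      · exact hd _
    rw [← hC₂, ← mul_assoc (1 - a ^ 2)] at h1
    linarith
  rw [sum_sum_eq_sum_add_sum_offDiag fun i j =>
    (deg i : ℝ) * deg j * ∫ z, interaction W R R₀ pts i j z]
  have h1 := Finset.sum_le_sum fun i (_ : i ∈ (Finset.univ : Finset (Fin m))) => hself i
  have h2 := Finset.sum_le_sum hoff
  rw [Finset.sum_sub_distrib, ← Finset.sum_mul, Finset.sum_const, Finset.card_univ,
    Fintype.card_fin, nsmul_eq_mul] at h1
  rw [Finset.sum_sub_distrib, ← Finset.mul_sum, Finset.sum_const, nsmul_eq_mul] at h2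
  have h3 : (((Finset.univ : Finset (Fin m)).offDiag.card : ℕ) : ℝ) * (d ^ 2 * C₂)
      ≤ ((m * m : ℕ) * d ^ 2) * C₂ := by
    rw [← mul_assoc]
    gcongr
    rw [Finset.offDiag_card, Finset.card_univ, Fintype.card_fin]
    exact Nat.sub_le _ _
  have h4 : (∑ i, (deg i : ℝ) ^ 2) * (2 * Real.pi * (Real.log (R / R₀) - profileI J (R / R₀)))
      = 2 * Real.pi * (∑ i, (deg i : ℝ) ^ 2)
        * (Real.log (R / R₀) - profileI J (R / R₀)) := by ring
  rw [h4] at h1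
  linarith

end WeightedGL

end

/-- The constant `C` depends only on `J`, `p₀`, `a`, `K`, `m` and `d = ∑ |dⱼ|`. The energy is an
extended nonnegative number, so replacing a negative right-hand side by `0` loses nothing. -/
theorem mainTheorem3 (J : ℝ → ℝ) (hJ : WeightedGL.IsPotential J)
    (p₀ a K : ℝ) (hp₀ : 0 < p₀) (ha : 0 < a) (m d : ℕ) :
    ∃ C : ℝ, ∀ (R R₀ : ℝ) (pts : Fin m → ℂ) (deg : Fin m → ℤ) (p : ℂ → ℝ) (u : ℂ → ℂ),
      WeightedGL.IsConfiguration J a K R R₀ pts deg u →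
      ∑ j, |deg j| = (d : ℤ) →
      ContinuousOn p (WeightedGL.perforatedDisc R R₀ pts) →
      (∀ z ∈ WeightedGL.perforatedDisc R R₀ pts, p₀ ≤ p z) →
      ENNReal.ofReal
          (2 * Real.pi * p₀ * (∑ i, (deg i : ℝ) ^ 2)
              * (Real.log (R / R₀) - WeightedGL.profileI J (R / R₀))
            + 2 * Real.pi * p₀ * (∑ q ∈ (Finset.univ : Finset (Fin m)).offDiag,
                ((deg q.1 : ℝ) * (deg q.2 : ℝ) - (1 - a ^ 2) * |(deg q.1 : ℝ)| * |(deg q.2 : ℝ)|)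
                  * Real.log (R / ‖pts q.1 - pts q.2‖))
            - C)
        ≤ WeightedGL.weightedEnergy p u (WeightedGL.perforatedDisc R R₀ pts) ∧
      ((∀ i, 0 ≤ deg i) →
        ENNReal.ofReal
            (2 * Real.pi * p₀ * (∑ i, (deg i : ℝ) ^ 2)
                * (Real.log (R / R₀) - WeightedGL.profileI J (R / R₀))
              + 2 * Real.pi * p₀ * a ^ 2 * (∑ q ∈ (Finset.univ : Finset (Fin m)).offDiag,
                  (deg q.1 : ℝ) * (deg q.2 : ℝ) * Real.log (R / ‖pts q.1 - pts q.2‖))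
              - C)
          ≤ WeightedGL.weightedEnergy p u (WeightedGL.perforatedDisc R R₀ pts)) := by
  have key : ∃ C : ℝ, 0 ≤ C ∧ ∀ (R R₀ : ℝ) (pts : Fin m → ℂ) (deg : Fin m → ℤ) (p : ℂ → ℝ)
      (u : ℂ → ℂ), WeightedGL.IsConfiguration J a K R R₀ pts deg u →
      ∑ j, |deg j| = (d : ℤ) →
      (∀ z ∈ WeightedGL.perforatedDisc R R₀ pts, p₀ ≤ p z) →
      ENNReal.ofReal
          (2 * Real.pi * p₀ * (∑ i, (deg i : ℝ) ^ 2)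
              * (Real.log (R / R₀) - WeightedGL.profileI J (R / R₀))
            + 2 * Real.pi * p₀ * (∑ q ∈ (Finset.univ : Finset (Fin m)).offDiag,
                ((deg q.1 : ℝ) * (deg q.2 : ℝ) - (1 - a ^ 2) * |(deg q.1 : ℝ)| * |(deg q.2 : ℝ)|)
                  * Real.log (R / ‖pts q.1 - pts q.2‖))
            - C)
        ≤ WeightedGL.weightedEnergy p u (WeightedGL.perforatedDisc R R₀ pts) := by
    by_cases ha1 : a ≤ 1
    · obtain ⟨C, hC, hmain⟩ := hJ.exists_interaction_bound K ha ha1 m d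
      refine ⟨p₀ * C, by positivity, fun R R₀ pts deg p u h hdeg hp => ?_⟩
      refine le_trans (ENNReal.ofReal_le_ofReal ?_) (h.ofReal_le_weightedEnergy ha ha1 hp₀ hp)
      refine le_trans (le_of_eq ?_) (mul_le_mul_of_nonneg_left (hmain R R₀ pts deg u h hdeg) hp₀.le)
      ring
    -- For `a > 1` there can be no hole, so all sums are empty.
    · refine ⟨0, le_rfl, fun R R₀ pts deg p u h hdeg hp => ?_⟩
      have : IsEmpty (Fin m) := ⟨fun j => ha1 (h.le_one j)⟩
      simp
  obtain ⟨C, -, hC⟩ := key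
  refine ⟨C, fun R R₀ pts deg p u h hdeg _ hp => ⟨hC R R₀ pts deg p u h hdeg hp, fun hpos => ?_⟩⟩
  -- For nonnegative degrees the coefficient `dᵢdⱼ - (1 - a²)|dᵢ||dⱼ|` is `a² dᵢdⱼ`, so the two
  -- bounds coincide.
  have hs : a ^ 2 * (∑ q ∈ (Finset.univ : Finset (Fin m)).offDiag,
        (deg q.1 : ℝ) * (deg q.2 : ℝ) * Real.log (R / ‖pts q.1 - pts q.2‖))
      = ∑ q ∈ (Finset.univ : Finset (Fin m)).offDiag,
        ((deg q.1 : ℝ) * (deg q.2 : ℝ) - (1 - a ^ 2) * |(deg q.1 : ℝ)| * |(deg q.2 : ℝ)|)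
          * Real.log (R / ‖pts q.1 - pts q.2‖) := by
    rw [Finset.mul_sum]
    refine Finset.sum_congr rfl fun q _ => ?_
    have h1 : (0 : ℝ) ≤ deg q.1 := by exact_mod_cast hpos q.1
    have h2 : (0 : ℝ) ≤ deg q.2 := by exact_mod_cast hpos q.2
    rw [abs_of_nonneg h1, abs_of_nonneg h2]
    ring
  rw [mul_assoc (2 * Real.pi * p₀) (a ^ 2), hs]
  exact hC R R₀ pts deg p u h hdeg hp
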